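/- **Setting.** Let $\eta>0$, $\mu>\max\{1,1/\eta\}$, $\bar\gamma,\gamma\in(0,1)$, $0<\bar s<S$, $\varepsilon_*>0$. For a finitely supported $\ell\in\mathbb Z^{\mathbb N}$, $\mathbb N=\{1,2,\dots\}$, put $|\ell|_\eta=\sum_i i^\eta|\ell_i|$. Let $\mathcal H_s$ be the space of series $u(\varphi,x)=\sum_{\ell,j}u_j(\ell)e^{\mathrm i\ell\cdot\varphi+\mathrm ijx}$ that are real for real $(\varphi,x)$ and satisfy $|u|_s=\sum_{\ell,j}|u_j(\ell)|e^{s(|\ell|_\eta+|j|)}<\infty$. For $f$ depending on $\omega\in\mathcal O$ put $|f|^{\mathcal O}_s=\sup_{\omega\in\mathcal O}|f(\omega)|_s+\gamma\sup_{\omega_1\ne\omega_2\in\mathcal O}|f(\omega_1)-f(\omega_2)|_s/|\omega_1-\omega_2|_\infty$, and define $|a|^{\mathcal O}$ in the same way for real-valued $a$. Let $\mathtt D_{\bar\gamma}$ be the set of $\omega\in[1,2]^{\mathbb N}$ with $|\omega\cdot\ell|>\bar\gamma\prod_i(1+|\ell_i|^2i^2)^{-1}$ for all $\ell\ne0$.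 Put $\sigma_{-1}=\frac18\min\{S-\bar s,1\}$, $\sigma_n=\frac{6\sigma_{-1}}{\pi^2(n+1)^2}$ $(n\ge0)$, $s_0=S-\sigma_{-1}$, $s_{n+1}=s_n-6\sigma_n$, $\varepsilon_n=\varepsilon_*e^{-(3/2)^n}$; also $t_0=s_0$ and $t_n=s_{n-1}-3\sigma_{n-1}$ for $n\ge1$. The symplectic form on continuous $2\pi$-periodic functions of $x$ with zero average is $\int_{\mathbb T}(\partial_x^{-1}u)\,v\,dx$. A linear operator $P$ on functions of $x$ is Hamiltonian if, on smooth functions with zero average, its values have zero average and $\partial_x^{-1}P$ is $L^2$-symmetric. **Data at step $n\ge0$.** Let $\mathcal O\subseteq\mathtt D_{\bar\gamma}$ and let $$L_k=\omega\cdot\partial_\varphi+(1+A_k)\partial_x^3+B_k(\varphi,x)\partial_x+C_k(\varphi,x),\quad 0\le k\le n,\qquad Q_n(u)=\sum_{0\le i\le2,\ 0\le j\le3,\ i+j\le4}q_{ij}(\varphi,x)(\partial_x^iu)(\partial_x^ju)$$ depend on $\omega\in\mathcal O$, with $A_0=B_0=C_0=0$; with $B_n,C_n,q_{ij}\in\mathcal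 H_{t_n}$; with $\frac1{2\pi}\int_{\mathbb T}B_n\,dx$ independent of $\varphi$; and with $\sum_{i,j}|q_{ij}|^{\mathcal O}_{t_n}\le M$. Let $h_n\in\mathcal H_{s_n}$ have zero $x$-average and satisfy $|h_n|^{\mathcal O}_{s_n}\le\varepsilon_n$. Assume that for every $\omega\in\mathcal O$ and every real $\varphi$ the operator in $x$ given by $L_n+Q_n'(h_n)-\omega\cdot\partial_\varphi$ at $\varphi$ is Hamiltonian. **Proposition.** There are numbers $\tau_1,\tau_2>0$ such that for all $\eta,\mu,\bar\gamma,\gamma$ as above and all $M>0$ there are $C,C_1,K>0$, depending only on these, such that the following holds for all $\bar s,S,\varepsilon_*,n$ and all data as above. Assume $$\varepsilon_k\le\sigma_k^{\tau_1+1}e^{-C_1\sigma_k^{-\mu}}\quad(0\le k\le n),$$ and, for $0\le k<n$, $$|A_{k+1}-A_k|^{\mathcal O}\le\sigma_k^{-\tau_2}e^{C\sigma_k^{-\mu}}\varepsilon_k,\qquad |B_{k+1}-B_k|^{\mathcal O}_{s_k-3\sigma_k},\ |C_{k+1}-C_k|^{\mathcal O}_{s_k-3\sigma_k}\le K\sigma_k^{-\tau_2}e^{C\sigma_k^{-\mu}}\varepsilon_k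 .\tag{1}$$ Then there are $\xi(\varphi,x)$ and $\beta(\varphi),p(\varphi),\mathtt r(\varphi)$ in $\mathcal H_{s_n-\sigma_n}$, for each $\omega\in\mathcal O$, with $$|\xi|^{\mathcal O}_{s_n-\sigma_n},\ |\beta|^{\mathcal O}_{s_n-\sigma_n},\ |p|^{\mathcal O}_{s_n-\sigma_n},\ |\mathtt r-1|^{\mathcal O}_{s_n-\sigma_n}\le K\sigma_n^{-\tau_1}\varepsilon_ne^{C\sigma_n^{-\mu}},$$ and there are a real $A_{n+1}$ and $B_{n+1},C_{n+1}\in\mathcal H_{s_n-3\sigma_n}$, depending on $\omega\in\mathcal O$, such that for every $\omega\in\mathcal O$: 1. The operator $Tv(\varphi,x)=(1+\xi_x(\varphi,x))\,v(\varphi+\omega\beta(\varphi),\,x+\xi(\varphi,x)+p(\varphi))$ is well defined and invertible, and its inverse has the same form, with functions $\tilde\xi(\varphi,x),\tilde\beta(\varphi),\tilde p(\varphi)$ in $\mathcal H_{s_n-2\sigma_n}$. Both $T$ and $T^{-1}$ map $\mathcal H_s$ to $\mathcal H_{s-\sigma_n}$ with norm at most $2$ whenever $\sigma_n<s\le s_n-\sigma_n$.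 2. $T$ and $T^{-1}$ are symplectic: for every real $\varphi$ the maps $u\mapsto(1+\xi_x(\varphi,\cdot))\,u(\cdot+\xi(\varphi,\cdot)+p(\varphi))$ and $u\mapsto(1+\tilde\xi_x(\varphi,\cdot))\,u(\cdot+\tilde\xi(\varphi,\cdot)+\tilde p(\varphi))$ preserve the continuous $2\pi$-periodic functions with zero average and the symplectic form. 3. $\mathtt r\,T^{-1}(L_n+Q_n'(h_n))T=\omega\cdot\partial_\varphi+(1+A_{n+1})\partial_x^3+B_{n+1}(\varphi,x)\partial_x+C_{n+1}(\varphi,x)$ on $\bigcup_{s>0}\mathcal H_s$. 4. $\frac1{2\pi}\int_{\mathbb T}B_{n+1}(\varphi,x)\,dx$ does not depend on $\varphi$. Moreover (1) holds for $k=n$ with the same constants. -/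

import Mathlib

open scoped ENNReal

namespace AiryKAM

noncomputable section

/-! ### Analytic functions on the infinite torus -/

/-- Frequencies `(ℓ, j)` with `ℓ` a finitely supported integer vector (Fourier variable of `φ`) and
`j ∈ ℤ` (Fourier variable of `x`). The coordinates `1, 2, 3, …` of the infinite torus are numbered
`0, 1, 2, …` here, so that `i + 1` takes the place of `i` in all weights. -/
abbrev Freq : Type := (ℕ →₀ ℤ) × ℤ

/-- Formal Fourier series `∑ u (ℓ, j) e^{i ℓ·φ + i j x}`. -/
abbrev Fourier : Type := Freq → ℂ

/-- Functions of the real variables `(φ, x)`. -/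
abbrev Fn : Type := (ℕ → ℝ) → ℝ → ℝ

/-- `|ℓ|_η = ∑ i^η |ℓ_i|`. -/
def wt (η : ℝ) (l : ℕ →₀ ℤ) : ℝ := l.sum fun i a => ((i : ℝ) + 1) ^ η * |(a : ℝ)|

/-- `ℓ · φ`. -/
def dot (l : ℕ →₀ ℤ) (φ : ℕ → ℝ) : ℝ := l.sum fun i a => (a : ℝ) * φ i

/-- The norm `|u|_s = ∑ |u (ℓ, j)| e^{s (|ℓ|_η + |j|)}`, with value `∞` when the series diverges. -/
def anorm (η s : ℝ) (u : Fourier) : ℝ≥0∞ :=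
  ∑' k : Freq, ‖u k‖ₑ * ENNReal.ofReal (Real.exp (s * (wt η k.1 + |(k.2 : ℝ)|)))

/-- The function is real for real `(φ, x)`. -/
def RealOnReal (u : Fourier) : Prop := ∀ k, u (-k) = (starRingEnd ℂ) (u k)

/-- `𝓗(𝕋^∞_s × 𝕋_s)`: real on real functions, analytic on the strip of width `s`. -/
def Hs (η s : ℝ) : Set Fourier := {u | RealOnReal u ∧ anorm η s u < ∞}

/-- Functions of `φ` only. -/
def XIndep (u : Fourier) : Prop := ∀ l j, j ≠ 0 → u (l, j) = 0

/-- Zero average in `x`. -/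
def ZeroAverage (u : Fourier) : Prop := ∀ l, u (l, 0) = 0

/-- The constant function `1`. -/
def oneF : Fourier := Pi.single 0 1

/-- The value at a real point `(φ, x)`. It is used for real on real series only, for which the sum is
a real number. -/
def eval (u : Fourier) : Fn := fun φ x =>
  (∑' k : Freq, u k * Complex.exp (Complex.I * ((dot k.1 φ + (k.2 : ℝ) * x : ℝ) : ℂ))).re

/-! ### Frequency vectors and dependence on them -/

/-- Diophantine frequency vectors in `[1,2]^ℕ`. -/
def Dioph (γ : ℝ) : Set (ℕ → ℝ) :=
  {ω | (∀ i, ω i ∈ Set.Icc (1 : ℝ) 2) ∧ ∀ l : ℕ →₀ ℤ, l ≠ 0 →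
    γ * ∏ i ∈ l.support, 1 / (1 + |(l i : ℝ)| ^ 2 * ((i : ℝ) + 1) ^ 2) < |dot l ω|}

/-- `sup_{ω ∈ Ω} |f(ω)| + γ sup_{ω₁ ≠ ω₂ ∈ Ω} |f(ω₁) - f(ω₂)| / |ω₁ - ω₂|_∞`, where `N` is the norm of
the space in which `f` takes its values. -/
def lipNorm {Y : Type*} [Sub Y] (N : Y → ℝ≥0∞) (γ : ℝ) (Ω : Set (ℕ → ℝ)) (f : (ℕ → ℝ) → Y) : ℝ≥0∞ :=
  (⨆ ω ∈ Ω, N (f ω)) + ENNReal.ofReal γ *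
    ⨆ ω₁ ∈ Ω, ⨆ ω₂ ∈ Ω, ⨆ _ : ω₁ ≠ ω₂, N (f ω₁ - f ω₂) / ⨆ i : ℕ, ‖ω₁ i - ω₂ i‖ₑ

/-! ### The parameters of the scheme -/

/-- `σ_{-1}`. -/
def sigmaInit (S sbar : ℝ) : ℝ := min (S - sbar) 1 / 8

/-- `σ_n = 6 σ_{-1} / (π² (n+1)²)`. -/
def sigma (S sbar : ℝ) (n : ℕ) : ℝ := 6 * sigmaInit S sbar / (Real.pi ^ 2 * ((n : ℝ) + 1) ^ 2)

/-- `s_0 = S - σ_{-1}`, `s_{n+1} = s_n - 6 σ_n`. -/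
def width (S sbar : ℝ) : ℕ → ℝ
  | 0 => S - sigmaInit S sbar
  | n + 1 => width S sbar n - 6 * sigma S sbar n

/-- The width of the strip on which the operator of step `n` is analytic: `s_{n-1} - 3 σ_{n-1}` for
`n ≥ 1`; at step `0` all coefficients are constants and `s_0` is as good as any other width. -/
def widthCoeff (S sbar : ℝ) : ℕ → ℝ
  | 0 => width S sbar 0
  | n + 1 => width S sbar n - 3 * sigma S sbar n

/-- `ε_n = ε e^{-χ^n}` with `χ = 3/2`. -/
def eps (ε : ℝ) (n : ℕ) : ℝ := ε * Real.exp (-((3 / 2 : ℝ) ^ n))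

/-! ### Differential operators -/

/-- `∂_x^j g`. -/
def dx (j : ℕ) (g : Fn) : Fn := fun φ x => iteratedDeriv j (g φ) x

/-- `ω · ∂_φ g`. -/
def dphi (ω : ℕ → ℝ) (g : Fn) : Fn := fun φ x => deriv (fun t : ℝ => g (φ + t • ω) x) 0

/-- `L g = ω·∂_φ g + (1 + A) ∂_x³ g + B ∂_x g + C g`. -/
def airyOp (ω : ℕ → ℝ) (A : ℝ) (B C : Fourier) (g : Fn) : Fn := fun φ x =>
  dphi ω g φ x + (1 + A) * dx 3 g φ x + eval B φ x * dx 1 g φ x + eval C φ x * g φ x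

/-- The pairs `0 ≤ i ≤ 2`, `0 ≤ j ≤ 3`, `i + j ≤ 4`. -/
def quadIndex : Finset (ℕ × ℕ) :=
  (Finset.range 3 ×ˢ Finset.range 4).filter fun ij => ij.1 + ij.2 ≤ 4

/-- The bilinear map `(u, v) ↦ ∑ q_{ij} (∂_x^i u) (∂_x^j v)`; the quadratic nonlinearity is
`Q(u) = quadBil q u u`. -/
def quadBil (q : ℕ × ℕ → Fourier) (u v : Fn) : Fn := fun φ x =>
  ∑ ij ∈ quadIndex, eval (q ij) φ x * dx ij.1 u φ x * dx ij.2 v φ x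

/-- The differential `Q'(u)[v]` of the quadratic map `Q(u) = quadBil q u u`. -/
def quadDiff (q : ℕ × ℕ → Fourier) (u v : Fn) : Fn := fun φ x =>
  quadBil q u v φ x + quadBil q v u φ x

/-! ### Symplectic structure `J = ∂_x` on functions of `x` with zero average -/

/-- Average over a period. -/
def avg (u : ℝ → ℝ) : ℝ := 1 / (2 * Real.pi) * ∫ x in (0 : ℝ)..(2 * Real.pi), u x

/-- `∂_x^{-1} u`: the primitive with zero average. -/
def invDx (u : ℝ → ℝ) : ℝ → ℝ := fun x =>
  (∫ y in (0 : ℝ)..x, u y) - avg fun z => ∫ y in (0 : ℝ)..z, u y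

/-- The symplectic form `∫_𝕋 (∂_x^{-1} u) v dx`. -/
def sympForm (u v : ℝ → ℝ) : ℝ := ∫ x in (0 : ℝ)..(2 * Real.pi), invDx u x * v x

/-- Continuous `2π`-periodic functions with zero average. -/
def Phase : Set (ℝ → ℝ) :=
  {u | Continuous u ∧ Function.Periodic u (2 * Real.pi) ∧ avg u = 0}

/-- A map on functions of `x` that preserves the phase space and the symplectic form. -/
def IsSymplectic (Φ : (ℝ → ℝ) → ℝ → ℝ) : Prop :=
  (∀ u ∈ Phase, Φ u ∈ Phase) ∧ ∀ u ∈ Phase, ∀ v ∈ Phase, sympForm (Φ u) (Φ v) = sympForm u v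

/-- A linear operator of the form `∂_x ∘ S` with `S` symmetric in `L²(𝕋)`: its values have zero average
and `∂_x^{-1} P` is symmetric, on smooth functions with zero average. -/
def IsHamiltonian (P : (ℝ → ℝ) → ℝ → ℝ) : Prop :=
  (∀ u ∈ Phase, ContDiff ℝ (⊤ : ℕ∞) u → avg (P u) = 0) ∧
  ∀ u ∈ Phase, ∀ v ∈ Phase, ContDiff ℝ (⊤ : ℕ∞) u → ContDiff ℝ (⊤ : ℕ∞) v →
    sympForm (P u) v = sympForm (P v) u

/-! ### The changes of variables -/

/-- The action on functions of `x` at fixed `φ`: `u ↦ (1 + ξ_x(φ, ·)) u(· + ξ(φ, ·) + p(φ))`.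
Here `p` is a function of `φ` only and is evaluated at `x = 0`. -/
def fibre (ξ p : Fourier) (φ : ℕ → ℝ) (u : ℝ → ℝ) : ℝ → ℝ := fun x =>
  (1 + dx 1 (eval ξ) φ x) * u (x + eval ξ φ x + eval p φ 0)

/-- `T v (φ, x) = (1 + ξ_x(φ, x)) v(φ + ω β(φ), x + ξ(φ, x) + p(φ))`. -/
def changeVar (ω : ℕ → ℝ) (ξ β p : Fourier) (v : Fn) : Fn := fun φ =>
  fibre ξ p φ (v (φ + eval β φ 0 • ω))

/-- `T` is a bounded operator from analytic functions on the strip of width `s` to analytic functions on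
the strip of width `s - σ`, for all widths `σ < s ≤ smax`. -/
def BoundedOnStrips (η σ smax : ℝ) (T : Fn → Fn) : Prop :=
  ∀ s, σ < s → s ≤ smax → ∀ v ∈ Hs η s, ∃ w ∈ Hs η (s - σ),
    eval w = T (eval v) ∧ anorm η (s - σ) w ≤ 2 * anorm η s v

end

end AiryKAM

/-!
The operator `L_n + Q_n'(h_n)` has the form
`ω·∂_φ + a₃ ∂_x³ + a₂ ∂_x² + a₁ ∂_x + a₀`, where `a₃ - (1 + A_n)`, `a₂`, `a₁ - B_n`, `a₀ - C_n` are
linear in `h_n` and hence small. That `∂_x⁻¹` times its part in `x` is symmetric forces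
`a₂ = 2 ∂_x a₃` (`coeff_two_of_isHamiltonian`). A single change of variables
`V ↦ (1 + ξ_x) V(φ + ω β, x + ξ + p)` brings it to the normal form (`Scale.exists_reduction`):

* `ξ` is chosen such that `a₃ (1 + ξ_x)³` does not depend on `x` (`Scale.exists_change_x`). The weight
  `1 + ξ_x`, which makes the transformation symplectic (`isSymplectic_transport`), then also removes
  the coefficient of second order (`coeff_two_eq_zero`).
* `β(φ)` is chosen such that `a₃ (1 + ξ_x)³ = (1 + A_{n+1}) (1 + ω·∂_φ β)`
  (`Scale.exists_change_time`). The new coefficient of `ω·∂_φ` is `1 + ω·∂_φ β`, so that division by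
  it, which is what the factor `r` does, makes the coefficient of third order constant.
* `p(φ)` is chosen such that the `x`-average of the coefficient of first order is a constant multiple
  of `1 + ω·∂_φ β`, and becomes constant after the division (`Scale.exists_translation`).

The last two choices invert `ω·∂_φ` on functions of `φ`. The inverse change of variables is the limit
of an iteration (`exists_right_inverse`); that this right inverse is also a left inverse follows from
the monotonicity of the maps on the orbits of `ω` and on the fibres (`left_inverse`). The inverse is
written with `p̃ = 0`, the whole displacement of `x` being put into `ξ̃`.

For the estimates, functions of `(ω, φ, x)` are measured by the sum over the Fourier coefficients of
their Lipschitz norms in `ω`, with exponential weights (`Bd`, `RBd`). This gives a Banach algebra that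
allows power series, composition with changes of variables near the identity, and Cauchy estimates for
`∂_x` and `ω·∂_φ`, all uniformly in the infinitely many angles since `ω ∈ [1, 2]^ℕ`. This norm
dominates the norm `|·|^O_s`; in the other direction one loses a width `δ` and the sum of all weights
`e^{-δ (|ℓ|_η + |j|)}`. This sum and the small divisors `1 / (ω·ℓ)` are both controlled by
`∏ (1 + ℓ_i² i²)² ≤ e^{c δ^{-μ}} e^{δ |ℓ|_η}`, for `μ > 1/η` (`exists_divisorProd_le`,
`exists_tsum_weight_le`, `exists_smallDivisor_le`). Thus all constants at step `n`, also the powers of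
`1 / σ_n`, are powers of one number `D = e^{c σ_n^{-μ}}` (`Scale`, `exists_scale`). Their exponents are
absolute, the smallness assumption reads `D^60 ε_n ≤ 1`, and every quantity produced in the step is at
most `D^48 ε_n`. The bounds on `A_n, B_n, C_n` that this requires come from the sum of the increments,
which is at most `∑ σ_k ≤ 1/8` (`increment_le`, `lipNorm_le_sum`).
-/

open scoped ENNReal
open Filter Topology

namespace AiryKAM

noncomputable section

/-! ### The Lipschitz norm of scalar functions of the frequency -/

lemma lipNorm_le {Y : Type*} [Sub Y] {N : Y → ℝ≥0∞} {γ : ℝ} {O : Set (ℕ → ℝ)} {f : (ℕ → ℝ) → Y}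
    {a l c : ℝ≥0∞} (ha : ∀ ω ∈ O, N (f ω) ≤ a)
    (hl : ∀ ω₁ ∈ O, ∀ ω₂ ∈ O, ω₁ ≠ ω₂ → N (f ω₁ - f ω₂) / (⨆ i : ℕ, ‖ω₁ i - ω₂ i‖ₑ) ≤ l)
    (hc : a + ENNReal.ofReal γ * l ≤ c) : lipNorm N γ O f ≤ c := by
  refine le_trans ?_ hc
  unfold lipNorm
  gcongr
  · exact iSup₂_le ha
  · exact iSup₂_le fun ω₁ h₁ => iSup₂_le fun ω₂ h₂ => iSup_le fun h => hl ω₁ h₁ ω₂ h₂ h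

/-- The two parts of a Lipschitz norm: a bound for the values and one for the difference
quotients. -/
lemma exists_lipNorm_eq {Y : Type*} [Sub Y] (N : Y → ℝ≥0∞) (γ : ℝ) (O : Set (ℕ → ℝ))
    (f : (ℕ → ℝ) → Y) : ∃ a l : ℝ≥0∞, (∀ ω ∈ O, N (f ω) ≤ a) ∧
    (∀ ω₁ ∈ O, ∀ ω₂ ∈ O, ω₁ ≠ ω₂ → N (f ω₁ - f ω₂) / (⨆ i : ℕ, ‖ω₁ i - ω₂ i‖ₑ) ≤ l) ∧
    lipNorm N γ O f = a + ENNReal.ofReal γ * l := by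
  refine ⟨_, _, fun ω h => ?_, fun ω₁ h₁ ω₂ h₂ h => ?_, rfl⟩
  · exact le_iSup₂ (f := fun ω (_ : ω ∈ O) => N (f ω)) ω h
  · refine le_trans ?_ (le_iSup₂ ω₁ h₁)
    refine le_trans ?_ (le_iSup₂ ω₂ h₂)
    exact le_iSup (fun _ : ω₁ ≠ ω₂ => N (f ω₁ - f ω₂) / (⨆ i : ℕ, ‖ω₁ i - ω₂ i‖ₑ)) h

lemma le_lipNorm {Y : Type*} [Sub Y] {N : Y → ℝ≥0∞} {γ : ℝ} {O : Set (ℕ → ℝ)} {f : (ℕ → ℝ) → Y}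
    {ω : ℕ → ℝ} (h : ω ∈ O) : N (f ω) ≤ lipNorm N γ O f := by
  obtain ⟨a, l, h1, -, h3⟩ := exists_lipNorm_eq N γ O f
  rw [h3]
  exact (h1 ω h).trans le_self_add

/-- Comparison of Lipschitz norms of functions with values in possibly different spaces. -/
lemma lipNorm_le_mul {Y Z : Type*} [Sub Y] [Sub Z] {N : Y → ℝ≥0∞} {N' : Z → ℝ≥0∞} {γ : ℝ}
    {O : Set (ℕ → ℝ)} {f : (ℕ → ℝ) → Y} {g : (ℕ → ℝ) → Z} {c : ℝ≥0∞}
    (h1 : ∀ ω ∈ O, N (f ω) ≤ c * N' (g ω))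
    (h2 : ∀ ω₁ ∈ O, ∀ ω₂ ∈ O, N (f ω₁ - f ω₂) ≤ c * N' (g ω₁ - g ω₂)) :
    lipNorm N γ O f ≤ c * lipNorm N' γ O g := by
  obtain ⟨a, l, ha, hl, h⟩ := exists_lipNorm_eq N' γ O g
  rw [h]
  refine lipNorm_le (a := c * a) (l := c * l) (fun ω hω => (h1 ω hω).trans (by gcongr; exact ha ω hω))
    (fun ω₁ h₁ ω₂ h₂ hne => ?_) (le_of_eq (by ring))
  calc _ ≤ (c * N' (g ω₁ - g ω₂)) / (⨆ i : ℕ, ‖ω₁ i - ω₂ i‖ₑ) := by gcongr; exact h2 ω₁ h₁ ω₂ h₂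
    _ = c * (N' (g ω₁ - g ω₂) / (⨆ i : ℕ, ‖ω₁ i - ω₂ i‖ₑ)) := by rw [mul_div_assoc]
    _ ≤ _ := by gcongr; exact hl ω₁ h₁ ω₂ h₂ hne

lemma lipNorm_mono {Y Z : Type*} [Sub Y] [Sub Z] {N : Y → ℝ≥0∞} {N' : Z → ℝ≥0∞} {γ : ℝ}
    {O : Set (ℕ → ℝ)} {f : (ℕ → ℝ) → Y} {g : (ℕ → ℝ) → Z}
    (h1 : ∀ ω ∈ O, N (f ω) ≤ N' (g ω))
    (h2 : ∀ ω₁ ∈ O, ∀ ω₂ ∈ O, N (f ω₁ - f ω₂) ≤ N' (g ω₁ - g ω₂)) :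
    lipNorm N γ O f ≤ lipNorm N' γ O g := by
  simpa using lipNorm_le_mul (c := 1) (γ := γ) (N := N) (N' := N') (f := f) (g := g)
    (by simpa using h1) (by simpa using h2)

/-- The Lipschitz norm `sup |f| + γ Lip f` of a complex valued function of the frequency vector. -/
def lipC (γ : ℝ) (O : Set (ℕ → ℝ)) (f : (ℕ → ℝ) → ℂ) : ℝ≥0∞ := lipNorm (fun a : ℂ => ‖a‖ₑ) γ O f

section lipC

variable {γ : ℝ} {O : Set (ℕ → ℝ)} {f g : (ℕ → ℝ) → ℂ}

lemma enorm_le_lipC {ω : ℕ → ℝ} (h : ω ∈ O) : ‖f ω‖ₑ ≤ lipC γ O f :=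
  le_lipNorm (N := fun a : ℂ => ‖a‖ₑ) h

lemma lipC_subset {O' : Set (ℕ → ℝ)} (h : O' ⊆ O) : lipC γ O' f ≤ lipC γ O f := by
  obtain ⟨a, l, h1, h2, h3⟩ := exists_lipNorm_eq (fun a : ℂ => ‖a‖ₑ) γ O f
  unfold lipC
  rw [h3]
  exact lipNorm_le (fun ω hω => h1 ω (h hω)) (fun ω₁ h₁ ω₂ h₂ => h2 ω₁ (h h₁) ω₂ (h h₂)) le_rfl

lemma lipC_const (c : ℂ) : lipC γ O (fun _ => c) ≤ ‖c‖ₑ :=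
  lipNorm_le (a := ‖c‖ₑ) (l := 0) (fun _ _ => le_rfl) (fun _ _ _ _ _ => by simp) (by simp)

lemma lipC_zero : lipC γ O (fun _ => 0) = 0 := by
  simpa using lipC_const (γ := γ) (O := O) 0

lemma lipC_neg : lipC γ O (fun ω => - f ω) = lipC γ O f := by
  refine le_antisymm (lipNorm_mono (fun ω hω => ?_) fun ω₁ h₁ ω₂ h₂ => ?_)
    (lipNorm_mono (fun ω hω => ?_) fun ω₁ h₁ ω₂ h₂ => ?_)
  · simp
  · rw [← neg_sub', enorm_neg]
  · simp
  · rw [← neg_sub', enorm_neg]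

lemma lipC_conj : lipC γ O (fun ω => (starRingEnd ℂ) (f ω)) ≤ lipC γ O f := by
  refine lipNorm_mono (fun ω hω => ?_) fun ω₁ h₁ ω₂ h₂ => ?_
  · simp [enorm_eq_nnnorm]
  · rw [← map_sub, ← ofReal_norm, ← ofReal_norm, Complex.norm_conj]

lemma lipC_mul : lipC γ O (fun ω => f ω * g ω) ≤ lipC γ O f * lipC γ O g := by
  obtain ⟨a, l, h1, h2, h3⟩ := exists_lipNorm_eq (fun a : ℂ => ‖a‖ₑ) γ O f
  obtain ⟨a', l', h1', h2', h3'⟩ := exists_lipNorm_eq (fun a : ℂ => ‖a‖ₑ) γ O g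
  unfold lipC
  rw [h3, h3']
  refine lipNorm_le (a := a * a') (l := l * a' + a * l') (fun ω hω => ?_)
    (fun ω₁ H₁ ω₂ H₂ hne => ?_) ?_
  · rw [enorm_mul]
    exact mul_le_mul' (h1 ω hω) (h1' ω hω)
  · have e : f ω₁ * g ω₁ - f ω₂ * g ω₂ = (f ω₁ - f ω₂) * g ω₁ + f ω₂ * (g ω₁ - g ω₂) := by ring
    rw [e]
    calc _ ≤ (‖f ω₁ - f ω₂‖ₑ * ‖g ω₁‖ₑ + ‖f ω₂‖ₑ * ‖g ω₁ - g ω₂‖ₑ) / (⨆ i : ℕ, ‖ω₁ i - ω₂ i‖ₑ) := by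
          gcongr
          refine (enorm_add_le _ _).trans ?_
          rw [enorm_mul, enorm_mul]
      _ = (‖f ω₁ - f ω₂‖ₑ / (⨆ i : ℕ, ‖ω₁ i - ω₂ i‖ₑ)) * ‖g ω₁‖ₑ
          + ‖f ω₂‖ₑ * (‖g ω₁ - g ω₂‖ₑ / (⨆ i : ℕ, ‖ω₁ i - ω₂ i‖ₑ)) := by
          simp only [div_eq_mul_inv]; ring
      _ ≤ _ := add_le_add (mul_le_mul' (h2 _ H₁ _ H₂ hne) (h1' _ H₁))
          (mul_le_mul' (h1 _ H₂) (h2' _ H₁ _ H₂ hne))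
  · calc a * a' + ENNReal.ofReal γ * (l * a' + a * l')
        ≤ a * a' + ENNReal.ofReal γ * (l * a' + a * l')
          + ENNReal.ofReal γ * l * (ENNReal.ofReal γ * l') := le_self_add
      _ = _ := by ring

/-- The Lipschitz norm is countably subadditive. -/
lemma lipC_tsum {ι : Type*} {F : ι → (ℕ → ℝ) → ℂ} (hf : ∀ ω ∈ O, HasSum (fun i => F i ω) (f ω)) :
    lipC γ O f ≤ ∑' i, lipC γ O (F i) := by
  choose a l h1 h2 h3 using fun i => exists_lipNorm_eq (fun a : ℂ => ‖a‖ₑ) γ O (F i)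
  have e : ∑' i, lipC γ O (F i) = ∑' i, a i + ENNReal.ofReal γ * ∑' i, l i := by
    rw [← ENNReal.tsum_mul_left, ← ENNReal.tsum_add]
    exact tsum_congr h3
  rw [e]
  refine lipNorm_le (fun ω hω => ?_) (fun ω₁ H₁ ω₂ H₂ hne => ?_) le_rfl
  · rw [← (hf ω hω).tsum_eq]
    exact enorm_tsum_le_tsum_enorm.trans (ENNReal.tsum_le_tsum fun i => h1 i ω hω)
  · rw [← ((hf ω₁ H₁).sub (hf ω₂ H₂)).tsum_eq]
    calc _ ≤ (∑' i, ‖F i ω₁ - F i ω₂‖ₑ) / (⨆ i : ℕ, ‖ω₁ i - ω₂ i‖ₑ) := by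
          gcongr; exact enorm_tsum_le_tsum_enorm
      _ = ∑' i, ‖F i ω₁ - F i ω₂‖ₑ / (⨆ i : ℕ, ‖ω₁ i - ω₂ i‖ₑ) := by
          simp only [div_eq_mul_inv]; rw [ENNReal.tsum_mul_right]
      _ ≤ _ := ENNReal.tsum_le_tsum fun i => h2 i _ H₁ _ H₂ hne

lemma lipC_add : lipC γ O (fun ω => f ω + g ω) ≤ lipC γ O f + lipC γ O g := by
  have := lipC_tsum (γ := γ) (O := O) (f := fun ω => f ω + g ω)
    (F := fun b : Bool => if b then f else g) (fun ω _ => by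
      have := hasSum_fintype (fun b : Bool => (if b then f else g) ω)
      simpa using this)
  simpa [tsum_fintype] using this

end lipC

/-! ### Weights and exponentials -/

lemma wt_nonneg (η : ℝ) (l : ℕ →₀ ℤ) : 0 ≤ wt η l :=
  Finset.sum_nonneg fun i _ => by positivity

lemma wt_zero (η : ℝ) : wt η 0 = 0 := by simp [wt]

lemma wt_add_le (η : ℝ) (l l' : ℕ →₀ ℤ) : wt η (l + l') ≤ wt η l + wt η l' := by
  classical
  have h : ∀ m : ℕ →₀ ℤ, m.support ⊆ l.support ∪ l'.support →
      wt η m = ∑ i ∈ l.support ∪ l'.support, ((i : ℝ) + 1) ^ η * |(m i : ℝ)| := fun m hm =>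
    Finsupp.sum_of_support_subset _ hm _ (by simp)
  rw [h _ Finsupp.support_add, h l Finset.subset_union_left, h l' Finset.subset_union_right,
    ← Finset.sum_add_distrib]
  refine Finset.sum_le_sum fun i _ => ?_
  rw [← mul_add]
  gcongr
  push_cast [Finsupp.add_apply]
  exact abs_add_le _ _

lemma dot_add_left (l l' : ℕ →₀ ℤ) (φ : ℕ → ℝ) : dot (l + l') φ = dot l φ + dot l' φ :=
  Finsupp.sum_add_index' (by simp) (by intros; push_cast; ring)

lemma dot_neg_left (l : ℕ →₀ ℤ) (φ : ℕ → ℝ) : dot (-l) φ = - dot l φ := by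
  have := dot_add_left (-l) l φ
  rw [neg_add_cancel] at this
  have h0 : dot 0 φ = 0 := by simp [dot]
  linarith

lemma dot_zero_left (φ : ℕ → ℝ) : dot 0 φ = 0 := by simp [dot]

lemma dot_add_smul (l : ℕ →₀ ℤ) (φ ω : ℕ → ℝ) (t : ℝ) :
    dot l (φ + t • ω) = dot l φ + t * dot l ω := by
  unfold dot Finsupp.sum
  rw [Finset.mul_sum, ← Finset.sum_add_distrib]
  refine Finset.sum_congr rfl fun i _ => ?_
  simp; ring

lemma sum_abs_le_wt {η : ℝ} (hη : 0 < η) (l : ℕ →₀ ℤ) : ∑ i ∈ l.support, |(l i : ℝ)| ≤ wt η l := by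
  refine Finset.sum_le_sum fun i _ => ?_
  have : (1 : ℝ) ≤ ((i : ℝ) + 1) ^ η := Real.one_le_rpow (by linarith [Nat.cast_nonneg (α := ℝ) i]) hη.le
  nlinarith [abs_nonneg (l i : ℝ)]

/-- `|ω · ℓ|` is at most `3 |ℓ|_η` in the Lipschitz norm, when the frequencies lie in `[1,2]`. -/
lemma lipC_dot {η γ : ℝ} (hη : 0 < η) (hγ : γ < 1) {O : Set (ℕ → ℝ)}
    (hO : ∀ ω ∈ O, ∀ i, ω i ∈ Set.Icc (1 : ℝ) 2) (l : ℕ →₀ ℤ) :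
    lipC γ O (fun ω => (dot l ω : ℂ)) ≤ ENNReal.ofReal (3 * wt η l) := by
  have hs := sum_abs_le_wt hη l
  set N := ∑ i ∈ l.support, |(l i : ℝ)| with hN
  have hN0 : 0 ≤ N := Finset.sum_nonneg fun i _ => abs_nonneg _
  refine lipNorm_le (a := ENNReal.ofReal (2 * N)) (l := ENNReal.ofReal N) (fun ω hω => ?_)
    (fun ω₁ H₁ ω₂ H₂ hne => ?_) ?_
  · rw [← ofReal_norm, Complex.norm_real]
    refine ENNReal.ofReal_le_ofReal ?_
    rw [hN, Finset.mul_sum, Real.norm_eq_abs]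
    refine (Finset.abs_sum_le_sum_abs _ _).trans (Finset.sum_le_sum fun i _ => ?_)
    have := hO ω hω i
    rw [abs_mul, abs_of_nonneg (show 0 ≤ ω i by linarith [this.1])]
    nlinarith [this.2, abs_nonneg (l i : ℝ)]
  · refine ENNReal.div_le_of_le_mul ?_
    rw [← Complex.ofReal_sub, hN, ENNReal.ofReal_sum_of_nonneg fun i _ => abs_nonneg _,
      Finset.sum_mul]
    have e : dot l ω₁ - dot l ω₂ = ∑ i ∈ l.support, (l i : ℝ) * (ω₁ i - ω₂ i) := by
      unfold dot Finsupp.sum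
      rw [← Finset.sum_sub_distrib]
      exact Finset.sum_congr rfl fun i _ => by ring
    rw [e]
    push_cast
    refine (enorm_sum_le _ _).trans (Finset.sum_le_sum fun i _ => ?_)
    rw [enorm_mul]
    have h1 : ‖((l i : ℝ) : ℂ)‖ₑ = ENNReal.ofReal |(l i : ℝ)| := by
      rw [← ofReal_norm, Complex.norm_real, Real.norm_eq_abs]
    have h2 : ‖((ω₁ i : ℂ) - ω₂ i)‖ₑ = ‖ω₁ i - ω₂ i‖ₑ := by
      rw [← Complex.ofReal_sub, ← ofReal_norm, Complex.norm_real, ofReal_norm]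
    rw [h2]
    refine mul_le_mul' (le_of_eq ?_) (le_iSup (fun i => ‖ω₁ i - ω₂ i‖ₑ) i)
    exact_mod_cast h1
  · calc _ ≤ ENNReal.ofReal (2 * N) + 1 * ENNReal.ofReal N := by
          gcongr; exact ENNReal.ofReal_le_one.2 hγ.le
      _ = ENNReal.ofReal (3 * N) := by
          rw [one_mul, ← ENNReal.ofReal_add (by positivity) hN0]; congr 1; ring
      _ ≤ _ := ENNReal.ofReal_le_ofReal (by linarith)

/-- The size `|ℓ|_η + |j|` of a frequency. -/
def freqSize (η : ℝ) (k : Freq) : ℝ := wt η k.1 + |(k.2 : ℝ)|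

lemma freqSize_nonneg (η : ℝ) (k : Freq) : 0 ≤ freqSize η k := add_nonneg (wt_nonneg η _) (abs_nonneg _)

lemma freqSize_add_le (η : ℝ) (k k' : Freq) :
    freqSize η (k + k') ≤ freqSize η k + freqSize η k' := by
  have h1 := wt_add_le η k.1 k'.1
  have h2 := abs_add_le (k.2 : ℝ) (k'.2 : ℝ)
  simp only [freqSize, Prod.fst_add, Prod.snd_add]
  push_cast
  linarith

lemma freqSize_zero (η : ℝ) : freqSize η 0 = 0 := by simp [freqSize, wt_zero]

lemma freqSize_neg (η : ℝ) (k : Freq) : freqSize η (-k) = freqSize η k := by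
  simp [freqSize, wt, Finsupp.sum]

/-- The weight `e^{s (|ℓ|_η + |j|)}` of the norm `anorm`. -/
def weight (η s : ℝ) (k : Freq) : ℝ≥0∞ := ENNReal.ofReal (Real.exp (s * freqSize η k))

lemma one_le_weight {η s : ℝ} (hs : 0 ≤ s) (k : Freq) : 1 ≤ weight η s k := by
  unfold weight
  rw [ENNReal.one_le_ofReal, Real.one_le_exp_iff]
  exact mul_nonneg hs (freqSize_nonneg _ _)

lemma weight_mono {η s s' : ℝ} (h : s' ≤ s) (k : Freq) : weight η s' k ≤ weight η s k := by
  unfold weight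
  gcongr
  exact freqSize_nonneg _ _

lemma weight_add_le {η s : ℝ} (hs : 0 ≤ s) (k k' : Freq) :
    weight η s (k + k') ≤ weight η s k * weight η s k' := by
  unfold weight
  rw [← ENNReal.ofReal_mul (Real.exp_nonneg _), ← Real.exp_add, ← mul_add]
  gcongr
  exact freqSize_add_le _ _ _

/-- The exponential `e^{i ℓ·φ + i j x}`. -/
def mode (k : Freq) (φ : ℕ → ℝ) (x : ℝ) : ℂ :=
  Complex.exp (Complex.I * ((dot k.1 φ + (k.2 : ℝ) * x : ℝ) : ℂ))

lemma norm_mode (k : Freq) (φ : ℕ → ℝ) (x : ℝ) : ‖mode k φ x‖ = 1 := by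
  unfold mode
  rw [mul_comm]
  exact Complex.norm_exp_ofReal_mul_I _

lemma mode_add (k k' : Freq) (φ : ℕ → ℝ) (x : ℝ) : mode (k + k') φ x = mode k φ x * mode k' φ x := by
  unfold mode
  rw [← Complex.exp_add, Prod.fst_add, Prod.snd_add, dot_add_left]
  congr 1
  push_cast
  ring

lemma mode_zero (φ : ℕ → ℝ) (x : ℝ) : mode 0 φ x = 1 := by simp [mode, dot_zero_left]

lemma conj_mode (k : Freq) (φ : ℕ → ℝ) (x : ℝ) : (starRingEnd ℂ) (mode k φ x) = mode (-k) φ x := by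
  unfold mode
  rw [← Complex.exp_conj]
  congr 1
  simp [dot_neg_left]
  ring

/-! ### Functions with absolutely convergent Fourier series -/

/-- `F`, a function of `(ω, φ, x)`, has for `ω ∈ O` an expansion `∑ u_k(ω) e^{i k·(φ, x)}` with
`∑ |u_k|^O e^{s|k|} ≤ c`. The Lipschitz norm of each coefficient is taken before the sum, which gives
the norm of a Banach algebra over the Lipschitz functions of `ω`; it bounds `|F|^O_s`, and conversely
it is bounded by `|F|^O_{s'}` for `s' > s` up to a factor. -/
def Bd (η γ : ℝ) (O : Set (ℕ → ℝ)) (s : ℝ) (c : ℝ≥0∞) (F : (ℕ → ℝ) → (ℕ → ℝ) → ℝ → ℂ) : Prop :=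
  ∃ u : Freq → (ℕ → ℝ) → ℂ, ∑' k, lipC γ O (u k) * weight η s k ≤ c ∧
    ∀ ω ∈ O, ∀ φ x, HasSum (fun k => u k ω * mode k φ x) (F ω φ x)

section Bd

variable {η γ : ℝ} {O : Set (ℕ → ℝ)} {s : ℝ} {c c' : ℝ≥0∞} {F G : (ℕ → ℝ) → (ℕ → ℝ) → ℝ → ℂ}

lemma Bd.congr (h : Bd η γ O s c F) (hFG : ∀ ω ∈ O, ∀ φ x, F ω φ x = G ω φ x) : Bd η γ O s c G := by
  obtain ⟨u, h1, h2⟩ := h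
  exact ⟨u, h1, fun ω hω φ x => hFG ω hω φ x ▸ h2 ω hω φ x⟩

lemma Bd.mono {s' : ℝ} (h : Bd η γ O s c F) (hs : s' ≤ s) (hc : c ≤ c') : Bd η γ O s' c' F := by
  obtain ⟨u, h1, h2⟩ := h
  refine ⟨u, le_trans (ENNReal.tsum_le_tsum fun k => ?_) (h1.trans hc), h2⟩
  gcongr
  exact weight_mono hs k

lemma Bd.subset {O' : Set (ℕ → ℝ)} (h : Bd η γ O s c F) (hO : O' ⊆ O) : Bd η γ O' s c F := by
  obtain ⟨u, h1, h2⟩ := h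
  refine ⟨u, le_trans (ENNReal.tsum_le_tsum fun k => ?_) h1, fun ω hω => h2 ω (hO hω)⟩
  gcongr
  exact lipC_subset hO

/-- A single exponential. -/
lemma Bd.mode_term (u : (ℕ → ℝ) → ℂ) (k : Freq) :
    Bd η γ O s (lipC γ O u * weight η s k) (fun ω φ x => u ω * mode k φ x) := by
  classical
  refine ⟨fun j => if j = k then u else fun _ => 0, ?_, fun ω hω φ x => ?_⟩
  · rw [tsum_eq_single k]
    · simp
    · intro j hj
      simp [hj, lipC_zero]
  · have := hasSum_single (f := fun j => (if j = k then u else fun _ => 0) ω * mode j φ x) k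
      (fun j hj => by simp [hj])
    simpa using this

/-- A function of the frequency vector alone. -/
lemma Bd.of_omega (u : (ℕ → ℝ) → ℂ) : Bd η γ O s (lipC γ O u) (fun ω _ _ => u ω) := by
  have := Bd.mode_term (η := η) (γ := γ) (O := O) (s := s) u 0
  simpa [mode_zero, weight, freqSize_zero] using this

lemma Bd.const (a : ℂ) : Bd η γ O s ‖a‖ₑ (fun _ _ _ => a) :=
  (Bd.of_omega fun _ => a).mono le_rfl (lipC_const a)

lemma summable_of_lipC {u : Freq → (ℕ → ℝ) → ℂ} (hs : 0 ≤ s)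
    (h : ∑' k, lipC γ O (u k) * weight η s k ≠ ∞) {ω : ℕ → ℝ} (hω : ω ∈ O) (φ : ℕ → ℝ) (x : ℝ) :
    Summable fun k => ‖u k ω * mode k φ x‖ := by
  rw [← tsum_enorm_ne_top_iff_summable_norm]
  refine ne_top_of_le_ne_top h (ENNReal.tsum_le_tsum fun k => ?_)
  rw [enorm_mul]
  refine mul_le_mul' (enorm_le_lipC hω) ?_
  rw [← ofReal_norm, norm_mode, ENNReal.ofReal_one]
  exact one_le_weight hs k

/-- Summation of series of functions, the completeness of the algebra. -/
lemma Bd.tsum {ι : Type*} {F : ι → (ℕ → ℝ) → (ℕ → ℝ) → ℝ → ℂ} {c : ι → ℝ≥0∞} (hs : 0 ≤ s)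
    (hc : ∑' i, c i ≤ c') (hc' : c' ≠ ∞) (hF : ∀ i, Bd η γ O s (c i) (F i))
    (hG : ∀ ω ∈ O, ∀ φ x, HasSum (fun i => F i ω φ x) (G ω φ x)) : Bd η γ O s c' G := by
  choose u h1 h2 using hF
  have hT : ∑' k, ∑' i, lipC γ O (u i k) * weight η s k ≤ c' := by
    rw [ENNReal.tsum_comm]
    exact (ENNReal.tsum_le_tsum h1).trans hc
  have hsum : ∀ k : Freq, ∀ ω ∈ O, Summable fun i => u i k ω := by
    intro k ω hω
    refine Summable.of_enorm (ne_top_of_le_ne_top hc' (le_trans ?_ ((ENNReal.le_tsum k).trans hT)))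
    refine ENNReal.tsum_le_tsum fun i => ?_
    calc ‖u i k ω‖ₑ ≤ lipC γ O (u i k) * 1 := by rw [mul_one]; exact enorm_le_lipC hω
      _ ≤ _ := by gcongr; exact one_le_weight hs k
  refine ⟨fun k ω => ∑' i, u i k ω, le_trans (ENNReal.tsum_le_tsum fun k => ?_) hT,
    fun ω hω φ x => ?_⟩
  · rw [ENNReal.tsum_mul_right]
    gcongr
    exact lipC_tsum fun ω hω => (hsum k ω hω).hasSum
  · have hdouble : Summable fun p : ι × Freq => u p.1 p.2 ω * mode p.2 φ x := by
      refine Summable.of_enorm (ne_top_of_le_ne_top hc' (le_trans ?_ hT))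
      rw [ENNReal.tsum_prod', ENNReal.tsum_comm]
      refine ENNReal.tsum_le_tsum fun k => ENNReal.tsum_le_tsum fun i => ?_
      rw [enorm_mul, ← ofReal_norm (mode k φ x), norm_mode, ENNReal.ofReal_one]
      exact mul_le_mul' (enorm_le_lipC hω) (one_le_weight hs k)
    have hA := hdouble.hasSum.prod_fiberwise fun i => h2 i ω hω φ x
    have hB := ((Equiv.prodComm Freq ι).hasSum_iff.2 hdouble.hasSum).prod_fiberwise
      (g := fun k => (∑' i, u i k ω) * mode k φ x)
      fun k => by simpa using (hsum k ω hω).hasSum.mul_right (mode k φ x)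
    rwa [hA.unique (hG ω hω φ x)] at hB

lemma Bd.add (hF : Bd η γ O s c F) (hG : Bd η γ O s c' G) :
    Bd η γ O s (c + c') (fun ω φ x => F ω φ x + G ω φ x) := by
  obtain ⟨u, h1, h2⟩ := hF
  obtain ⟨v, h3, h4⟩ := hG
  refine ⟨fun k ω => u k ω + v k ω, le_trans (ENNReal.tsum_le_tsum fun k => ?_)
    (ENNReal.tsum_add.trans_le (add_le_add h1 h3)), fun ω hω φ x => ?_⟩
  · rw [← add_mul]
    gcongr
    exact lipC_add
  · simp_rw [add_mul]
    exact (h2 ω hω φ x).add (h4 ω hω φ x)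

lemma Bd.neg (hF : Bd η γ O s c F) : Bd η γ O s c (fun ω φ x => - F ω φ x) := by
  obtain ⟨u, h1, h2⟩ := hF
  refine ⟨fun k ω => - u k ω, by simpa only [lipC_neg] using h1, fun ω hω φ x => ?_⟩
  simp_rw [neg_mul]
  exact (h2 ω hω φ x).neg

end Bd

section Bd

variable {η γ : ℝ} {O : Set (ℕ → ℝ)} {s : ℝ} {c c' : ℝ≥0∞} {F G : (ℕ → ℝ) → (ℕ → ℝ) → ℝ → ℂ}

lemma tsum_lipC_mul_le (hs : 0 ≤ s) {u v : Freq → (ℕ → ℝ) → ℂ} 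
    (h1 : ∑' k, lipC γ O (u k) * weight η s k ≤ c) (h3 : ∑' k, lipC γ O (v k) * weight η s k ≤ c') :
    ∑' p : Freq × Freq, lipC γ O (fun ω => u p.1 ω * v p.2 ω) * weight η s (p.1 + p.2)
      ≤ c * c' := by
  calc _ ≤ ∑' p : Freq × Freq, (lipC γ O (u p.1) * weight η s p.1)
        * (lipC γ O (v p.2) * weight η s p.2) := by
        refine ENNReal.tsum_le_tsum fun p => ?_
        calc _ ≤ (lipC γ O (u p.1) * lipC γ O (v p.2)) * (weight η s p.1 * weight η s p.2) :=
              mul_le_mul' lipC_mul (weight_add_le hs _ _)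
          _ = _ := by ring
    _ = (∑' k, lipC γ O (u k) * weight η s k) * ∑' k, lipC γ O (v k) * weight η s k := by
        rw [ENNReal.tsum_prod']
        simp_rw [ENNReal.tsum_mul_left, ENNReal.tsum_mul_right]
    _ ≤ _ := mul_le_mul' h1 h3

/-- The submultiplicativity of the norm. -/
lemma Bd.mul (hs : 0 ≤ s) (hF : Bd η γ O s c F) (hG : Bd η γ O s c' G) (hc : c ≠ ∞) (hc' : c' ≠ ∞) :
    Bd η γ O s (c * c') (fun ω φ x => F ω φ x * G ω φ x) := by
  obtain ⟨u, h1, h2⟩ := hF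
  obtain ⟨v, h3, h4⟩ := hG
  have hT := tsum_lipC_mul_le hs h1 h3
  refine Bd.tsum (ι := Freq × Freq)
    (F := fun p ω φ x => (u p.1 ω * v p.2 ω) * mode (p.1 + p.2) φ x) hs hT (ENNReal.mul_ne_top hc hc')
    (fun p => Bd.mode_term (fun ω => u p.1 ω * v p.2 ω) (p.1 + p.2)) fun ω hω φ x => ?_
  obtain ⟨f, hf⟩ : ∃ f, f = fun k => u k ω * mode k φ x := ⟨_, rfl⟩
  obtain ⟨g, hg⟩ : ∃ g, g = fun k => v k ω * mode k φ x := ⟨_, rfl⟩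
  have e1 : Summable fun k => ‖f k‖ := by
    rw [hf]; exact summable_of_lipC hs (ne_top_of_le_ne_top hc h1) hω φ x
  have e2 : Summable fun k => ‖g k‖ := by
    rw [hg]; exact summable_of_lipC hs (ne_top_of_le_ne_top hc' h3) hω φ x
  have a1 : HasSum f (F ω φ x) := hf ▸ h2 ω hω φ x
  have a2 : HasSum g (G ω φ x) := hg ▸ h4 ω hω φ x
  have e : (fun p : Freq × Freq => f p.1 * g p.2)
      = fun p => (u p.1 ω * v p.2 ω) * mode (p.1 + p.2) φ x := by
    funext p
    rw [mode_add, hf, hg]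
    ring
  rw [← e]
  exact a1.mul a2 (summable_mul_of_summable_norm e1 e2)

end Bd

/-! ### Power series of functions with absolutely convergent Fourier series -/

lemma hasSum_of_eq {ι E : Type*} [AddCommMonoid E] [TopologicalSpace E] {f g : ι → E} {a : E}
    (h : HasSum f a) (hfg : ∀ i, f i = g i) : HasSum g a :=
  (funext hfg : f = g) ▸ h

section Bd

variable {η γ : ℝ} {O : Set (ℕ → ℝ)} {s : ℝ} {c c' : ℝ≥0∞} {F G : (ℕ → ℝ) → (ℕ → ℝ) → ℝ → ℂ}

lemma Bd.pow (hs : 0 ≤ s) (hF : Bd η γ O s c F) (hc : c ≠ ∞) (n : ℕ) :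
    Bd η γ O s (c ^ n) (fun ω φ x => F ω φ x ^ n) := by
  induction n with
  | zero => simpa using Bd.const (η := η) (γ := γ) (O := O) (s := s) 1
  | succ n ih =>
    simp_rw [pow_succ]
    exact ih.mul hs hF (ENNReal.pow_ne_top hc) hc

lemma Bd.const_mul (hs : 0 ≤ s) (a : ℂ) (hF : Bd η γ O s c F) (hc : c ≠ ∞) :
    Bd η γ O s (‖a‖ₑ * c) (fun ω φ x => a * F ω φ x) :=
  (Bd.const a).mul hs hF enorm_ne_top hc

/-- Power series without constant term. -/
lemma Bd.powerSeries (hs : 0 ≤ s) {a : ℕ → ℝ} {b B : ℝ} (hb : 0 ≤ b)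
    (hF : Bd η γ O s (ENNReal.ofReal b) F) (ha : HasSum (fun n => |a n| * b ^ (n + 1)) B)
    (hG : ∀ ω ∈ O, ∀ φ x, HasSum (fun n => (a n : ℂ) * F ω φ x ^ (n + 1)) (G ω φ x)) :
    Bd η γ O s (ENNReal.ofReal B) G := by
  refine Bd.tsum (ι := ℕ) (F := fun n ω φ x => (a n : ℂ) * F ω φ x ^ (n + 1))
    (c := fun n => ENNReal.ofReal (|a n| * b ^ (n + 1))) hs ?_ ENNReal.ofReal_ne_top (fun n => ?_) hG
  · rw [← ha.tsum_eq, ENNReal.ofReal_tsum_of_nonneg (fun n => by positivity) ha.summable]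
  · refine ((hF.pow hs ENNReal.ofReal_ne_top (n + 1)).const_mul hs (a n : ℂ)
      (ENNReal.pow_ne_top ENNReal.ofReal_ne_top)).mono le_rfl (le_of_eq ?_)
    rw [ENNReal.ofReal_mul (abs_nonneg _), ENNReal.ofReal_pow hb, ← ofReal_norm, Complex.norm_real,
      Real.norm_eq_abs]

lemma hasSum_exp_sub_one (z : ℂ) :
    HasSum (fun n : ℕ => ((((n + 1).factorial : ℝ)⁻¹ : ℝ) : ℂ) * z ^ (n + 1)) (Complex.exp z - 1) := by
  have h := NormedSpace.expSeries_div_hasSum_exp z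
  rw [← Complex.exp_eq_exp_ℂ] at h
  have h2 := (hasSum_nat_add_iff' 1).2 h
  simp only [Finset.range_one, Finset.sum_singleton, pow_zero, Nat.factorial_zero, Nat.cast_one,
    div_one] at h2
  refine hasSum_of_eq h2 fun n => ?_
  push_cast
  rw [div_eq_mul_inv, mul_comm]

lemma Bd.exp_sub_one (hs : 0 ≤ s) {b : ℝ} (hb : 0 ≤ b) (hF : Bd η γ O s (ENNReal.ofReal b) F) :
    Bd η γ O s (ENNReal.ofReal (Real.exp b - 1)) (fun ω φ x => Complex.exp (F ω φ x) - 1) := by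
  refine hF.powerSeries hs hb (a := fun n => ((n + 1).factorial : ℝ)⁻¹) ?_
    fun ω _ φ x => hasSum_exp_sub_one _
  have h := hasSum_exp_sub_one (b : ℂ)
  have h2 : HasSum (fun n : ℕ => |(((n + 1).factorial : ℝ)⁻¹)| * b ^ (n + 1)) (Real.exp b - 1) := by
    refine Complex.hasSum_ofReal.1 ?_
    push_cast
    refine hasSum_of_eq h fun n => ?_
    rw [abs_of_nonneg (by positivity)]
  exact h2

lemma Bd.exp (hs : 0 ≤ s) {b : ℝ} (hb : 0 ≤ b) (hF : Bd η γ O s (ENNReal.ofReal b) F) :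
    Bd η γ O s (ENNReal.ofReal (Real.exp b)) (fun ω φ x => Complex.exp (F ω φ x)) := by
  refine (((hF.exp_sub_one hs hb).add (Bd.const 1)).congr fun ω _ φ x => by ring).mono le_rfl ?_
  have h1 : (‖(1 : ℂ)‖ₑ : ℝ≥0∞) = ENNReal.ofReal 1 := by simp
  rw [h1, ← ENNReal.ofReal_add (by linarith [Real.add_one_le_exp b]) zero_le_one]
  simp

lemma Bd.ofReal_add {b b' : ℝ} (hb : 0 ≤ b) (hb' : 0 ≤ b') (hF : Bd η γ O s (ENNReal.ofReal b) F)
    (hG : Bd η γ O s (ENNReal.ofReal b') G) :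
    Bd η γ O s (ENNReal.ofReal (b + b')) (fun ω φ x => F ω φ x + G ω φ x) := by
  rw [ENNReal.ofReal_add hb hb']
  exact hF.add hG

lemma Bd.ofReal_mul (hs : 0 ≤ s) {b b' : ℝ} (hb : 0 ≤ b) (hF : Bd η γ O s (ENNReal.ofReal b) F)
    (hG : Bd η γ O s (ENNReal.ofReal b') G) :
    Bd η γ O s (ENNReal.ofReal (b * b')) (fun ω φ x => F ω φ x * G ω φ x) := by
  rw [ENNReal.ofReal_mul hb]
  exact hF.mul hs hG ENNReal.ofReal_ne_top ENNReal.ofReal_ne_top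

/-! ### Composition with a change of variables -/

lemma mode_comp (k : Freq) (φ ω : ℕ → ℝ) (x t y : ℝ) :
    mode k (φ + t • ω) (x + y) =
      mode k φ x * Complex.exp (Complex.I * ((dot k.1 ω : ℂ) * t + (k.2 : ℂ) * y)) := by
  unfold mode
  rw [← Complex.exp_add, dot_add_smul]
  congr 1
  push_cast
  ring

/-- The phase shift that a displacement `(t ω, y)` causes in the exponential of index `k`. -/
lemma Bd.phase (hη : 0 < η) (hγ : γ < 1) (hO : ∀ ω ∈ O, ∀ i, ω i ∈ Set.Icc (1 : ℝ) 2) (hs : 0 ≤ s)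
    {b : ℝ} (hb : 0 ≤ b) {f g : (ℕ → ℝ) → (ℕ → ℝ) → ℝ → ℂ} (hf : Bd η γ O s (ENNReal.ofReal b) f)
    (hg : Bd η γ O s (ENNReal.ofReal b) g) (k : Freq) :
    Bd η γ O s (ENNReal.ofReal (3 * b * freqSize η k))
      (fun ω φ x => Complex.I * ((dot k.1 ω : ℂ) * f ω φ x + (k.2 : ℂ) * g ω φ x)) := by
  have hw := wt_nonneg η k.1
  have h1 := ((Bd.of_omega (η := η) (s := s) fun ω => (dot k.1 ω : ℂ)).mono le_rfl
    (lipC_dot hη hγ hO k.1)).ofReal_mul hs (by positivity) hf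
  have h2 := ((Bd.const (η := η) (s := s) (γ := γ) (O := O) (k.2 : ℂ)).mono le_rfl
    (c' := ENNReal.ofReal |(k.2 : ℝ)|) (by rw [← ofReal_norm, Complex.norm_intCast])).ofReal_mul hs
      (abs_nonneg _) hg
  have h3 := (h1.ofReal_add (by positivity) (by positivity) h2).const_mul hs Complex.I
    ENNReal.ofReal_ne_top
  refine h3.mono le_rfl ?_
  rw [← ofReal_norm, Complex.norm_I, ENNReal.ofReal_one, one_mul]
  refine ENNReal.ofReal_le_ofReal ?_
  unfold freqSize
  nlinarith [mul_nonneg hb (abs_nonneg (k.2 : ℝ))]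

lemma ofReal_exp_mul_weight (t s : ℝ) (k : Freq) :
    weight η s k * ENNReal.ofReal (Real.exp (t * freqSize η k)) = weight η (s + t) k := by
  unfold weight
  rw [← ENNReal.ofReal_mul (Real.exp_nonneg _), ← Real.exp_add]
  congr 2
  ring

/-- Composition with `(φ, x) ↦ (φ + f ω, x + g)`: the exponentials `e^{i (ω·ℓ) f + i j g}` are
estimated by `e^{3 b |k|}`, so that the width `3 b` of the strip is lost. -/
lemma Bd.comp (hη : 0 < η) (hγ : γ < 1) (hO : ∀ ω ∈ O, ∀ i, ω i ∈ Set.Icc (1 : ℝ) 2) {s' : ℝ}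
    (hs : 0 ≤ s') {b : ℝ} (hb : 0 ≤ b) (hss : s' + 3 * b ≤ s) (hF : Bd η γ O s c F) (hc : c ≠ ∞)
    {f g : (ℕ → ℝ) → Fn} (hf : Bd η γ O s' (ENNReal.ofReal b) fun ω φ x => f ω φ x)
    (hg : Bd η γ O s' (ENNReal.ofReal b) fun ω φ x => g ω φ x) :
    Bd η γ O s' c (fun ω φ x => F ω (φ + f ω φ x • ω) (x + g ω φ x)) := by
  obtain ⟨u, h1, h2⟩ := hF
  refine Bd.tsum (ι := Freq) (c := fun k => lipC γ O (u k) * weight η s k)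
    (F := fun k ω φ x => u k ω * mode k φ x *
      Complex.exp (Complex.I * ((dot k.1 ω : ℂ) * f ω φ x + (k.2 : ℂ) * g ω φ x)))
    hs h1 hc (fun k => ?_) fun ω hω φ x => ?_
  · have hfin : lipC γ O (u k) * weight η s k ≠ ∞ :=
      ne_top_of_le_ne_top hc ((ENNReal.le_tsum k).trans h1)
    have hfin' : lipC γ O (u k) * weight η s' k ≠ ∞ :=
      ne_top_of_le_ne_top hfin (by gcongr; exact weight_mono (by linarith) k)
    refine ((Bd.mode_term (u k) k).mul hs ((Bd.phase hη hγ hO hs hb hf hg k).exp hs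
      (mul_nonneg (by positivity) (freqSize_nonneg _ _))) hfin' ENNReal.ofReal_ne_top).mono le_rfl ?_
    rw [mul_assoc, ofReal_exp_mul_weight]
    gcongr
    exact weight_mono hss k
  · refine hasSum_of_eq (h2 ω hω (φ + f ω φ x • ω) (x + g ω φ x)) fun k => ?_
    rw [mode_comp, mul_assoc]

/-- Lipschitz dependence of a composition on the change of variables. -/
lemma Bd.comp_sub_comp (hη : 0 < η) (hγ : γ < 1) (hO : ∀ ω ∈ O, ∀ i, ω i ∈ Set.Icc (1 : ℝ) 2)
    {s' : ℝ} (hs : 0 ≤ s') {b d δ : ℝ} (hb : 0 ≤ b) (hd : 0 ≤ d) (hδ : 0 < δ)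
    (hss : s' + 3 * b + 3 * d + δ ≤ s) (hF : Bd η γ O s c F) (hc : c ≠ ∞)
    {f g f' g' : (ℕ → ℝ) → Fn}
    (hf : Bd η γ O s' (ENNReal.ofReal b) fun ω φ x => f ω φ x)
    (hg : Bd η γ O s' (ENNReal.ofReal b) fun ω φ x => g ω φ x)
    (hf' : Bd η γ O s' (ENNReal.ofReal d) fun ω φ x => (f' ω φ x - f ω φ x : ℝ))
    (hg' : Bd η γ O s' (ENNReal.ofReal d) fun ω φ x => (g' ω φ x - g ω φ x : ℝ)) :
    Bd η γ O s' (ENNReal.ofReal (3 * d / δ) * c)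
      (fun ω φ x => F ω (φ + f' ω φ x • ω) (x + g' ω φ x) - F ω (φ + f ω φ x • ω) (x + g ω φ x)) := by
  obtain ⟨u, h1, h2⟩ := hF
  refine Bd.tsum (ι := Freq)
    (c := fun k => ENNReal.ofReal (3 * d / δ) * (lipC γ O (u k) * weight η s k))
    (F := fun k ω φ x => u k ω * mode k φ x *
      (Complex.exp (Complex.I * ((dot k.1 ω : ℂ) * f ω φ x + (k.2 : ℂ) * g ω φ x)) *
       (Complex.exp (Complex.I * ((dot k.1 ω : ℂ) * (f' ω φ x - f ω φ x : ℝ)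
          + (k.2 : ℂ) * (g' ω φ x - g ω φ x : ℝ))) - 1)))
    hs ?_ (ENNReal.mul_ne_top ENNReal.ofReal_ne_top hc) (fun k => ?_) fun ω hω φ x => ?_
  · rw [ENNReal.tsum_mul_left]
    gcongr
  · have hfin : lipC γ O (u k) * weight η s k ≠ ∞ :=
      ne_top_of_le_ne_top hc ((ENNReal.le_tsum k).trans h1)
    have hfin' : lipC γ O (u k) * weight η s' k ≠ ∞ :=
      ne_top_of_le_ne_top hfin (by gcongr; exact weight_mono (by linarith) k)
    have hk := freqSize_nonneg η k
    have hE := (Bd.phase hη hγ hO hs hb hf hg k).exp hs (by positivity)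
    have hE' := (Bd.phase hη hγ hO hs hd hf' hg' k).exp_sub_one hs (by positivity)
    refine ((Bd.mode_term (u k) k).mul hs (hE.ofReal_mul hs (Real.exp_nonneg _) hE') hfin'
      ENNReal.ofReal_ne_top).mono le_rfl ?_
    have key : Real.exp (3 * b * freqSize η k) * (Real.exp (3 * d * freqSize η k) - 1) ≤
        (3 * d / δ) * Real.exp ((3 * b + 3 * d + δ) * freqSize η k) := by
      -- `e^y - 1 ≤ y e^y` and `|k| ≤ e^{δ|k|} / δ`
      have e1 : Real.exp (3 * d * freqSize η k) - 1 ≤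
          (3 * d * freqSize η k) * Real.exp (3 * d * freqSize η k) := by
        have := Real.add_one_le_exp (-(3 * d * freqSize η k))
        have h0 := Real.exp_pos (3 * d * freqSize η k)
        rw [Real.exp_neg] at this
        have h3 : (Real.exp (3 * d * freqSize η k))⁻¹ * Real.exp (3 * d * freqSize η k) = 1 :=
          inv_mul_cancel₀ h0.ne'
        nlinarith
      have e2 : freqSize η k ≤ Real.exp (δ * freqSize η k) / δ := by
        rw [le_div_iff₀ hδ]
        linarith [Real.add_one_le_exp (δ * freqSize η k)]
      rw [add_mul, add_mul, Real.exp_add, Real.exp_add]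
      calc _ ≤ Real.exp (3 * b * freqSize η k) *
            ((3 * d * (Real.exp (δ * freqSize η k) / δ)) * Real.exp (3 * d * freqSize η k)) := by
              refine mul_le_mul_of_nonneg_left (e1.trans ?_) (Real.exp_nonneg _)
              gcongr
        _ = _ := by ring
    calc _ ≤ lipC γ O (u k) * weight η s' k * ENNReal.ofReal ((3 * d / δ) *
          Real.exp ((3 * b + 3 * d + δ) * freqSize η k)) := by gcongr
      _ = ENNReal.ofReal (3 * d / δ) * (lipC γ O (u k) * weight η (s' + (3 * b + 3 * d + δ)) k) := by
          rw [ENNReal.ofReal_mul (by positivity), ← ofReal_exp_mul_weight]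
          ring
      _ ≤ _ := by
          gcongr
          exact weight_mono (by linarith) k
  · refine hasSum_of_eq ((h2 ω hω (φ + f' ω φ x • ω) (x + g' ω φ x)).sub
      (h2 ω hω (φ + f ω φ x • ω) (x + g ω φ x))) fun k => ?_
    rw [mode_comp, mode_comp, mul_sub, mul_one, ← Complex.exp_add, mul_sub, mul_assoc, mul_assoc]
    congr 4
    push_cast
    ring_nf

end Bd

/-! ### Differentiation along `x` and along the frequency vector -/

section Bd

variable {η γ : ℝ} {O : Set (ℕ → ℝ)} {s : ℝ} {c c' : ℝ≥0∞} {F G : (ℕ → ℝ) → (ℕ → ℝ) → ℝ → ℂ}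

lemma freqSize_mul_weight_le {s s' : ℝ} (h : s' < s) (k : Freq) :
    ENNReal.ofReal (freqSize η k) * weight η s' k ≤ ENNReal.ofReal (1 / (s - s')) * weight η s k := by
  have h0 := freqSize_nonneg η k
  have hd : 0 < s - s' := sub_pos.2 h
  rw [← add_sub_cancel s' s, ← ofReal_exp_mul_weight (s - s') s']
  have : ENNReal.ofReal (freqSize η k) ≤ ENNReal.ofReal (1 / (s - s')) *
      ENNReal.ofReal (Real.exp ((s - s') * freqSize η k)) := by
    rw [← ENNReal.ofReal_mul (by positivity)]
    refine ENNReal.ofReal_le_ofReal ?_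
    rw [one_div, inv_mul_eq_div, le_div_iff₀ hd]
    linarith [Real.add_one_le_exp ((s - s') * freqSize η k)]
  calc _ ≤ ENNReal.ofReal (1 / (s - s')) *
      ENNReal.ofReal (Real.exp ((s - s') * freqSize η k)) * weight η s' k := by gcongr
    _ = _ := by rw [add_sub_cancel_left]; ring

/-- The differential of `t, y ↦ ∑ v_k e^{i k·(φ + t ω, x + y)}`. -/
lemma hasFDerivAt_series (hη : 0 < η) {ω : ℕ → ℝ} (hω : ∀ i, ω i ∈ Set.Icc (1 : ℝ) 2)
    {v : Freq → ℂ} (h0 : Summable fun k => ‖v k‖) (h1 : Summable fun k => ‖v k‖ * freqSize η k)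
    (φ : ℕ → ℝ) (x : ℝ) {a b : ℂ}
    (ha : HasSum (fun k : Freq => Complex.I * (dot k.1 ω : ℂ) * v k * mode k φ x) a)
    (hb : HasSum (fun k : Freq => Complex.I * (k.2 : ℂ) * v k * mode k φ x) b) :
    HasFDerivAt (fun p : ℝ × ℝ => ∑' k, v k * mode k (φ + p.1 • ω) (x + p.2))
      ((ContinuousLinearMap.fst ℝ ℝ ℝ).smulRight a + (ContinuousLinearMap.snd ℝ ℝ ℝ).smulRight b)
      0 := by
  have hdot : ∀ k : Freq, |dot k.1 ω| ≤ 3 * wt η k.1 := fun k => by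
    have h := (enorm_le_lipC (γ := 0) (Set.mem_singleton ω)).trans
      (lipC_dot (O := {ω}) hη zero_lt_one (by rintro _ rfl; exact hω) k.1)
    rw [← ofReal_norm, Complex.norm_real, Real.norm_eq_abs] at h
    exact (ENNReal.ofReal_le_ofReal_iff (by linarith [wt_nonneg η k.1])).1 h
  let L : Freq → ℝ × ℝ →L[ℝ] ℂ := fun k =>
    (ContinuousLinearMap.fst ℝ ℝ ℝ).smulRight (Complex.I * (dot k.1 ω : ℂ)) +
      (ContinuousLinearMap.snd ℝ ℝ ℝ).smulRight (Complex.I * (k.2 : ℂ))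
  have hL : ∀ k p, L k p = Complex.I * ((dot k.1 ω : ℂ) * (p.1 : ℝ) + (k.2 : ℂ) * (p.2 : ℝ)) := by
    intro k p
    simp only [L, add_apply, ContinuousLinearMap.smulRight_apply, ContinuousLinearMap.coe_fst',
      ContinuousLinearMap.coe_snd', Complex.real_smul]
    ring
  have hLn : ∀ k, ‖L k‖ ≤ 3 * freqSize η k := fun k => by
    refine ContinuousLinearMap.opNorm_le_bound _ (by have := freqSize_nonneg η k; positivity) fun p => ?_
    rw [hL, norm_mul, Complex.norm_I, one_mul]
    have h1 : |p.1| ≤ ‖p‖ := norm_fst_le p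
    have h2 : |p.2| ≤ ‖p‖ := norm_snd_le p
    refine (norm_add_le _ _).trans ?_
    rw [norm_mul, norm_mul, Complex.norm_real, Complex.norm_real, Complex.norm_real,
      Complex.norm_intCast, Real.norm_eq_abs, Real.norm_eq_abs, Real.norm_eq_abs]
    unfold freqSize
    have h3 := hdot k
    have h4 := abs_nonneg (k.2 : ℝ)
    have h5 := wt_nonneg η k.1
    have h6 := norm_nonneg p
    calc |dot k.1 ω| * |p.1| + |(k.2 : ℝ)| * |p.2| ≤ 3 * wt η k.1 * ‖p‖ + |(k.2 : ℝ)| * ‖p‖ := by gcongr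
      _ ≤ _ := by nlinarith [mul_nonneg h4 h6]
  have hterm : ∀ (k : Freq) (p : ℝ × ℝ), v k * mode k (φ + p.1 • ω) (x + p.2) =
      v k * mode k φ x * Complex.exp (L k p) := fun k p => by
    rw [mode_comp, hL, mul_assoc]
  have hf : ∀ (k : Freq) (p : ℝ × ℝ), HasFDerivAt (fun p : ℝ × ℝ => v k * mode k (φ + p.1 • ω) (x + p.2))
      ((v k * mode k φ x) • (Complex.exp (L k p) • L k)) p := fun k p => by
    have := ((L k).hasFDerivAt (x := p)).cexp.const_mul (v k * mode k φ x)
    exact this.congr_of_eventuallyEq (Eventually.of_forall fun p => hterm k p)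
  have hexp : ∀ (k : Freq) (p : ℝ × ℝ), ‖Complex.exp (L k p)‖ = 1 := fun k p => by
    rw [hL, mul_comm]
    have := Complex.norm_exp_ofReal_mul_I (dot k.1 ω * p.1 + k.2 * p.2)
    push_cast at this
    exact this
  have hu : Summable fun k => 3 * (‖v k‖ * freqSize η k) := h1.mul_left 3
  have hD := hasFDerivAt_tsum (𝕜 := ℝ) (x₀ := (0 : ℝ × ℝ)) hu hf (fun k p => by
      rw [norm_smul, norm_smul, hexp, one_mul, norm_mul, norm_mode, mul_one]
      calc _ ≤ ‖v k‖ * (3 * freqSize η k) := by gcongr; exact hLn k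
        _ = _ := by ring)
    (by
      refine Summable.of_norm ?_
      simpa [norm_mode] using h0) 0
  refine hD.congr_fderiv ?_
  have hsum : Summable fun k => (v k * mode k φ x) • (Complex.exp (L k 0) • L k) := by
    refine Summable.of_norm_bounded hu fun k => ?_
    rw [norm_smul, norm_smul, hexp, one_mul, norm_mul, norm_mode, mul_one]
    calc _ ≤ ‖v k‖ * (3 * freqSize η k) := by gcongr; exact hLn k
      _ = _ := by ring
  ext
  · have h2 := (hsum.hasSum.mapL (ContinuousLinearMap.apply ℝ ℂ ((1 : ℝ), (0 : ℝ)))).unique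
      (hasSum_of_eq ha fun k => by
        simp [L]
        ring)
    simpa using h2
  · have h2 := (hsum.hasSum.mapL (ContinuousLinearMap.apply ℝ ℂ ((0 : ℝ), (1 : ℝ)))).unique
      (hasSum_of_eq hb fun k => by
        simp [L]
        ring)
    simpa using h2

/-- Fourier multipliers. -/
lemma tsum_lipC_multiplier_le {s' : ℝ} {u m : Freq → (ℕ → ℝ) → ℂ} {C : ℝ≥0∞}
    (hm : ∀ k, lipC γ O (m k) * weight η s' k ≤ C * weight η s k)
    (hu : ∑' k, lipC γ O (u k) * weight η s k ≤ c) :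
    ∑' k, lipC γ O (fun ω => m k ω * u k ω) * weight η s' k ≤ C * c := by
  calc _ ≤ ∑' k, C * (lipC γ O (u k) * weight η s k) := by
        refine ENNReal.tsum_le_tsum fun k => ?_
        calc _ ≤ (lipC γ O (m k) * lipC γ O (u k)) * weight η s' k := by gcongr; exact lipC_mul
          _ = (lipC γ O (m k) * weight η s' k) * lipC γ O (u k) := by ring
          _ ≤ (C * weight η s k) * lipC γ O (u k) := by exact mul_le_mul' (hm k) le_rfl
          _ = _ := by ring
    _ = C * ∑' k, lipC γ O (u k) * weight η s k := ENNReal.tsum_mul_left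
    _ ≤ _ := by gcongr

lemma summable_norm_of_lipC {u : Freq → (ℕ → ℝ) → ℂ} (hs : 0 ≤ s)
    (h : ∑' k, lipC γ O (u k) * weight η s k ≠ ∞) {ω : ℕ → ℝ} (hω : ω ∈ O) :
    Summable fun k => ‖u k ω‖ := by
  simpa [norm_mode] using summable_of_lipC hs h hω 0 0

lemma lipC_dot_mul_weight_le (hη : 0 < η) (hγ : γ < 1) (hO : ∀ ω ∈ O, ∀ i, ω i ∈ Set.Icc (1 : ℝ) 2)
    {s' : ℝ} (h : s' < s) (k : Freq) :
    lipC γ O (fun ω => Complex.I * (dot k.1 ω : ℂ)) * weight η s' k ≤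
      ENNReal.ofReal (3 / (s - s')) * weight η s k := by
  have hd : 0 < s - s' := sub_pos.2 h
  have h1 : lipC γ O (fun ω => Complex.I * (dot k.1 ω : ℂ)) ≤ 3 * ENNReal.ofReal (freqSize η k) := by
    refine lipC_mul.trans ?_
    calc _ ≤ ‖Complex.I‖ₑ * ENNReal.ofReal (3 * wt η k.1) :=
          mul_le_mul' (lipC_const _) (lipC_dot hη hγ hO k.1)
      _ ≤ 1 * ENNReal.ofReal (3 * freqSize η k) := by
          refine mul_le_mul' (by rw [← ofReal_norm]; simp) (ENNReal.ofReal_le_ofReal ?_)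
          unfold freqSize
          linarith [abs_nonneg (k.2 : ℝ)]
      _ = _ := by rw [one_mul, ENNReal.ofReal_mul (by norm_num)]; simp
  calc _ ≤ 3 * ENNReal.ofReal (freqSize η k) * weight η s' k := by gcongr
    _ = 3 * (ENNReal.ofReal (freqSize η k) * weight η s' k) := by ring
    _ ≤ 3 * (ENNReal.ofReal (1 / (s - s')) * weight η s k) := by
        gcongr 3 * ?_; exact freqSize_mul_weight_le h k
    _ = _ := by
        rw [← mul_assoc]
        congr 1
        have : (3 : ℝ≥0∞) = ENNReal.ofReal 3 := by simp
        rw [this, ← ENNReal.ofReal_mul (by norm_num)]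
        congr 1
        ring

lemma lipC_int_mul_weight_le {s' : ℝ} (h : s' < s) (k : Freq) :
    lipC γ O (fun _ => Complex.I * (k.2 : ℂ)) * weight η s' k ≤
      ENNReal.ofReal (1 / (s - s')) * weight η s k := by
  have h1 : lipC γ O (fun _ => Complex.I * (k.2 : ℂ)) ≤ ENNReal.ofReal (freqSize η k) := by
    refine (lipC_const _).trans ?_
    rw [← ofReal_norm]
    refine ENNReal.ofReal_le_ofReal ?_
    rw [norm_mul, Complex.norm_I, one_mul, Complex.norm_intCast]
    unfold freqSize
    linarith [wt_nonneg η k.1]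
  exact (mul_le_mul_left h1 _).trans (freqSize_mul_weight_le h k)

/-- Differentiability of a function with coefficients `u` and the expansions of its derivatives. -/
lemma hasFDerivAt_of_coeff (hη : 0 < η) (hO : ∀ ω ∈ O, ∀ i, ω i ∈ Set.Icc (1 : ℝ) 2) (hs : 0 < s)
    {u : Freq → (ℕ → ℝ) → ℂ} (hu : ∑' k, lipC γ O (u k) * weight η s k ≠ ∞)
    (hF : ∀ ω ∈ O, ∀ φ x, HasSum (fun k => u k ω * mode k φ x) (F ω φ x)) {ω : ℕ → ℝ} (hω : ω ∈ O)
    (φ : ℕ → ℝ) (x : ℝ) {a b : ℂ}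
    (ha : HasSum (fun k : Freq => Complex.I * (dot k.1 ω : ℂ) * u k ω * mode k φ x) a)
    (hb : HasSum (fun k : Freq => Complex.I * (k.2 : ℂ) * u k ω * mode k φ x) b) :
    HasFDerivAt (fun p : ℝ × ℝ => F ω (φ + p.1 • ω) (x + p.2))
      ((ContinuousLinearMap.fst ℝ ℝ ℝ).smulRight a + (ContinuousLinearMap.snd ℝ ℝ ℝ).smulRight b)
      0 := by
  have h1 : Summable fun k => ‖u k ω‖ * freqSize η k := by
    have : ∑' k, ‖u k ω * (freqSize η k : ℂ)‖ₑ ≠ ∞ := by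
      refine ne_top_of_le_ne_top (b := ENNReal.ofReal (1 / (s - 0)) *
        ∑' k, lipC γ O (u k) * weight η s k) (ENNReal.mul_ne_top ENNReal.ofReal_ne_top hu) ?_
      rw [← ENNReal.tsum_mul_left]
      refine ENNReal.tsum_le_tsum fun k => ?_
      rw [enorm_mul]
      have e : ‖(freqSize η k : ℂ)‖ₑ = ENNReal.ofReal (freqSize η k) * weight η 0 k := by
        rw [← ofReal_norm, Complex.norm_real, Real.norm_eq_abs, abs_of_nonneg (freqSize_nonneg _ _)]
        simp [weight]
      rw [e]
      calc _ ≤ lipC γ O (u k) * (ENNReal.ofReal (1 / (s - 0)) * weight η s k) :=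
            mul_le_mul' (enorm_le_lipC hω) (freqSize_mul_weight_le hs k)
        _ = _ := by ring
    rw [tsum_enorm_ne_top_iff_summable_norm] at this
    refine this.congr fun k => ?_
    rw [norm_mul, Complex.norm_real, Real.norm_eq_abs, abs_of_nonneg (freqSize_nonneg _ _)]
  have := hasFDerivAt_series hη (hO ω hω) (summable_norm_of_lipC hs.le hu hω) h1 φ x ha hb
  refine this.congr_of_eventuallyEq (Eventually.of_forall fun p => ?_)
  exact (hF ω hω _ _).tsum_eq.symm

/-- Cauchy estimates. -/
lemma Bd.exists_deriv (hη : 0 < η) (hγ : γ < 1) (hO : ∀ ω ∈ O, ∀ i, ω i ∈ Set.Icc (1 : ℝ) 2)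
    {s' : ℝ} (hs' : 0 ≤ s') (h : s' < s) (hF : Bd η γ O s c F) (hc : c ≠ ∞) :
    ∃ Fω Fx : (ℕ → ℝ) → (ℕ → ℝ) → ℝ → ℂ,
      Bd η γ O s' (ENNReal.ofReal (3 / (s - s')) * c) Fω ∧
      Bd η γ O s' (ENNReal.ofReal (1 / (s - s')) * c) Fx ∧
      ∀ ω ∈ O, ∀ φ x, HasFDerivAt (fun p : ℝ × ℝ => F ω (φ + p.1 • ω) (x + p.2))
        ((ContinuousLinearMap.fst ℝ ℝ ℝ).smulRight (Fω ω φ x) +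
          (ContinuousLinearMap.snd ℝ ℝ ℝ).smulRight (Fx ω φ x)) 0 := by
  obtain ⟨u, h1, h2⟩ := hF
  have b1 := tsum_lipC_multiplier_le (s' := s') (m := fun k ω => Complex.I * (dot k.1 ω : ℂ))
    (fun k => lipC_dot_mul_weight_le hη hγ hO h k) h1
  have b2 := tsum_lipC_multiplier_le (s' := s') (m := fun k _ => Complex.I * (k.2 : ℂ))
    (fun k => lipC_int_mul_weight_le (γ := γ) (O := O) h k) h1
  have c1 := ne_top_of_le_ne_top (ENNReal.mul_ne_top ENNReal.ofReal_ne_top hc) b1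
  have c2 := ne_top_of_le_ne_top (ENNReal.mul_ne_top ENNReal.ofReal_ne_top hc) b2
  refine ⟨_, _, ⟨_, b1, fun ω hω φ x => (summable_of_lipC hs' c1 hω φ x).of_norm.hasSum⟩,
    ⟨_, b2, fun ω hω φ x => (summable_of_lipC hs' c2 hω φ x).of_norm.hasSum⟩, fun ω hω φ x => ?_⟩
  exact hasFDerivAt_of_coeff hη hO (hs'.trans_lt h) (ne_top_of_le_ne_top hc h1) h2 hω φ x
    (summable_of_lipC hs' c1 hω φ x).of_norm.hasSum (summable_of_lipC hs' c2 hω φ x).of_norm.hasSum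

/-! ### Real parts, averages, and the inversion of `∂_x` and `ω·∂_φ` -/

lemma tsum_lipC_conj_le {u : Freq → (ℕ → ℝ) → ℂ} :
    ∑' k, lipC γ O (fun ω => (starRingEnd ℂ) (u (-k) ω)) * weight η s k ≤
      ∑' k, lipC γ O (u k) * weight η s k := by
  rw [← (Equiv.neg Freq).tsum_eq fun k => lipC γ O (u k) * weight η s k]
  refine ENNReal.tsum_le_tsum fun k => ?_
  simp only [Equiv.neg_apply]
  have : weight η s (-k) = weight η s k := by simp only [weight, freqSize_neg]
  rw [this]
  gcongr
  exact lipC_conj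

lemma hasSum_conj_coeff {u : Freq → (ℕ → ℝ) → ℂ} {ω φ : ℕ → ℝ} {x : ℝ} {z : ℂ}
    (h : HasSum (fun k => u k ω * mode k φ x) z) :
    HasSum (fun k => (starRingEnd ℂ) (u (-k) ω) * mode k φ x) ((starRingEnd ℂ) z) := by
  have h1 := h.map (starRingEnd ℂ) Complex.continuous_conj
  have h2 := (Equiv.neg Freq).hasSum_iff.2 h1
  refine hasSum_of_eq h2 fun k => ?_
  simp [conj_mode]

/-- A function with absolutely convergent Fourier series whose values are real has a symmetric
expansion. -/
lemma Bd.exists_symm {f : (ℕ → ℝ) → Fn} (hF : Bd η γ O s c F)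
    (hf : ∀ ω ∈ O, ∀ φ x, f ω φ x = (F ω φ x).re) :
    ∃ u : Freq → (ℕ → ℝ) → ℂ, ∑' k, lipC γ O (u k) * weight η s k ≤ c ∧
      (∀ k ω, u (-k) ω = (starRingEnd ℂ) (u k ω)) ∧
      ∀ ω ∈ O, ∀ φ x, HasSum (fun k => u k ω * mode k φ x) (f ω φ x : ℂ) := by
  obtain ⟨u, h1, h2⟩ := hF
  refine ⟨fun k ω => (1 / 2 : ℂ) * (u k ω + (starRingEnd ℂ) (u (-k) ω)), ?_, fun k ω => ?_,
    fun ω hω φ x => ?_⟩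
  · calc _ ≤ ∑' k, (‖(1 / 2 : ℂ)‖ₑ * (lipC γ O (u k) * weight η s k) + ‖(1 / 2 : ℂ)‖ₑ *
          (lipC γ O (fun ω => (starRingEnd ℂ) (u (-k) ω)) * weight η s k)) := by
          refine ENNReal.tsum_le_tsum fun k => ?_
          calc _ ≤ (‖(1 / 2 : ℂ)‖ₑ * (lipC γ O (u k) + lipC γ O (fun ω => (starRingEnd ℂ) (u (-k) ω))))
                * weight η s k := by
                gcongr
                exact lipC_mul.trans (mul_le_mul' (lipC_const _) lipC_add)
            _ = _ := by ring
      _ ≤ ‖(1 / 2 : ℂ)‖ₑ * c + ‖(1 / 2 : ℂ)‖ₑ * c := by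
          rw [ENNReal.tsum_add, ENNReal.tsum_mul_left, ENNReal.tsum_mul_left]
          gcongr
          exact tsum_lipC_conj_le.trans h1
      _ = c := by
          rw [← add_mul, ← ofReal_norm, ← ENNReal.ofReal_add (norm_nonneg _) (norm_nonneg _)]
          norm_num
  · simp only [neg_neg, map_mul, map_add, Complex.conj_conj, map_div₀, map_one, map_ofNat]
    rw [add_comm]
  · have h3 := h2 ω hω φ x
    have h4 := (h3.add (hasSum_conj_coeff h3)).mul_left (1 / 2)
    rw [Complex.add_conj, ← hf ω hω] at h4
    push_cast at h4
    rw [← mul_assoc, one_div, inv_mul_cancel₀ two_ne_zero, one_mul] at h4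
    exact hasSum_of_eq h4 fun k => by ring

lemma Bd.re (hF : Bd η γ O s c F) : Bd η γ O s c (fun ω φ x => ((F ω φ x).re : ℂ)) := by
  obtain ⟨u, h1, -, h3⟩ := hF.exists_symm (f := fun ω φ x => (F ω φ x).re) fun _ _ _ _ => rfl
  exact ⟨u, h1, h3⟩

/-- The `x`-average of a single exponential. -/
lemma integral_mode (k : Freq) (φ : ℕ → ℝ) :
    ∫ x in (0 : ℝ)..(2 * Real.pi), mode k φ x = if k.2 = 0 then 2 * Real.pi * mode k φ 0 else 0 := by
  have e : ∀ x, mode k φ x = mode k φ 0 * Complex.exp ((Complex.I * k.2) * x) := fun x => by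
    have := mode_comp k φ 0 0 0 x
    simp only [smul_zero, add_zero, zero_add] at this
    rw [this]
    congr 2
    push_cast
    ring
  split_ifs with h
  · have : ∀ x, mode k φ x = mode k φ 0 := fun x => by rw [e x, h]; simp
    rw [intervalIntegral.integral_congr fun x _ => this x, intervalIntegral.integral_const]
    simp
  · rw [intervalIntegral.integral_congr fun x _ => e x]
    rw [intervalIntegral.integral_const_mul, integral_exp_mul_complex (by simpa using h)]
    have : Complex.exp (Complex.I * k.2 * ((2 * Real.pi : ℝ) : ℂ)) = 1 := by
      have := Complex.exp_int_mul_two_pi_mul_I k.2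
      rw [← this]
      congr 1
      push_cast
      ring
    rw [this]
    simp

lemma hasSum_avg {u : Freq → (ℕ → ℝ) → ℂ} {ω φ : ℕ → ℝ} {f : ℝ → ℝ}
    (hu : Summable fun k => ‖u k ω‖) (hf : ∀ x, HasSum (fun k => u k ω * mode k φ x) (f x : ℂ)) (x : ℝ) :
    HasSum (fun k : Freq => (if k.2 = 0 then u k ω else 0) * mode k φ x) (avg f : ℂ) := by
  have hcont : ∀ k, Continuous fun x : ℝ => u k ω * mode k φ x := fun k => by
    unfold mode
    fun_prop
  have h := intervalIntegral.hasSum_integral_of_dominated_convergence (μ := MeasureTheory.volume)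
    (a := 0) (b := 2 * Real.pi) (F := fun k x => u k ω * mode k φ x) (f := fun x => (f x : ℂ))
    (fun k _ => ‖u k ω‖) (fun k => (hcont k).aestronglyMeasurable)
    (fun k => Eventually.of_forall fun x _ => by rw [norm_mul, norm_mode, mul_one])
    (Eventually.of_forall fun _ _ => hu) (by simp) (Eventually.of_forall fun x _ => hf x)
  simp_rw [intervalIntegral.integral_const_mul, integral_mode] at h
  rw [intervalIntegral.integral_ofReal] at h
  have h2 := h.mul_left ((1 / (2 * Real.pi) : ℝ) : ℂ)
  rw [← Complex.ofReal_mul] at h2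
  refine hasSum_of_eq h2 fun k => ?_
  split_ifs with hk
  · have hm : mode k φ x = mode k φ 0 := by
      unfold mode
      simp [hk]
    have hpi : (Real.pi : ℂ) ≠ 0 := by exact_mod_cast Real.pi_ne_zero
    rw [hm]
    push_cast
    field_simp
  · simp

lemma lipC_ite_le {u : (ℕ → ℝ) → ℂ} {p : Prop} [Decidable p] :
    lipC γ O (fun ω => if p then u ω else 0) ≤ lipC γ O u := by
  split_ifs
  · exact le_rfl
  · rw [lipC_zero]; exact bot_le

end Bd

/-! ### Real valued functions -/

/-- The standing assumptions on the weights and on the set of frequency vectors. -/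
structure Setting (η γ : ℝ) (O : Set (ℕ → ℝ)) : Prop where
  eta_pos : 0 < η
  gamma_lt : γ < 1
  mem_Icc : ∀ ω ∈ O, ∀ i, ω i ∈ Set.Icc (1 : ℝ) 2

/-- `RBd η γ O s b f`: the real valued function `f` of `(ω, φ, x)` has norm at most `b` on the strip
of width `s`, in the sense of `Bd`. -/
def RBd (η γ : ℝ) (O : Set (ℕ → ℝ)) (s b : ℝ) (f : (ℕ → ℝ) → Fn) : Prop :=
  0 ≤ b ∧ Bd η γ O s (ENNReal.ofReal b) fun ω φ x => (f ω φ x : ℂ)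

/-- `∂_x f`. -/
def DX (f : (ℕ → ℝ) → Fn) : (ℕ → ℝ) → Fn := fun ω φ x => deriv (f ω φ) x

/-- `ω·∂_φ f`. -/
def DO (f : (ℕ → ℝ) → Fn) : (ℕ → ℝ) → Fn := fun ω => dphi ω (f ω)

/-- The `x`-average of `f`. -/
def AV (f : (ℕ → ℝ) → Fn) : (ℕ → ℝ) → Fn := fun ω φ _ => avg (f ω φ)

/-- The composition `f(φ + β ω, x + α)`. -/
def CP (β α f : (ℕ → ℝ) → Fn) : (ℕ → ℝ) → Fn :=
  fun ω φ x => f ω (φ + β ω φ x • ω) (x + α ω φ x)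

/-- Functions that do not depend on `x`. -/
def IndepX (f : (ℕ → ℝ) → Fn) : Prop := ∀ ω φ x y, f ω φ x = f ω φ y

lemma hasDerivAt_comp_of_zero {g : ℝ × ℝ → ℝ} {L : ℝ × ℝ →L[ℝ] ℝ} (h : HasFDerivAt g L 0)
    {c : ℝ → ℝ × ℝ} {c' : ℝ × ℝ} {t : ℝ} (hc : HasDerivAt c c' t) (h0 : c t = 0) :
    HasDerivAt (fun r => g (c r)) (L c') t := by
  rw [← h0] at h
  exact h.comp_hasDerivAt t hc

section RBd

variable {η γ : ℝ} {O : Set (ℕ → ℝ)} {s s' b b' : ℝ} {f g : (ℕ → ℝ) → Fn}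

lemma RBd.congr (h : RBd η γ O s b f) (hfg : ∀ ω ∈ O, ∀ φ x, f ω φ x = g ω φ x) : RBd η γ O s b g :=
  ⟨h.1, h.2.congr fun ω hω φ x => by rw [hfg ω hω]⟩

lemma RBd.mono (h : RBd η γ O s b f) (hs : s' ≤ s) (hb : b ≤ b') : RBd η γ O s' b' f :=
  ⟨h.1.trans hb, h.2.mono hs (ENNReal.ofReal_le_ofReal hb)⟩

lemma RBd.subset {O' : Set (ℕ → ℝ)} (h : RBd η γ O s b f) (hO : O' ⊆ O) : RBd η γ O' s b f :=
  ⟨h.1, h.2.subset hO⟩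

lemma RBd.const (a : ℝ) : RBd η γ O s |a| (fun _ _ _ => a) :=
  ⟨abs_nonneg a, (Bd.const (a : ℂ)).mono le_rfl (by rw [← ofReal_norm, Complex.norm_real, Real.norm_eq_abs])⟩

/-- A function of the frequency vector alone. -/
lemma RBd.of_omega {a : (ℕ → ℝ) → ℝ} (hb : 0 ≤ b)
    (ha : lipNorm (fun a : ℝ => ‖a‖ₑ) γ O a ≤ ENNReal.ofReal b) : RBd η γ O s b (fun ω _ _ => a ω) := by
  refine ⟨hb, (Bd.of_omega fun ω => (a ω : ℂ)).mono le_rfl (le_trans ?_ ha)⟩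
  refine lipNorm_mono (fun ω _ => ?_) fun ω₁ _ ω₂ _ => ?_
  · rw [← ofReal_norm, Complex.norm_real, ofReal_norm]
  · rw [← Complex.ofReal_sub, ← ofReal_norm, Complex.norm_real, ofReal_norm]

lemma RBd.add (hf : RBd η γ O s b f) (hg : RBd η γ O s b' g) :
    RBd η γ O s (b + b') (fun ω φ x => f ω φ x + g ω φ x) :=
  ⟨add_nonneg hf.1 hg.1, (hf.2.ofReal_add hf.1 hg.1 hg.2).congr fun ω _ φ x => by push_cast; rfl⟩

lemma RBd.neg (hf : RBd η γ O s b f) : RBd η γ O s b (fun ω φ x => - f ω φ x) :=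
  ⟨hf.1, hf.2.neg.congr fun ω _ φ x => by push_cast; rfl⟩

lemma RBd.mul (hs : 0 ≤ s) (hf : RBd η γ O s b f) (hg : RBd η γ O s b' g) :
    RBd η γ O s (b * b') (fun ω φ x => f ω φ x * g ω φ x) :=
  ⟨mul_nonneg hf.1 hg.1, (hf.2.ofReal_mul hs hf.1 hg.2).congr fun ω _ φ x => by push_cast; rfl⟩

lemma RBd.const_mul (hs : 0 ≤ s) (a : ℝ) (hf : RBd η γ O s b f) :
    RBd η γ O s (|a| * b) (fun ω φ x => a * f ω φ x) := (RBd.const a).mul hs hf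

lemma RBd.sum {ι : Type*} (t : Finset ι) {f : ι → (ℕ → ℝ) → Fn} {b : ι → ℝ}
    (h : ∀ i ∈ t, RBd η γ O s (b i) (f i)) :
    RBd η γ O s (∑ i ∈ t, b i) (fun ω φ x => ∑ i ∈ t, f i ω φ x) := by
  classical
  induction t using Finset.induction_on with
  | empty => simpa using RBd.const (η := η) (γ := γ) (O := O) (s := s) 0
  | insert i t hi ih =>
    simp_rw [Finset.sum_insert hi]
    exact (h i (Finset.mem_insert_self i t)).add (ih fun j hj => h j (Finset.mem_insert_of_mem hj))

/-- The supremum norm is bounded by the norm of the Fourier series. -/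
lemma RBd.abs_le (hs : 0 ≤ s) (hf : RBd η γ O s b f) {ω : ℕ → ℝ} (hω : ω ∈ O) (φ : ℕ → ℝ) (x : ℝ) :
    |f ω φ x| ≤ b := by
  obtain ⟨hb, u, h1, h2⟩ := hf
  have h : ‖(f ω φ x : ℂ)‖ₑ ≤ ENNReal.ofReal b := by
    rw [← show _ = (f ω φ x : ℂ) from (h2 ω hω φ x).tsum_eq]
    refine enorm_tsum_le_tsum_enorm.trans ((ENNReal.tsum_le_tsum fun k => ?_).trans h1)
    rw [enorm_mul, ← ofReal_norm (mode k φ x), norm_mode, ENNReal.ofReal_one]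
    exact mul_le_mul' (enorm_le_lipC hω) (one_le_weight hs k)
  rw [← ofReal_norm, Complex.norm_real, Real.norm_eq_abs] at h
  exact (ENNReal.ofReal_le_ofReal_iff hb).1 h

lemma RBd.tsum {f : ℕ → (ℕ → ℝ) → Fn} {c : ℕ → ℝ} (hs : 0 ≤ s) (hc : HasSum c b)
    (hf : ∀ n, RBd η γ O s (c n) (f n)) (hg : ∀ ω ∈ O, ∀ φ x, HasSum (fun n => f n ω φ x) (g ω φ x)) :
    RBd η γ O s b g := by
  refine ⟨hc.nonneg fun n => (hf n).1, Bd.tsum (c := fun n => ENNReal.ofReal (c n)) hs ?_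
    ENNReal.ofReal_ne_top (fun n => (hf n).2) fun ω hω φ x => Complex.hasSum_ofReal.2 (hg ω hω φ x)⟩
  rw [← hc.tsum_eq, ENNReal.ofReal_tsum_of_nonneg (fun n => (hf n).1) hc.summable]

/-- Power series with coefficients bounded by `1`. -/
lemma RBd.powerSeries (hs : 0 ≤ s) (hf : RBd η γ O s b f) (hb : b ≤ 1 / 2) {a : ℕ → ℝ}
    (ha : ∀ n, |a n| ≤ 1)
    (hg : ∀ ω ∈ O, ∀ φ x, HasSum (fun n => a n * f ω φ x ^ (n + 1)) (g ω φ x)) :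
    RBd η γ O s (2 * b) g := by
  have hb0 := hf.1
  have hgeo : HasSum (fun n : ℕ => b ^ (n + 1)) (b * (1 - b)⁻¹) := by
    simp_rw [pow_succ']
    exact (hasSum_geometric_of_lt_one hb0 (by linarith)).mul_left b
  have hle : ∀ n : ℕ, |a n| * b ^ (n + 1) ≤ b ^ (n + 1) := fun n =>
    mul_le_of_le_one_left (by positivity) (ha n)
  have hsum : Summable fun n : ℕ => |a n| * b ^ (n + 1) :=
    Summable.of_nonneg_of_le (fun n => by positivity) hle hgeo.summable
  have h2 : ∑' n : ℕ, |a n| * b ^ (n + 1) ≤ 2 * b := by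
    refine (hsum.tsum_le_tsum hle hgeo.summable).trans ?_
    rw [hgeo.tsum_eq, ← div_eq_mul_inv, div_le_iff₀ (by linarith)]
    nlinarith
  refine ⟨by linarith, (hf.2.powerSeries hs hb0 hsum.hasSum fun ω hω φ x => ?_).mono le_rfl
    (ENNReal.ofReal_le_ofReal h2)⟩
  have := Complex.hasSum_ofReal.2 (hg ω hω φ x)
  push_cast at this
  exact this

lemma RBd.inv_one_add (hs : 0 ≤ s) (hf : RBd η γ O s b f) (hb : b ≤ 1 / 2) :
    RBd η γ O s (2 * b) (fun ω φ x => (1 + f ω φ x)⁻¹ - 1) := by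
  refine hf.powerSeries hs hb (a := fun n => (-1) ^ (n + 1)) (fun n => by simp) fun ω hω φ x => ?_
  have habs : |-f ω φ x| < 1 := by
    rw [abs_neg]
    linarith [hf.abs_le hs hω φ x]
  have h := (hasSum_nat_add_iff' 1).2 (hasSum_geometric_of_abs_lt_one habs)
  simp only [sub_neg_eq_add, Finset.range_one, Finset.sum_singleton, pow_zero] at h
  refine hasSum_of_eq h fun n => ?_
  rw [neg_eq_neg_one_mul, mul_pow]

lemma RBd.log_one_add (hs : 0 ≤ s) (hf : RBd η γ O s b f) (hb : b ≤ 1 / 2) :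
    RBd η γ O s (2 * b) (fun ω φ x => Real.log (1 + f ω φ x)) := by
  refine hf.powerSeries hs hb (a := fun n => (-1) ^ n / (n + 1)) (fun n => ?_) fun ω hω φ x => ?_
  · rw [abs_div, abs_pow, abs_neg, abs_one, one_pow, abs_of_nonneg (by positivity),
      div_le_one (by positivity)]
    linarith [Nat.cast_nonneg (α := ℝ) n]
  · have habs : |-f ω φ x| < 1 := by
      rw [abs_neg]
      linarith [hf.abs_le hs hω φ x]
    have h := (Real.hasSum_pow_div_log_of_abs_lt_one habs).neg
    rw [neg_neg, sub_neg_eq_add] at h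
    refine hasSum_of_eq h fun n => ?_
    rw [neg_eq_neg_one_mul (f ω φ x), mul_pow, pow_succ (-1 : ℝ)]
    ring

lemma RBd.exp_sub_one (hs : 0 ≤ s) (hf : RBd η γ O s b f) (hb : b ≤ 1 / 2) :
    RBd η γ O s (2 * b) (fun ω φ x => Real.exp (f ω φ x) - 1) := by
  have hb0 := hf.1
  refine ⟨by linarith, ((hf.2.exp_sub_one hs hb0).mono le_rfl (ENNReal.ofReal_le_ofReal ?_)).congr
    fun ω _ φ x => by push_cast; rfl⟩
  have h := Real.add_one_le_exp (-b)
  rw [Real.exp_neg] at h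
  have hpos := Real.exp_pos b
  have h3 : (Real.exp b)⁻¹ * Real.exp b = 1 := inv_mul_cancel₀ hpos.ne'
  nlinarith

lemma RBd.comp (H : Setting η γ O) (hs : 0 ≤ s') {d : ℝ} (hss : s' + 3 * d ≤ s)
    (hf : RBd η γ O s b f) {β α : (ℕ → ℝ) → Fn} (hβ : RBd η γ O s' d β) (hα : RBd η γ O s' d α) :
    RBd η γ O s' b (CP β α f) :=
  ⟨hf.1, hf.2.comp H.eta_pos H.gamma_lt H.mem_Icc hs hβ.1 hss ENNReal.ofReal_ne_top hβ.2 hα.2⟩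

lemma RBd.comp_sub_comp (H : Setting η γ O) (hs : 0 ≤ s') {d d' δ : ℝ} (hδ : 0 < δ)
    (hss : s' + 3 * d + 3 * d' + δ ≤ s) (hf : RBd η γ O s b f) {β α β' α' : (ℕ → ℝ) → Fn}
    (hβ : RBd η γ O s' d β) (hα : RBd η γ O s' d α)
    (hβ' : RBd η γ O s' d' fun ω φ x => β' ω φ x - β ω φ x)
    (hα' : RBd η γ O s' d' fun ω φ x => α' ω φ x - α ω φ x) :
    RBd η γ O s' (3 * d' / δ * b) (fun ω φ x => CP β' α' f ω φ x - CP β α f ω φ x) := by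
  have hd := hβ'.1
  have hb := hf.1
  refine ⟨by positivity, ?_⟩
  rw [ENNReal.ofReal_mul (by positivity)]
  refine (hf.2.comp_sub_comp H.eta_pos H.gamma_lt H.mem_Icc hs hβ.1 hd hδ hss ENNReal.ofReal_ne_top
    hβ.2 hα.2 hβ'.2 hα'.2).congr fun ω _ φ x => ?_
  simp only [CP]
  push_cast
  rfl

/-- The size of `f(φ + β ω, x + α) - f(φ, x)`. -/
lemma RBd.comp_sub (H : Setting η γ O) (hs : 0 ≤ s') {d δ : ℝ} (hδ : 0 < δ)
    (hss : s' + 3 * d + δ ≤ s) (hf : RBd η γ O s b f) {β α : (ℕ → ℝ) → Fn}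
    (hβ : RBd η γ O s' d β) (hα : RBd η γ O s' d α) :
    RBd η γ O s' (3 * d / δ * b) (fun ω φ x => CP β α f ω φ x - f ω φ x) := by
  have h0 : RBd η γ O s' 0 (fun _ _ _ => 0) := by simpa using RBd.const (η := η) (γ := γ) (O := O) 0
  refine (hf.comp_sub_comp H hs hδ (by linarith) h0 h0 (β' := β) (α' := α) (by simpa using hβ)
    (by simpa using hα)).congr fun ω _ φ x => ?_
  simp [CP]

/-! ### Derivatives of real valued functions -/

lemma RBd.exists_deriv (H : Setting η γ O) (hs' : 0 ≤ s') (h : s' < s) (hf : RBd η γ O s b f) :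
    RBd η γ O s' (3 / (s - s') * b) (DO f) ∧ RBd η γ O s' (1 / (s - s') * b) (DX f) ∧
      ∀ ω ∈ O, ∀ φ x, HasFDerivAt (fun p : ℝ × ℝ => f ω (φ + p.1 • ω) (x + p.2))
        ((ContinuousLinearMap.fst ℝ ℝ ℝ).smulRight (DO f ω φ x) +
          (ContinuousLinearMap.snd ℝ ℝ ℝ).smulRight (DX f ω φ x)) 0 := by
  have hd : 0 < s - s' := sub_pos.2 h
  have hb := hf.1
  obtain ⟨Fω, Fx, h1, h2, h3⟩ := hf.2.exists_deriv H.eta_pos H.gamma_lt H.mem_Icc hs' h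
    ENNReal.ofReal_ne_top
  have h4 : ∀ ω ∈ O, ∀ φ x, HasFDerivAt (fun p : ℝ × ℝ => f ω (φ + p.1 • ω) (x + p.2))
        ((ContinuousLinearMap.fst ℝ ℝ ℝ).smulRight (Fω ω φ x).re +
          (ContinuousLinearMap.snd ℝ ℝ ℝ).smulRight (Fx ω φ x).re) 0 := fun ω hω φ x => by
    have := Complex.reCLM.hasFDerivAt.comp (0 : ℝ × ℝ) (h3 ω hω φ x)
    refine this.congr_fderiv ?_
    ext <;> simp
  have hω' : ∀ ω ∈ O, ∀ φ x, DO f ω φ x = (Fω ω φ x).re := fun ω hω φ x => by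
    have hc : HasDerivAt (fun t : ℝ => (t, (0 : ℝ))) ((1 : ℝ), (0 : ℝ)) 0 :=
      (hasDerivAt_id (0 : ℝ)).prodMk (hasDerivAt_const _ _)
    have := (hasDerivAt_comp_of_zero (h4 ω hω φ x) hc rfl).deriv
    simpa [Function.comp_def, DO, dphi] using this
  have hx' : ∀ ω ∈ O, ∀ φ x, DX f ω φ x = (Fx ω φ x).re := fun ω hω φ x => by
    have hc : HasDerivAt (fun y : ℝ => ((0 : ℝ), y - x)) ((0 : ℝ), (1 : ℝ)) x :=
      (hasDerivAt_const _ _).prodMk ((hasDerivAt_id x).sub_const x)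
    have := (hasDerivAt_comp_of_zero (h4 ω hω φ x) hc (by simp)).deriv
    simpa [Function.comp_def, DX] using this
  refine ⟨⟨by positivity, ?_⟩, ⟨by positivity, ?_⟩, fun ω hω φ x => ?_⟩
  · rw [ENNReal.ofReal_mul (by positivity)]
    exact h1.re.congr fun ω hω φ x => by rw [hω' ω hω]
  · rw [ENNReal.ofReal_mul (by positivity)]
    exact h2.re.congr fun ω hω φ x => by rw [hx' ω hω]
  · rw [hω' ω hω, hx' ω hω]
    exact h4 ω hω φ x

lemma RBd.dphi (H : Setting η γ O) (hs' : 0 ≤ s') (h : s' < s) (hf : RBd η γ O s b f) :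
    RBd η γ O s' (3 / (s - s') * b) (DO f) := (hf.exists_deriv H hs' h).1

lemma RBd.dx (H : Setting η γ O) (hs' : 0 ≤ s') (h : s' < s) (hf : RBd η γ O s b f) :
    RBd η γ O s' (1 / (s - s') * b) (DX f) := (hf.exists_deriv H hs' h).2.1

lemma RBd.hasFDerivAt (H : Setting η γ O) (hs : 0 < s) (hf : RBd η γ O s b f) {ω : ℕ → ℝ}
    (hω : ω ∈ O) (φ : ℕ → ℝ) (x : ℝ) :
    HasFDerivAt (fun p : ℝ × ℝ => f ω (φ + p.1 • ω) (x + p.2))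
        ((ContinuousLinearMap.fst ℝ ℝ ℝ).smulRight (DO f ω φ x) +
          (ContinuousLinearMap.snd ℝ ℝ ℝ).smulRight (DX f ω φ x)) 0 :=
  (hf.exists_deriv H le_rfl hs).2.2 ω hω φ x

/-- The chain rule along a curve `(φ + a(t) ω, y(t))`. -/
lemma RBd.hasDerivAt_curve (H : Setting η γ O) (hs : 0 < s) (hf : RBd η γ O s b f) {ω : ℕ → ℝ}
    (hω : ω ∈ O) (φ : ℕ → ℝ) {a y : ℝ → ℝ} {a' y' t : ℝ} (ha : HasDerivAt a a' t)
    (hy : HasDerivAt y y' t) :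
    HasDerivAt (fun r => f ω (φ + a r • ω) (y r))
      (a' * DO f ω (φ + a t • ω) (y t) + y' * DX f ω (φ + a t • ω) (y t)) t := by
  have hc : HasDerivAt (fun r : ℝ => (a r - a t, y r - y t)) (a', y') t :=
    (ha.sub_const _).prodMk (hy.sub_const _)
  have h0 := hf.hasFDerivAt H hs hω (φ + a t • ω) (y t)
  have := hasDerivAt_comp_of_zero h0 hc (by simp)
  have e : (fun r => f ω (φ + a t • ω + (a r - a t) • ω) (y t + (y r - y t)))
      = fun r => f ω (φ + a r • ω) (y r) := by
    funext r
    congr 1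
    · rw [add_assoc, ← add_smul, add_sub_cancel]
    · ring
  simp only [e] at this
  simpa using this

lemma RBd.hasDerivAt_x (H : Setting η γ O) (hs : 0 < s) (hf : RBd η γ O s b f) {ω : ℕ → ℝ}
    (hω : ω ∈ O) (φ : ℕ → ℝ) (x : ℝ) : HasDerivAt (f ω φ) (DX f ω φ x) x := by
  simpa using hf.hasDerivAt_curve H hs hω φ (hasDerivAt_const x (0 : ℝ)) (hasDerivAt_id x)

lemma RBd.hasDerivAt_phi (H : Setting η γ O) (hs : 0 < s) (hf : RBd η γ O s b f) {ω : ℕ → ℝ}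
    (hω : ω ∈ O) (φ : ℕ → ℝ) (x t : ℝ) :
    HasDerivAt (fun r : ℝ => f ω (φ + r • ω) x) (DO f ω (φ + t • ω) x) t := by
  simpa using hf.hasDerivAt_curve H hs hω φ (hasDerivAt_id t) (hasDerivAt_const t x)

lemma RBd.continuous (H : Setting η γ O) (hs : 0 < s) (hf : RBd η γ O s b f) {ω : ℕ → ℝ}
    (hω : ω ∈ O) (φ : ℕ → ℝ) : Continuous fun p : ℝ × ℝ => f ω (φ + p.1 • ω) p.2 := by
  refine continuous_iff_continuousAt.2 fun p => ?_
  have h := (hf.hasFDerivAt H hs hω (φ + p.1 • ω) p.2).continuousAt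
  have h2 : ContinuousAt (fun q : ℝ × ℝ => q - p) p := by fun_prop
  have h3 := ContinuousAt.comp (f := fun q : ℝ × ℝ => q - p) (x := p) (by simpa using h) h2
  refine h3.congr (Eventually.of_forall fun q => ?_)
  simp only [Function.comp, Prod.fst_sub, Prod.snd_sub]
  congr 1
  · rw [add_assoc, ← add_smul, add_sub_cancel]
  · ring

lemma RBd.contDiff (H : Setting η γ O) (hs : 0 < s) (hf : RBd η γ O s b f) {ω : ℕ → ℝ}
    (hω : ω ∈ O) (φ : ℕ → ℝ) : ContDiff ℝ (⊤ : ℕ∞) (f ω φ) := by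
  refine contDiff_infty.2 fun n => ?_
  induction n generalizing f s b with
  | zero =>
    rw [Nat.cast_zero, contDiff_zero]
    exact continuous_iff_continuousAt.2 fun x => (hf.hasDerivAt_x H hs hω φ x).continuousAt
  | succ n ih =>
    push_cast
    rw [contDiff_succ_iff_deriv]
    refine ⟨fun x => (hf.hasDerivAt_x H hs hω φ x).differentiableAt, by simp, ?_⟩
    exact ih (half_pos hs) (hf.dx H (half_pos hs).le (half_lt_self hs))

lemma mode_periodic (k : Freq) (φ : ℕ → ℝ) (x : ℝ) : mode k φ (x + 2 * Real.pi) = mode k φ x := by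
  have := mode_comp k φ 0 x 0 (2 * Real.pi)
  simp only [smul_zero, add_zero] at this
  rw [this]
  have h := Complex.exp_int_mul_two_pi_mul_I k.2
  rw [show Complex.I * ((dot k.1 0 : ℂ) * ((0 : ℝ) : ℂ) + (k.2 : ℂ) * ((2 * Real.pi : ℝ) : ℂ)) =
    k.2 * (2 * Real.pi * Complex.I) by push_cast; ring, h, mul_one]

lemma RBd.periodic (hf : RBd η γ O s b f) {ω : ℕ → ℝ} (hω : ω ∈ O) (φ : ℕ → ℝ) :
    Function.Periodic (f ω φ) (2 * Real.pi) := fun x => by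
  obtain ⟨hb, u, h1, h2⟩ := hf
  have h := h2 ω hω φ (x + 2 * Real.pi)
  simp_rw [mode_periodic] at h
  exact Complex.ofReal_injective (h.unique (h2 ω hω φ x))

/-! ### Averages and primitives -/

lemma RBd.avg (hs : 0 ≤ s) (hf : RBd η γ O s b f) : RBd η γ O s b (AV f) := by
  obtain ⟨hb, u, h1, h2⟩ := hf
  refine ⟨hb, fun k ω => if k.2 = 0 then u k ω else 0, le_trans (ENNReal.tsum_le_tsum fun k => ?_) h1,
    fun ω hω φ x => hasSum_avg (summable_norm_of_lipC hs (ne_top_of_le_ne_top ENNReal.ofReal_ne_top h1)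
      hω) (fun x => h2 ω hω φ x) x⟩
  gcongr
  exact lipC_ite_le

/-- The primitive in `x` of a function minus its average. -/
lemma RBd.exists_primitive (H : Setting η γ O) (hs : 0 < s) (hf : RBd η γ O s b f) :
    ∃ g, RBd η γ O s b g ∧ ∀ ω ∈ O, ∀ φ x, DX g ω φ x = f ω φ x - AV f ω φ x := by
  obtain ⟨hb, u, h1, h2⟩ := hf
  have hfin := ne_top_of_le_ne_top ENNReal.ofReal_ne_top h1
  set m : Freq → (ℕ → ℝ) → ℂ := fun k _ => if k.2 = 0 then 0 else (Complex.I * k.2)⁻¹ with hm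
  have hm1 : ∀ k, lipC γ O (m k) * weight η s k ≤ 1 * weight η s k := fun k => by
    gcongr
    refine (lipC_const _).trans ?_
    split_ifs with hk
    · simp
    · rw [← ofReal_norm, ENNReal.ofReal_le_one, norm_inv, norm_mul, Complex.norm_I, one_mul,
        Complex.norm_intCast]
      exact inv_le_one_of_one_le₀ (by exact_mod_cast Int.one_le_abs hk)
  have b1 := (tsum_lipC_multiplier_le hm1 h1).trans (one_mul _).le
  have c1 := ne_top_of_le_ne_top ENNReal.ofReal_ne_top b1
  have hG : ∀ ω ∈ O, ∀ φ x, HasSum (fun k => m k ω * u k ω * mode k φ x)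
      (∑' k, m k ω * u k ω * mode k φ x) := fun ω hω φ x =>
    (summable_of_lipC hs.le c1 hω φ x).of_norm.hasSum
  have hBd : Bd η γ O s (ENNReal.ofReal b) fun ω φ x => ∑' k, m k ω * u k ω * mode k φ x :=
    ⟨_, b1, hG⟩
  refine ⟨fun ω φ x => (∑' k, m k ω * u k ω * mode k φ x).re, ⟨hb, hBd.re⟩, fun ω hω φ x => ?_⟩
  have hsub := (h2 ω hω φ x).sub (hasSum_avg (summable_norm_of_lipC hs.le hfin hω) (h2 ω hω φ) x)
  rw [← Complex.ofReal_sub] at hsub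
  have b2 := ne_top_of_le_ne_top (ENNReal.mul_ne_top ENNReal.ofReal_ne_top c1)
    (tsum_lipC_multiplier_le (s' := 0) (m := fun k ω => Complex.I * (dot k.1 ω : ℂ))
    (fun k => lipC_dot_mul_weight_le H.eta_pos H.gamma_lt H.mem_Icc hs k) le_rfl)
  have hD := hasFDerivAt_of_coeff (F := fun ω φ x => ∑' k, m k ω * u k ω * mode k φ x)
    H.eta_pos H.mem_Icc hs c1 hG hω φ x (summable_of_lipC le_rfl b2 hω φ x).of_norm.hasSum
    (hasSum_of_eq hsub fun k => by
      simp only [hm]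
      split_ifs with hk
      · simp
      · have : (k.2 : ℂ) ≠ 0 := by exact_mod_cast hk
        field_simp
        simp [mul_comm])
  have hc : HasDerivAt (fun y : ℝ => ((0 : ℝ), y - x)) ((0 : ℝ), (1 : ℝ)) x :=
    (hasDerivAt_const _ _).prodMk ((hasDerivAt_id x).sub_const x)
  have hD2 := Complex.reCLM.hasFDerivAt.comp (0 : ℝ × ℝ) hD
  have := (hasDerivAt_comp_of_zero hD2 hc (by simp)).deriv
  simpa [Function.comp_def, DX, AV] using this

/-- Inversion of `ω·∂_φ` on functions of `φ`: the small divisors `ω·ℓ` are compensated by a loss in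
the width of the strip. -/
lemma RBd.exists_dphi_inverse (H : Setting η γ O) {C : ℝ} (hs' : 0 < s') (hC : 0 ≤ C)
    (hsd : ∀ l : ℕ →₀ ℤ, l ≠ 0 → lipC γ O (fun ω => (Complex.I * (dot l ω : ℂ))⁻¹) *
      weight η s' (l, 0) ≤ ENNReal.ofReal C * weight η s (l, 0))
    (hdot : ∀ ω ∈ O, ∀ l : ℕ →₀ ℤ, l ≠ 0 → dot l ω ≠ 0)
    (hs : s' ≤ s) (hf : RBd η γ O s b f) (hfx : IndepX f) :
    ∃ (g : (ℕ → ℝ) → Fn) (g₀ : (ℕ → ℝ) → ℝ), RBd η γ O s' (C * b) g ∧ IndepX g ∧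
      lipNorm (fun a : ℝ => ‖a‖ₑ) γ O g₀ ≤ ENNReal.ofReal b ∧
      ∀ ω ∈ O, ∀ φ x, DO g ω φ x = f ω φ x - g₀ ω := by
  obtain ⟨hb, u, h1, h2⟩ := hf
  have hfin := ne_top_of_le_ne_top ENNReal.ofReal_ne_top h1
  set m : Freq → (ℕ → ℝ) → ℂ := fun k ω => if k.2 = 0 ∧ k.1 ≠ 0 then (Complex.I * (dot k.1 ω : ℂ))⁻¹
    else 0 with hm
  have hm1 : ∀ k, lipC γ O (m k) * weight η s' k ≤ ENNReal.ofReal C * weight η s k := fun k => by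
    simp only [hm]
    split_ifs with hk
    · have : k = (k.1, 0) := Prod.ext rfl hk.1
      rw [this]
      exact hsd k.1 hk.2
    · simp [lipC_zero]
  have b1 := tsum_lipC_multiplier_le hm1 h1
  rw [← ENNReal.ofReal_mul hC] at b1
  have c1 := ne_top_of_le_ne_top ENNReal.ofReal_ne_top b1
  have hG : ∀ ω ∈ O, ∀ φ x, HasSum (fun k => m k ω * u k ω * mode k φ x)
      (∑' k, m k ω * u k ω * mode k φ x) := fun ω hω φ x =>
    (summable_of_lipC hs'.le c1 hω φ x).of_norm.hasSum
  have hBd : Bd η γ O s' (ENNReal.ofReal (C * b)) fun ω φ x => ∑' k, m k ω * u k ω * mode k φ x :=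
    ⟨_, b1, hG⟩
  refine ⟨fun ω φ x => (∑' k, m k ω * u k ω * mode k φ x).re, fun ω => (u 0 ω).re,
    ⟨mul_nonneg hC hb, hBd.re⟩, fun ω φ x y => ?_, ?_, fun ω hω φ x => ?_⟩
  · refine congrArg Complex.re (tsum_congr fun k => ?_)
    by_cases hk : k.2 = 0
    · simp [mode, hk]
    · simp [hm, hk]
  · refine le_trans ?_ ((ENNReal.le_tsum 0).trans h1)
    calc lipNorm (fun a : ℝ => ‖a‖ₑ) γ O (fun ω => (u 0 ω).re) ≤ lipC γ O (u 0) := by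
          refine lipNorm_mono (fun ω _ => ?_) fun ω₁ _ ω₂ _ => ?_
          · rw [← ofReal_norm, ← ofReal_norm]
            exact ENNReal.ofReal_le_ofReal (Complex.abs_re_le_norm _)
          · rw [← ofReal_norm, ← ofReal_norm, ← Complex.sub_re]
            exact ENNReal.ofReal_le_ofReal (Complex.abs_re_le_norm _)
      _ = lipC γ O (u 0) * 1 := (mul_one _).symm
      _ ≤ _ := by gcongr; exact one_le_weight (hs'.le.trans hs) 0
  · have havg : AV f ω φ x = f ω φ x := by
      have : f ω φ = fun _ => f ω φ x := funext fun y => hfx ω φ y x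
      simp only [AV, AiryKAM.avg]
      rw [this, intervalIntegral.integral_const]
      have := Real.pi_ne_zero
      simp
      field_simp
    have h3 := hasSum_avg (summable_norm_of_lipC (hs'.le.trans hs) hfin hω) (h2 ω hω φ) x
    have h4 : HasSum (fun k : Freq => if k = 0 then u 0 ω else 0) (u 0 ω) := hasSum_ite_eq 0 (u 0 ω)
    have hsub := h3.sub h4
    have b2 := ne_top_of_le_ne_top (ENNReal.mul_ne_top ENNReal.ofReal_ne_top c1)
      (tsum_lipC_multiplier_le (s' := 0) (m := fun k _ => Complex.I * (k.2 : ℂ))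
      (fun k => lipC_int_mul_weight_le hs' k) le_rfl)
    have hD := hasFDerivAt_of_coeff (F := fun ω φ x => ∑' k, m k ω * u k ω * mode k φ x)
      H.eta_pos H.mem_Icc hs' c1 hG hω φ x
      (hasSum_of_eq hsub fun k => by
        simp only [hm]
        by_cases hk : k.2 = 0
        · by_cases hk1 : k.1 = 0
          · have : k = 0 := Prod.ext hk1 hk
            subst this
            simp [mode_zero]
          · have h0 : k ≠ 0 := fun h => hk1 (by rw [h]; rfl)
            have hd : (dot k.1 ω : ℂ) ≠ 0 := by exact_mod_cast hdot ω hω k.1 hk1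
            have hI : Complex.I * (dot k.1 ω : ℂ) ≠ 0 := mul_ne_zero Complex.I_ne_zero hd
            rw [if_pos hk, if_neg h0, if_pos ⟨hk, hk1⟩, ← mul_assoc (Complex.I * (dot k.1 ω : ℂ)),
              mul_inv_cancel₀ hI]
            ring
        · have h0 : k ≠ 0 := fun h => hk (by rw [h]; rfl)
          simp [hk, h0])
      (summable_of_lipC le_rfl b2 hω φ x).of_norm.hasSum
    have hc : HasDerivAt (fun t : ℝ => (t, (0 : ℝ))) ((1 : ℝ), (0 : ℝ)) 0 :=
      (hasDerivAt_id (0 : ℝ)).prodMk (hasDerivAt_const _ _)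
    have hD2 := Complex.reCLM.hasFDerivAt.comp (0 : ℝ × ℝ) hD
    have := (hasDerivAt_comp_of_zero hD2 hc rfl).deriv
    rw [← havg]
    simpa [Function.comp_def, DO, AiryKAM.dphi, AV] using this

end RBd

/-! ### Inversion of changes of variables -/

section Inverse

variable {η γ : ℝ} {O : Set (ℕ → ℝ)} {s s' b : ℝ}

/-- The iterates `X ↦ -(β, α) ∘ (id + X)` that converge to the inverse of `id + (β, α)`. -/
def inverseIter (β α : (ℕ → ℝ) → Fn) : ℕ → ((ℕ → ℝ) → Fn) × ((ℕ → ℝ) → Fn)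
  | 0 => (fun _ _ _ => 0, fun _ _ _ => 0)
  | n + 1 => (fun ω φ x => - CP (inverseIter β α n).1 (inverseIter β α n).2 β ω φ x,
      fun ω φ x => - CP (inverseIter β α n).1 (inverseIter β α n).2 α ω φ x)

lemma RBd.exists_limit (hs : 0 ≤ s) {f : ℕ → (ℕ → ℝ) → Fn} (h0 : f 0 = fun _ _ _ => 0)
    (hd : ∀ n, RBd η γ O s (b * (1 / 2) ^ n) (fun ω φ x => f (n + 1) ω φ x - f n ω φ x)) :
    ∃ g, RBd η γ O s (2 * b) g ∧ (∀ ω ∈ O, ∀ φ x, Tendsto (fun n => f n ω φ x) atTop (𝓝 (g ω φ x))) ∧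
      ((∀ n, IndepX (f n)) → IndepX g) := by
  have hgeo : HasSum (fun n : ℕ => b * (1 / 2) ^ n) (2 * b) := by
    have := hasSum_geometric_two.mul_left b
    rwa [mul_comm b 2] at this
  have hsum : ∀ ω ∈ O, ∀ φ x, Summable fun n => f (n + 1) ω φ x - f n ω φ x := fun ω hω φ x =>
    Summable.of_norm_bounded hgeo.summable fun n => (hd n).abs_le hs hω φ x
  refine ⟨fun ω φ x => ∑' n, (f (n + 1) ω φ x - f n ω φ x),
    RBd.tsum hs hgeo hd fun ω hω φ x => (hsum ω hω φ x).hasSum, fun ω hω φ x => ?_,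
    fun h ω φ x y => tsum_congr fun n => by rw [h (n + 1) ω φ x y, h n ω φ x y]⟩
  refine (hsum ω hω φ x).hasSum.tendsto_sum_nat.congr fun n => ?_
  rw [Finset.sum_range_sub (fun n => f n ω φ x), h0, sub_zero]

/-- A change of variables `(φ, x) ↦ (φ + β ω, x + α)` close to the identity has a right inverse of the
same form. -/
lemma exists_right_inverse (H : Setting η γ O) {δ : ℝ} (hs : 0 < s') (hδ : 0 < δ) (hb : 6 * b ≤ δ)
    (hss : s' + 2 * δ ≤ s) {β α : (ℕ → ℝ) → Fn} (hβ : RBd η γ O s b β) (hα : RBd η γ O s b α) :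
    ∃ β' α', RBd η γ O s' (2 * b) β' ∧ RBd η γ O s' (2 * b) α' ∧ (IndepX β → IndepX β') ∧
      ∀ ω ∈ O, ∀ φ x, β' ω φ x = - CP β' α' β ω φ x ∧ α' ω φ x = - CP β' α' α ω φ x := by
  have hb0 := hβ.1
  have hzero : RBd η γ O s' b (fun _ _ _ => 0) := by
    have : RBd η γ O s' |(0 : ℝ)| (fun _ _ _ => 0) := RBd.const 0
    rw [abs_zero] at this
    exact this.mono le_rfl hb0
  have hX : ∀ n, RBd η γ O s' b (inverseIter β α n).1 ∧ RBd η γ O s' b (inverseIter β α n).2 := by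
    intro n
    induction n with
    | zero => exact ⟨hzero, hzero⟩
    | succ n ih =>
      exact ⟨(hβ.comp H hs.le (by linarith) ih.1 ih.2).neg, (hα.comp H hs.le (by linarith) ih.1 ih.2).neg⟩
  have hd : ∀ n, RBd η γ O s' (b * (1 / 2) ^ n)
        (fun ω φ x => (inverseIter β α (n + 1)).1 ω φ x - (inverseIter β α n).1 ω φ x) ∧
      RBd η γ O s' (b * (1 / 2) ^ n)
        (fun ω φ x => (inverseIter β α (n + 1)).2 ω φ x - (inverseIter β α n).2 ω φ x) := by
    intro n
    induction n with
    | zero =>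
      rw [pow_zero, mul_one]
      exact ⟨(hX 1).1.congr fun ω _ φ x => by simp [inverseIter],
        (hX 1).2.congr fun ω _ φ x => by simp [inverseIter]⟩
    | succ n ih =>
      have hle : b * (1 / 2) ^ n ≤ b := mul_le_of_le_one_right hb0 (pow_le_one₀ (by norm_num) (by norm_num))
      have hcontr : 3 * (b * (1 / 2) ^ n) / δ * b ≤ b * (1 / 2) ^ (n + 1) := by
        rw [pow_succ, div_mul_eq_mul_div, div_le_iff₀ hδ]
        have : 0 ≤ b * (1 / 2 : ℝ) ^ n := by positivity
        nlinarith
      refine ⟨((hβ.comp_sub_comp H hs.le hδ (by linarith) (hX n).1 (hX n).2 ih.1 ih.2).neg.mono le_rfl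
        hcontr).congr fun ω _ φ x => ?_,
        ((hα.comp_sub_comp H hs.le hδ (by linarith) (hX n).1 (hX n).2 ih.1 ih.2).neg.mono le_rfl
        hcontr).congr fun ω _ φ x => ?_⟩
      · simp only [inverseIter]; ring
      · simp only [inverseIter]; ring
  obtain ⟨β', h1, h2, h3⟩ := RBd.exists_limit hs.le (f := fun n => (inverseIter β α n).1) rfl
    fun n => (hd n).1
  obtain ⟨α', h4, h5, -⟩ := RBd.exists_limit hs.le (f := fun n => (inverseIter β α n).2) rfl
    fun n => (hd n).2
  refine ⟨β', α', h1, h4, fun hβx => h3 fun n => ?_, fun ω hω φ x => ?_⟩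
  · induction n with
    | zero => exact fun _ _ _ _ => rfl
    | succ n ih =>
      intro ω φ x y
      simp only [inverseIter, CP]
      rw [ih ω φ x y, hβx ω _ _ (y + (inverseIter β α n).2 ω φ y)]
  · have hs0 : 0 < s := by linarith
    have key : ∀ f : (ℕ → ℝ) → Fn, RBd η γ O s b f →
        Tendsto (fun n => - CP (inverseIter β α n).1 (inverseIter β α n).2 f ω φ x) atTop
          (𝓝 (- CP β' α' f ω φ x)) := fun f hf => by
      have hc := (hf.continuous H hs0 hω φ).tendsto (β' ω φ x, x + α' ω φ x)
      exact (hc.comp ((h2 ω hω φ x).prodMk_nhds ((h5 ω hω φ x).const_add x))).neg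
    exact ⟨tendsto_nhds_unique ((tendsto_add_atTop_iff_nat 1).2 (h2 ω hω φ x)) (key β hβ),
      tendsto_nhds_unique ((tendsto_add_atTop_iff_nat 1).2 (h5 ω hω φ x)) (key α hα)⟩

end Inverse

/-! ### Fourier coefficients -/

section Fourier

variable {η γ : ℝ} {O : Set (ℕ → ℝ)} {s s' b : ℝ}

lemma anorm_eq (η s : ℝ) (u : Fourier) : anorm η s u = ∑' k, ‖u k‖ₑ * weight η s k := rfl

lemma lipNorm_anorm_le (u : Freq → (ℕ → ℝ) → ℂ) :
    lipNorm (anorm η s) γ O (fun ω k => u k ω) ≤ ∑' k, lipC γ O (u k) * weight η s k := by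
  choose a l h1 h2 h3 using fun k => exists_lipNorm_eq (fun a : ℂ => ‖a‖ₑ) γ O (u k)
  refine lipNorm_le (a := ∑' k, a k * weight η s k) (l := ∑' k, l k * weight η s k)
    (fun ω hω => ?_) (fun ω₁ H₁ ω₂ H₂ hne => ?_) (le_of_eq ?_)
  · exact ENNReal.tsum_le_tsum fun k => mul_le_mul' (h1 k ω hω) le_rfl
  · rw [anorm_eq, div_eq_mul_inv, ← ENNReal.tsum_mul_right]
    refine ENNReal.tsum_le_tsum fun k => ?_
    calc _ = (‖u k ω₁ - u k ω₂‖ₑ / (⨆ i : ℕ, ‖ω₁ i - ω₂ i‖ₑ)) * weight η s k := by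
          rw [div_eq_mul_inv]; simp only [Pi.sub_apply]; ring
      _ ≤ _ := by gcongr; exact h2 k _ H₁ _ H₂ hne
  · rw [← ENNReal.tsum_mul_left, ← ENNReal.tsum_add]
    refine tsum_congr fun k => ?_
    unfold lipC
    rw [h3]
    ring

/-- A single coefficient is bounded by the norm of the series. -/
lemma lipC_coeff_mul_weight_le (u : (ℕ → ℝ) → Fourier) (k : Freq) :
    lipC γ O (fun ω => u ω k) * weight η s k ≤ lipNorm (anorm η s) γ O u := by
  obtain ⟨a, l, h1, h2, h3⟩ := exists_lipNorm_eq (anorm η s) γ O u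
  have hk : ∀ v : Fourier, ‖v k‖ₑ * weight η s k ≤ anorm η s v := fun v => ENNReal.le_tsum k
  have hw : weight η s k ≠ 0 := by
    unfold weight
    simp [Real.exp_pos]
  have hw' : weight η s k ≠ ∞ := ENNReal.ofReal_ne_top
  rw [h3, ← ENNReal.le_div_iff_mul_le (Or.inl hw) (Or.inl hw')]
  refine lipNorm_le (a := a / weight η s k) (l := l / weight η s k) (fun ω hω => ?_)
    (fun ω₁ H₁ ω₂ H₂ hne => ?_) (le_of_eq ?_)
  · rw [ENNReal.le_div_iff_mul_le (Or.inl hw) (Or.inl hw')]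
    exact (hk _).trans (h1 ω hω)
  · rw [ENNReal.le_div_iff_mul_le (Or.inl hw) (Or.inl hw')]
    refine le_trans (le_of_eq ?_) ((ENNReal.div_le_div_right (hk (u ω₁ - u ω₂)) _).trans (h2 ω₁ H₁ ω₂ H₂ hne))
    simp only [div_eq_mul_inv, Pi.sub_apply]
    ring
  · simp only [div_eq_mul_inv]
    ring

lemma hasSum_eval {u : Fourier} (hu : RealOnReal u) (hs : Summable fun k => ‖u k‖) (φ : ℕ → ℝ) (x : ℝ) :
    HasSum (fun k => u k * mode k φ x) (eval u φ x : ℂ) := by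
  have h : HasSum (fun k => u k * mode k φ x) (∑' k, u k * mode k φ x) := by
    refine (Summable.of_norm ?_).hasSum
    simpa [norm_mode] using hs
  have h2 := hasSum_conj_coeff (u := fun k _ => u k) (ω := 0) h
  have h3 : (starRingEnd ℂ) (∑' k, u k * mode k φ x) = ∑' k, u k * mode k φ x := by
    refine h2.unique (hasSum_of_eq h fun k => ?_)
    rw [hu k, Complex.conj_conj]
  have h4 : (eval u φ x : ℂ) = ∑' k, u k * mode k φ x := Complex.conj_eq_iff_re.1 h3
  rwa [h4]

lemma eval_eq_of_hasSum {u : Fourier} {φ : ℕ → ℝ} {x y : ℝ}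
    (h : HasSum (fun k => u k * mode k φ x) (y : ℂ)) : eval u φ x = y := by
  have : (∑' k, u k * mode k φ x).re = y := by rw [h.tsum_eq, Complex.ofReal_re]
  exact this

lemma summable_norm_of_mem_Hs {u : Fourier} (hs : 0 ≤ s) (hu : anorm η s u < ∞) :
    Summable fun k => ‖u k‖ := by
  rw [← tsum_enorm_ne_top_iff_summable_norm]
  refine ne_top_of_le_ne_top hu.ne (ENNReal.tsum_le_tsum fun k => ?_)
  calc ‖u k‖ₑ = ‖u k‖ₑ * 1 := (mul_one _).symm
    _ ≤ _ := by gcongr; exact one_le_weight hs k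

lemma anorm_mono {u : Fourier} (h : s' ≤ s) : anorm η s' u ≤ anorm η s u :=
  ENNReal.tsum_le_tsum fun k => by
    gcongr 1
    exact weight_mono h k

lemma Hs_mono {u : Fourier} (h : s' ≤ s) (hu : u ∈ Hs η s) : u ∈ Hs η s' :=
  ⟨hu.1, (anorm_mono h).trans_lt hu.2⟩

/-- A fixed series, at a single frequency vector. -/
lemma Bd.of_mem_Hs {u : Fourier} (hs : 0 ≤ s) (hu : u ∈ Hs η s) (ω : ℕ → ℝ) :
    Bd η γ {ω} s (anorm η s u) (fun _ φ x => (eval u φ x : ℂ)) := by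
  refine ⟨fun k _ => u k, ENNReal.tsum_le_tsum fun k => ?_, fun ω' _ φ x =>
    hasSum_eval hu.1 (summable_norm_of_mem_Hs hs hu.2) φ x⟩
  exact mul_le_mul' (lipC_const _) le_rfl

lemma RBd.of_mem_Hs {u : Fourier} (hs : 0 ≤ s) (hu : u ∈ Hs η s) (ω : ℕ → ℝ) :
    RBd η γ {ω} s (anorm η s u).toReal (fun _ => eval u) := by
  refine ⟨ENNReal.toReal_nonneg, ?_⟩
  rw [ENNReal.ofReal_toReal hu.2.ne]
  exact Bd.of_mem_Hs hs hu ω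

/-- Passing from the Lipschitz norm of a family of series to the norm of `Bd` costs a loss of width
and the factor `∑ e^{-δ|k|}`. -/
lemma RBd.of_lipNorm {u : (ℕ → ℝ) → Fourier} (hs : 0 ≤ s) {S : ℝ} (hb : 0 ≤ b) (hS0 : 0 ≤ S)
    (hS : ∑' k, weight η (s' - s) k ≤ ENNReal.ofReal S) (hu : ∀ ω ∈ O, u ω ∈ Hs η s)
    (h : lipNorm (anorm η s) γ O u ≤ ENNReal.ofReal b) :
    RBd η γ O s' (S * b) (fun ω => eval (u ω)) := by
  refine ⟨by positivity, fun k ω => u ω k, ?_, fun ω hω φ x =>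
    hasSum_eval (hu ω hω).1 (summable_norm_of_mem_Hs hs (hu ω hω).2) φ x⟩
  rw [ENNReal.ofReal_mul hS0, mul_comm]
  calc _ ≤ ∑' k, ENNReal.ofReal b * weight η (s' - s) k := by
        refine ENNReal.tsum_le_tsum fun k => ?_
        have : weight η s' k = weight η s k * weight η (s' - s) k := by
          unfold weight
          rw [← ENNReal.ofReal_mul (Real.exp_nonneg _), ← Real.exp_add]
          congr 2
          ring
        rw [this, ← mul_assoc]
        gcongr
        exact (lipC_coeff_mul_weight_le u k).trans h
    _ ≤ _ := by
        rw [ENNReal.tsum_mul_left]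
        gcongr

/-- The choice of Fourier coefficients for a real valued function. -/
lemma RBd.exists_fourier {f : (ℕ → ℝ) → Fn} (hs : 0 ≤ s) (hf : RBd η γ O s b f) :
    ∃ U : (ℕ → ℝ) → Fourier, lipNorm (anorm η s) γ O U ≤ ENNReal.ofReal b ∧
      (∀ ω ∈ O, U ω ∈ Hs η s ∧ eval (U ω) = f ω) ∧ (IndepX f → ∀ ω ∈ O, XIndep (U ω)) := by
  classical
  obtain ⟨u, h1, h2, h3⟩ := hf.2.exists_symm (f := f) fun _ _ _ _ => (Complex.ofReal_re _).symm
  set m : Prop := IndepX f with hm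
  let v : Freq → (ℕ → ℝ) → ℂ := fun k ω => if k.2 = 0 ∨ ¬ m then u k ω else 0
  have hv1 : ∑' k, lipC γ O (v k) * weight η s k ≤ ENNReal.ofReal b := by
    refine le_trans (ENNReal.tsum_le_tsum fun k => ?_) h1
    gcongr
    exact lipC_ite_le
  have hv2 : ∀ ω ∈ O, ∀ φ x, HasSum (fun k => v k ω * mode k φ x) (f ω φ x : ℂ) := by
    intro ω hω φ x
    by_cases hmm : m
    · have := hasSum_avg (summable_norm_of_lipC hs (ne_top_of_le_ne_top ENNReal.ofReal_ne_top h1) hω)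
        (h3 ω hω φ) x
      have havg : AiryKAM.avg (f ω φ) = f ω φ x := by
        have : f ω φ = fun _ => f ω φ x := funext fun y => hmm ω φ y x
        simp only [AiryKAM.avg]
        rw [this, intervalIntegral.integral_const]
        have := Real.pi_ne_zero
        simp
        field_simp
      rw [havg] at this
      exact hasSum_of_eq this fun k => by simp [v, hmm]
    · exact hasSum_of_eq (h3 ω hω φ x) fun k => by simp [v, hmm]
  have hfin : ∀ ω ∈ O, anorm η s (fun k => v k ω) ≤ ENNReal.ofReal b := fun ω hω =>
    (ENNReal.tsum_le_tsum fun k => mul_le_mul' (enorm_le_lipC hω) le_rfl).trans hv1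
  refine ⟨fun ω k => v k ω, (lipNorm_anorm_le v).trans hv1, fun ω hω => ⟨⟨fun k => ?_, ?_⟩, ?_⟩,
    fun h ω _ l j hj => ?_⟩
  · simp only [v, Prod.snd_neg, neg_eq_zero, h2]
    split_ifs <;> simp
  · exact (hfin ω hω).trans_lt ENNReal.ofReal_lt_top
  · funext φ x
    exact eval_eq_of_hasSum (hv2 ω hω φ x)
  · simp [v, hj, show m from h]

end Fourier

/-! ### Small divisors -/

section SmallDivisors

/-- The product `∏ (1 + ℓ_i² i²)` of the Diophantine condition. -/
def divisorProd (l : ℕ →₀ ℤ) : ℝ := ∏ i ∈ l.support, (1 + |(l i : ℝ)| ^ 2 * ((i : ℝ) + 1) ^ 2)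

lemma one_le_divisorProd (l : ℕ →₀ ℤ) : 1 ≤ divisorProd l :=
  Finset.prod_induction _ (fun x => 1 ≤ x) (fun _ _ => one_le_mul_of_one_le_of_one_le) le_rfl fun i _ => by
    have : 0 ≤ |(l i : ℝ)| ^ 2 * ((i : ℝ) + 1) ^ 2 := by positivity
    linarith

/-- A single factor of the product. With `z = i^η |a|` it is at most a power of `z`, and hence its
logarithm is at most a small power of `z`. -/
lemma log_factor_le {η ν : ℝ} (hη : 0 < η) (hν : 0 < ν) {i a : ℝ} (hi : 1 ≤ i) (ha : 1 ≤ a) :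
    2 * Real.log (1 + a ^ 2 * i ^ 2) ≤ (2 + (4 + 4 / η) / ν) * (i ^ η * a) ^ ν := by
  have hiη : 1 ≤ i ^ η := Real.one_le_rpow hi hη.le
  have hz : 1 ≤ i ^ η * a := one_le_mul_of_one_le_of_one_le hiη ha
  set z := i ^ η * a with hzdef
  have haz : a ≤ z := by nlinarith
  have hiz : i ≤ z ^ (1 / η) := by
    have : i = (i ^ η) ^ (1 / η) := by
      rw [← Real.rpow_mul (by linarith), mul_one_div_cancel hη.ne', Real.rpow_one]
    calc i = (i ^ η) ^ (1 / η) := this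
      _ ≤ _ := Real.rpow_le_rpow (by linarith) (by nlinarith) (by positivity)
  have h1 : Real.log (1 + a ^ 2 * i ^ 2) ≤ Real.log 2 + 2 * Real.log a + 2 * Real.log i := by
    have : Real.log (2 * a ^ 2 * i ^ 2) = Real.log 2 + 2 * Real.log a + 2 * Real.log i := by
      rw [Real.log_mul (by positivity) (by positivity), Real.log_mul (by positivity) (by positivity),
        Real.log_pow, Real.log_pow]
      norm_num
    rw [← this]
    refine Real.log_le_log (by positivity) ?_
    have : 1 ≤ a ^ 2 * i ^ 2 := one_le_mul_of_one_le_of_one_le (one_le_pow₀ ha) (one_le_pow₀ hi)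
    linarith
  have h2 : Real.log a ≤ Real.log z := Real.log_le_log (by linarith) haz
  have h3 : Real.log i ≤ 1 / η * Real.log z := by
    rw [← Real.log_rpow (by linarith)]
    exact Real.log_le_log (by linarith) hiz
  have h4 : Real.log z ≤ z ^ ν / ν := Real.log_le_rpow_div (by linarith) hν
  have h5 : Real.log 2 ≤ 1 := by linarith [Real.log_two_lt_d9]
  have h6 : 1 ≤ z ^ ν := Real.one_le_rpow hz hν.le
  calc 2 * Real.log (1 + a ^ 2 * i ^ 2) ≤ 2 + (4 + 4 / η) * Real.log z := by
        have : (4 + 4 / η) * Real.log z = 4 * Real.log z + 4 * (1 / η * Real.log z) := by ring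
        linarith
    _ ≤ 2 * z ^ ν + (4 + 4 / η) * (z ^ ν / ν) := by
        have : (4 + 4 / η) * Real.log z ≤ (4 + 4 / η) * (z ^ ν / ν) :=
          mul_le_mul_of_nonneg_left h4 (by positivity)
        linarith
    _ = _ := by ring

/-- The main estimate on small divisors: only the factors with `i^η |ℓ_i| ≤ R`, where `R` is a power
of `1/δ`, are not compensated by `e^{-δ i^η |ℓ_i|}`. There are at most `R^{1/η}` of them, since
`ℓ_i ≠ 0`, and each contributes at most a small power of `R` to the logarithm. -/
lemma exists_divisorProd_le {η μ : ℝ} (hη : 0 < η) (hμ : 1 / η < μ) :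
    ∃ c : ℝ, 0 < c ∧ ∀ δ : ℝ, 0 < δ → ∀ l : ℕ →₀ ℤ,
      divisorProd l ^ 2 ≤ Real.exp (c * δ ^ (-μ) + δ * wt η l) := by
  have hη1 : 0 < 1 / η := by positivity
  have hμ0 : 0 < μ := hη1.trans hμ
  set ν := (μ - 1 / η) / (1 + μ) with hνdef
  have hν : 0 < ν := div_pos (by linarith) (by linarith)
  have hν1 : ν < 1 := by rw [hνdef, div_lt_one (by linarith)]; linarith
  have hνμ : ν + 1 / η = μ * (1 - ν) := by rw [hνdef]; field_simp; ring
  set c := 2 + (4 + 4 / η) / ν with hc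
  have hc0 : 0 < c := by positivity
  refine ⟨c * c ^ μ, by positivity, fun δ hδ l => ?_⟩
  set R := (c / δ) ^ (1 / (1 - ν)) with hR
  have hR0 : 0 < R := by positivity
  have hpos : ∀ i ∈ l.support, 0 < 1 + |(l i : ℝ)| ^ 2 * ((i : ℝ) + 1) ^ 2 := fun i _ => by positivity
  have hRpow : R ^ (1 / η) * (c * R ^ ν) = c * c ^ μ * δ ^ (-μ) := by
    have e1 : R ^ (1 / η) * R ^ ν = (c / δ) ^ μ := by
      rw [← Real.rpow_add hR0, add_comm, hνμ, hR, ← Real.rpow_mul (by positivity)]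
      congr 1
      have : 1 - ν ≠ 0 := by linarith
      field_simp
    calc _ = c * (R ^ (1 / η) * R ^ ν) := by ring
      _ = c * (c / δ) ^ μ := by rw [e1]
      _ = _ := by rw [Real.div_rpow hc0.le hδ.le, Real.rpow_neg hδ.le]; ring
  have key : ∑ i ∈ l.support, 2 * Real.log (1 + |(l i : ℝ)| ^ 2 * ((i : ℝ) + 1) ^ 2) ≤
      c * c ^ μ * δ ^ (-μ) + δ * wt η l := by
    have hterm : ∀ i ∈ l.support, 2 * Real.log (1 + |(l i : ℝ)| ^ 2 * ((i : ℝ) + 1) ^ 2) ≤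
        (if i < ⌊R ^ (1 / η)⌋₊ then c * R ^ ν else 0) + δ * (((i : ℝ) + 1) ^ η * |(l i : ℝ)|) := by
      intro i hi
      have hi1 : (1 : ℝ) ≤ (i : ℝ) + 1 := by linarith [Nat.cast_nonneg (α := ℝ) i]
      have ha : (1 : ℝ) ≤ |(l i : ℝ)| := by
        exact_mod_cast Int.one_le_abs (Finsupp.mem_support_iff.1 hi)
      have h := log_factor_le hη hν hi1 ha
      have hz : 1 ≤ ((i : ℝ) + 1) ^ η * |(l i : ℝ)| :=
        one_le_mul_of_one_le_of_one_le (Real.one_le_rpow hi1 hη.le) ha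
      set z := ((i : ℝ) + 1) ^ η * |(l i : ℝ)| with hzdef
      refine h.trans ?_
      by_cases hzR : z ≤ R
      · have hlt : i < ⌊R ^ (1 / η)⌋₊ := by
          rw [← Nat.succ_le_iff, Nat.le_floor_iff (by positivity)]
          push_cast
          have e : (i : ℝ) + 1 = (((i : ℝ) + 1) ^ η) ^ (1 / η) := by
            rw [← Real.rpow_mul (by linarith), mul_one_div_cancel hη.ne', Real.rpow_one]
          rw [e]
          refine Real.rpow_le_rpow (by positivity) (le_trans ?_ hzR) hη1.le
          have : 0 ≤ ((i : ℝ) + 1) ^ η := by positivity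
          nlinarith
        rw [if_pos hlt]
        have : c * z ^ ν ≤ c * R ^ ν := by gcongr
        have : 0 ≤ δ * z := by positivity
        linarith
      · have h1 : c / δ ≤ z ^ (1 - ν) := by
          have : c / δ = R ^ (1 - ν) := by
            rw [hR, ← Real.rpow_mul (by positivity), one_div_mul_cancel (by linarith), Real.rpow_one]
          rw [this]
          exact Real.rpow_le_rpow hR0.le (le_of_not_ge hzR) (by linarith)
        have h2 : c * z ^ ν ≤ δ * z := by
          rw [div_le_iff₀ hδ] at h1
          calc c * z ^ ν ≤ (z ^ (1 - ν) * δ) * z ^ ν := by gcongr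
            _ = δ * (z ^ (1 - ν) * z ^ ν) := by ring
            _ = δ * z := by
                rw [← Real.rpow_add (by linarith), sub_add_cancel, Real.rpow_one]
        have : 0 ≤ (if i < ⌊R ^ (1 / η)⌋₊ then c * R ^ ν else 0) := by
          split_ifs <;> positivity
        linarith
    refine (Finset.sum_le_sum hterm).trans ?_
    rw [Finset.sum_add_distrib, ← Finset.mul_sum]
    refine add_le_add ?_ le_rfl
    rw [← Finset.sum_filter, Finset.sum_const, nsmul_eq_mul, ← hRpow]
    gcongr
    have hcard : (l.support.filter fun i => i < ⌊R ^ (1 / η)⌋₊).card ≤ ⌊R ^ (1 / η)⌋₊ := by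
      refine (Finset.card_le_card (t := Finset.range ⌊R ^ (1 / η)⌋₊) fun i hi => ?_).trans
        (Finset.card_range _).le
      exact Finset.mem_range.2 (Finset.mem_filter.1 hi).2
    calc _ ≤ ((⌊R ^ (1 / η)⌋₊ : ℕ) : ℝ) := by exact_mod_cast hcard
      _ ≤ _ := Nat.floor_le (by positivity)
  calc divisorProd l ^ 2 = Real.exp (2 * Real.log (divisorProd l)) := by
        rw [two_mul, Real.exp_add, Real.exp_log (by linarith [one_le_divisorProd l]), sq]
    _ ≤ _ := by
        rw [Real.exp_le_exp]
        unfold divisorProd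
        rw [Real.log_prod fun i hi => (hpos i hi).ne', Finset.mul_sum]
        exact key

lemma lipC_inv_le {γ : ℝ} {O : Set (ℕ → ℝ)} {f : (ℕ → ℝ) → ℂ} {a : ℝ}
    (ha : ∀ ω ∈ O, f ω ≠ 0 ∧ ‖(f ω)⁻¹‖ ≤ a) :
    lipC γ O (fun ω => (f ω)⁻¹) ≤ ENNReal.ofReal a + ENNReal.ofReal a ^ 2 * lipC γ O f := by
  obtain ⟨A, l, h1, h2, h3⟩ := exists_lipNorm_eq (fun a : ℂ => ‖a‖ₑ) γ O f
  have h3' : lipC γ O f = A + ENNReal.ofReal γ * l := h3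
  have he : ∀ ω ∈ O, ‖(f ω)⁻¹‖ₑ ≤ ENNReal.ofReal a := fun ω hω => by
    rw [← ofReal_norm]
    exact ENNReal.ofReal_le_ofReal (ha ω hω).2
  refine lipNorm_le (a := ENNReal.ofReal a) (l := ENNReal.ofReal a ^ 2 * l) he
    (fun ω₁ H₁ ω₂ H₂ hne => ?_) ?_
  · have e : (f ω₁)⁻¹ - (f ω₂)⁻¹ = -((f ω₁)⁻¹ * (f ω₂)⁻¹ * (f ω₁ - f ω₂)) := by
      have := (ha ω₁ H₁).1
      have := (ha ω₂ H₂).1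
      field_simp
      ring
    rw [e, enorm_neg, enorm_mul, enorm_mul, mul_div_assoc, sq]
    exact mul_le_mul' (mul_le_mul' (he _ H₁) (he _ H₂)) (h2 _ H₁ _ H₂ hne)
  · rw [h3', mul_add]
    calc _ = ENNReal.ofReal a + ENNReal.ofReal a ^ 2 * (ENNReal.ofReal γ * l) := by ring
      _ ≤ _ := by gcongr; exact le_add_self

lemma dioph_lower {γbar : ℝ} (hγ : 0 < γbar) {ω : ℕ → ℝ} (hω : ω ∈ Dioph γbar) {l : ℕ →₀ ℤ}
    (hl : l ≠ 0) : dot l ω ≠ 0 ∧ |dot l ω|⁻¹ ≤ divisorProd l / γbar := by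
  have h := hω.2 l hl
  have hP : 0 < divisorProd l := by linarith [one_le_divisorProd l]
  have e : ∏ i ∈ l.support, 1 / (1 + |(l i : ℝ)| ^ 2 * ((i : ℝ) + 1) ^ 2) = (divisorProd l)⁻¹ := by
    unfold divisorProd
    rw [← Finset.prod_inv_distrib]
    exact Finset.prod_congr rfl fun i _ => one_div _
  rw [e, ← div_eq_mul_inv] at h
  have hpos : 0 < γbar / divisorProd l := by positivity
  refine ⟨fun h0 => ?_, ?_⟩
  · rw [h0, abs_zero] at h
    linarith
  · rw [← inv_div]
    exact inv_anti₀ hpos h.le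

lemma exists_smallDivisor_le {η μ γbar : ℝ} (hη : 0 < η) (hμ1 : 1 < μ) (hμ : 1 / η < μ)
    (hγbar : 0 < γbar) :
    ∃ c : ℝ, 0 < c ∧ ∀ δ : ℝ, 0 < δ → δ ≤ 1 → ∀ γ : ℝ, γ < 1 → ∀ O : Set (ℕ → ℝ), O ⊆ Dioph γbar →
      ∀ s : ℝ, ∀ l : ℕ →₀ ℤ, l ≠ 0 → lipC γ O (fun ω => (Complex.I * (dot l ω : ℂ))⁻¹) *
        weight η (s - δ) (l, 0) ≤ ENNReal.ofReal (Real.exp (c * δ ^ (-μ))) * weight η s (l, 0) := by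
  obtain ⟨c, hc, h⟩ := exists_divisorProd_le hη hμ
  have hμ0 : 0 < μ := by linarith
  set K := 6 / γbar ^ 2 + 1 / γbar with hK
  have hK0 : 0 < K := by positivity
  refine ⟨c * 2 ^ μ + K + 1, by positivity, fun δ hδ hδ1 γ hγ O hO s l hl => ?_⟩
  set X := δ ^ (-μ) with hX
  have hX1 : 1 / δ ≤ X := by
    rw [hX, one_div, ← Real.rpow_neg_one]
    exact Real.rpow_le_rpow_of_exponent_ge hδ hδ1 (by linarith)
  have hX2 : 1 ≤ X := le_trans (by rw [le_div_iff₀ hδ]; linarith) hX1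
  set w := wt η l with hw
  have hw0 : 0 ≤ w := wt_nonneg η l
  set P := divisorProd l with hP
  have hP1 : 1 ≤ P := one_le_divisorProd l
  have hPle : P ^ 2 ≤ Real.exp (c * 2 ^ μ * X + δ / 2 * w) := by
    have := h (δ / 2) (by linarith) l
    rwa [Real.div_rpow hδ.le (by norm_num), Real.rpow_neg (by norm_num : (0 : ℝ) ≤ 2), div_inv_eq_mul,
      mul_comm (δ ^ (-μ)), ← mul_assoc] at this
  have hN : lipC γ O (fun ω => (Complex.I * (dot l ω : ℂ))⁻¹) ≤
      ENNReal.ofReal (P / γbar + (P / γbar) ^ 2 * (3 * w)) := by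
    refine (lipC_inv_le (a := P / γbar) fun ω hω => ?_).trans ?_
    · obtain ⟨h1, h2⟩ := dioph_lower hγbar (hO hω) hl
      refine ⟨mul_ne_zero Complex.I_ne_zero (by exact_mod_cast h1), ?_⟩
      rwa [norm_inv, norm_mul, Complex.norm_I, one_mul, Complex.norm_real, Real.norm_eq_abs]
    · rw [ENNReal.ofReal_add (by positivity) (by positivity), ENNReal.ofReal_mul (by positivity),
        ENNReal.ofReal_pow (by positivity)]
      gcongr
      refine lipC_mul.trans ((mul_le_mul' (lipC_const _)
        (lipC_dot hη hγ (fun ω hω => (hO hω).1) l)).trans ?_)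
      rw [← ofReal_norm, Complex.norm_I, ENNReal.ofReal_one, one_mul]
  have hsmall : P / γbar + (P / γbar) ^ 2 * (3 * w) ≤
      Real.exp ((c * 2 ^ μ + K + 1) * X) * Real.exp (δ * w) := by
    have h1 : P / γbar + (P / γbar) ^ 2 * (3 * w) ≤ P ^ 2 * (K * (1 / δ * (1 + δ / 2 * w))) := by
      have e1 : P / γbar ≤ P ^ 2 * (1 / γbar * (1 / δ * (1 + δ / 2 * w))) := by
        have : 1 ≤ 1 / δ * (1 + δ / 2 * w) :=
          one_le_mul_of_one_le_of_one_le (by rw [le_div_iff₀ hδ]; linarith)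
            (by have : 0 ≤ δ / 2 * w := by positivity
                linarith)
        calc P / γbar = P * (1 / γbar * 1) := by ring
          _ ≤ P ^ 2 * (1 / γbar * (1 / δ * (1 + δ / 2 * w))) := by
              gcongr
              nlinarith
      have e2 : (P / γbar) ^ 2 * (3 * w) ≤ P ^ 2 * (6 / γbar ^ 2 * (1 / δ * (1 + δ / 2 * w))) := by
        have : 3 * w ≤ 6 * (1 / δ * (1 + δ / 2 * w)) := by
          have : 6 * (1 / δ * (1 + δ / 2 * w)) = 6 / δ + 3 * w := by field_simp; ring
          rw [this]
          have : 0 < 6 / δ := by positivity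
          linarith
        calc _ = P ^ 2 * (1 / γbar ^ 2 * (3 * w)) := by ring
          _ ≤ P ^ 2 * (1 / γbar ^ 2 * (6 * (1 / δ * (1 + δ / 2 * w)))) := by gcongr
          _ = _ := by ring
      calc _ ≤ _ := add_le_add e1 e2
        _ = _ := by rw [hK]; ring
    refine h1.trans ?_
    calc _ ≤ Real.exp (c * 2 ^ μ * X + δ / 2 * w) * (Real.exp (K * X) *
          (Real.exp X * Real.exp (δ / 2 * w))) := by
          gcongr
          · calc K ≤ K * X := le_mul_of_one_le_right hK0.le hX2
              _ ≤ _ := by linarith [Real.add_one_le_exp (K * X)]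
          · linarith [Real.add_one_le_exp X]
          · linarith [Real.add_one_le_exp (δ / 2 * w)]
      _ = _ := by
          simp only [← Real.exp_add]
          congr 1
          ring
  have hwt : weight η s (l, 0) = weight η (s - δ) (l, 0) * ENNReal.ofReal (Real.exp (δ * w)) := by
    have := ofReal_exp_mul_weight (η := η) δ (s - δ) (l, 0)
    rw [sub_add_cancel] at this
    rw [← this, hw]
    simp [freqSize]
  rw [hwt]
  calc _ ≤ ENNReal.ofReal (Real.exp ((c * 2 ^ μ + K + 1) * X) * Real.exp (δ * w)) *
        weight η (s - δ) (l, 0) := by gcongr; exact hN.trans (ENNReal.ofReal_le_ofReal hsmall)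
    _ = _ := by rw [ENNReal.ofReal_mul (Real.exp_nonneg _)]; ring

/-! ### The sum of all exponential weights -/

lemma exists_sum_inv_sq : ∃ K : ℝ, 0 < K ∧ ∀ (t : Finset ℤ) (y : ℝ), 1 ≤ y →
    ∑ a ∈ t, 1 / (1 + |(a : ℝ)| ^ 2 * y ^ 2) ≤ 1 + K / y ^ 2 := by
  have hsum : Summable fun a : ℤ => 1 / (a : ℝ) ^ 2 := Real.summable_one_div_int_pow.2 (by norm_num)
  refine ⟨1 + ∑' a : ℤ, 1 / (a : ℝ) ^ 2, by
    have : 0 ≤ ∑' a : ℤ, 1 / (a : ℝ) ^ 2 := tsum_nonneg fun a => by positivity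
    linarith, fun t y hy => ?_⟩
  have hterm : ∀ a ∈ t, 1 / (1 + |(a : ℝ)| ^ 2 * y ^ 2) ≤
      (if a = 0 then 1 else 0) + 1 / y ^ 2 * (1 / (a : ℝ) ^ 2) := fun a _ => by
    split_ifs with h
    · simp [h]
    · have ha : (0 : ℝ) < (a : ℝ) ^ 2 := by positivity
      rw [zero_add, sq_abs, one_div_mul_one_div_rev]
      refine one_div_le_one_div_of_le (by positivity) ?_
      linarith
  refine (Finset.sum_le_sum hterm).trans ?_
  rw [Finset.sum_add_distrib, ← Finset.mul_sum]
  have h1 : ∑ a ∈ t, (if a = 0 then (1 : ℝ) else 0) ≤ 1 := by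
    rw [Finset.sum_ite_eq']
    split_ifs <;> norm_num
  have h2 : ∑ a ∈ t, 1 / (a : ℝ) ^ 2 ≤ ∑' a : ℤ, 1 / (a : ℝ) ^ 2 :=
    hsum.sum_le_tsum t fun a _ => by positivity
  calc _ ≤ 1 + 1 / y ^ 2 * (∑' a : ℤ, 1 / (a : ℝ) ^ 2) := by gcongr
    _ ≤ _ := by
        have : 0 < 1 / y ^ 2 := by positivity
        rw [one_div_mul_eq_div, add_div]
        linarith

/-- `∑ ∏ 1/(1 + ℓ_i² i²)` converges over all finitely supported `ℓ`, as the infinite product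
`∏_i (1 + O(1/i²))` does. -/
lemma exists_tsum_inv_divisorProd :
    ∃ K : ℝ, 0 < K ∧ ∑' l : ℕ →₀ ℤ, ENNReal.ofReal (divisorProd l)⁻¹ ≤ ENNReal.ofReal K := by
  classical
  obtain ⟨K, hK, h⟩ := exists_sum_inv_sq
  have hsum : Summable fun i : ℕ => 1 / ((i : ℝ) + 1) ^ 2 := by
    have := (summable_nat_add_iff 1).2 (Real.summable_one_div_nat_pow.2 (one_lt_two))
    simpa using this
  refine ⟨Real.exp (K * ∑' i : ℕ, 1 / ((i : ℝ) + 1) ^ 2), Real.exp_pos _, ?_⟩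
  rw [ENNReal.tsum_eq_iSup_sum]
  refine iSup_le fun T => ?_
  rw [← ENNReal.ofReal_sum_of_nonneg fun l _ => by
    have := one_le_divisorProd l
    positivity]
  refine ENNReal.ofReal_le_ofReal ?_
  -- all indices in `T` are supported in `{0, …, n - 1}` and have values in a finite set `V`
  obtain ⟨n, hn⟩ : ∃ n, ∀ l ∈ T, l.support ⊆ Finset.range n := by
    obtain ⟨n, hn⟩ := (T.biUnion fun l => l.support).exists_nat_subset_range
    exact ⟨n, fun l hl => (Finset.subset_biUnion_of_mem (fun l : ℕ →₀ ℤ => l.support) hl).trans hn⟩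
  set V : Finset ℤ := T.biUnion fun l => (Finset.range n).image fun i => l i with hV
  set g : ℕ → ℤ → ℝ := fun i a => 1 / (1 + |(a : ℝ)| ^ 2 * ((i : ℝ) + 1) ^ 2) with hg
  have hg0 : ∀ i a, 0 ≤ g i a := fun i a => by simp only [hg]; positivity
  have hP : ∀ l ∈ T, (divisorProd l)⁻¹ = ∏ i : Fin n, g i (l i) := fun l hl => by
    rw [Fin.prod_univ_eq_prod_range (fun i => g i (l i)) n, ← Finset.prod_subset (hn l hl)]
    · unfold divisorProd
      rw [← Finset.prod_inv_distrib]
      exact Finset.prod_congr rfl fun i _ => (one_div _).symm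
    · intro i _ hi
      simp [hg, Finsupp.notMem_support_iff.1 hi]
  calc ∑ l ∈ T, (divisorProd l)⁻¹ = ∑ l ∈ T, ∏ i : Fin n, g i (l i) := Finset.sum_congr rfl hP
    _ ≤ ∑ x ∈ Fintype.piFinset fun _ : Fin n => V, ∏ i : Fin n, g i (x i) := by
        rw [← Finset.sum_image (s := T) (g := fun (l : ℕ →₀ ℤ) (i : Fin n) => l i)
          (f := fun x : Fin n → ℤ => ∏ i : Fin n, g i (x i))]
        · refine Finset.sum_le_sum_of_subset_of_nonneg (fun x hx => ?_)
            fun x _ _ => Finset.prod_nonneg fun i _ => hg0 _ _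
          obtain ⟨l, hl, rfl⟩ := Finset.mem_image.1 hx
          rw [Fintype.mem_piFinset]
          intro i
          exact Finset.mem_biUnion.2 ⟨l, hl, Finset.mem_image.2 ⟨i, Finset.mem_range.2 i.2, rfl⟩⟩
        · intro l hl l' hl' hll
          ext i
          by_cases hi : i < n
          · exact congrFun hll ⟨i, hi⟩
          · have h1 : i ∉ l.support := fun h => hi (Finset.mem_range.1 (hn l hl h))
            have h2 : i ∉ l'.support := fun h => hi (Finset.mem_range.1 (hn l' hl' h))
            rw [Finsupp.notMem_support_iff.1 h1, Finsupp.notMem_support_iff.1 h2]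
    _ = ∏ i : Fin n, ∑ a ∈ V, g i a := (Finset.prod_univ_sum _ _).symm
    _ ≤ ∏ i : Fin n, Real.exp (K * (1 / ((i : ℝ) + 1) ^ 2)) := by
        refine Finset.prod_le_prod (fun i _ => Finset.sum_nonneg fun a _ => hg0 _ _) fun i _ => ?_
        refine (h V ((i : ℝ) + 1) (by linarith [Nat.cast_nonneg (α := ℝ) (i : ℕ)])).trans ?_
        have := Real.add_one_le_exp (K * (1 / (((i : ℕ) : ℝ) + 1) ^ 2))
        rw [mul_one_div] at this ⊢
        linarith
    _ = Real.exp (K * ∑ i ∈ Finset.range n, 1 / ((i : ℝ) + 1) ^ 2) := by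
        rw [← Real.exp_sum, Finset.mul_sum,
          Fin.sum_univ_eq_sum_range (fun i => K * (1 / ((i : ℝ) + 1) ^ 2)) n]
    _ ≤ _ := by
        gcongr
        exact hsum.sum_le_tsum _ fun i _ => by positivity

lemma exists_tsum_weight_le {η μ : ℝ} (hη : 0 < η) (hμ1 : 1 < μ) (hμ : 1 / η < μ) :
    ∃ c : ℝ, 0 < c ∧ ∀ δ : ℝ, 0 < δ → δ ≤ 1 →
      ∑' k, weight η (-δ) k ≤ ENNReal.ofReal (Real.exp (c * δ ^ (-μ))) := by
  obtain ⟨c, hc, h⟩ := exists_divisorProd_le hη hμ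
  obtain ⟨K, hK, hKs⟩ := exists_tsum_inv_divisorProd
  obtain ⟨J, hJ, hJs⟩ := exists_sum_inv_sq
  refine ⟨c + K + 8 * (1 + J) + 1 + 1, by positivity, fun δ hδ hδ1 => ?_⟩
  set X := δ ^ (-μ) with hX
  have hX1 : 1 / δ ≤ X := by
    rw [hX, one_div, ← Real.rpow_neg_one]
    exact Real.rpow_le_rpow_of_exponent_ge hδ hδ1 (by linarith)
  have hX2 : 1 ≤ X := le_trans (by rw [le_div_iff₀ hδ]; linarith) hX1
  have hl : ∑' l : ℕ →₀ ℤ, ENNReal.ofReal (Real.exp (-δ * wt η l)) ≤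
      ENNReal.ofReal (Real.exp (c * X) * K) := by
    rw [ENNReal.ofReal_mul (Real.exp_nonneg _)]
    refine le_trans ?_ (mul_le_mul_right hKs _)
    rw [← ENNReal.tsum_mul_left]
    refine ENNReal.tsum_le_tsum fun l => ?_
    rw [← ENNReal.ofReal_mul (Real.exp_nonneg _)]
    refine ENNReal.ofReal_le_ofReal ?_
    have hP := one_le_divisorProd l
    rw [← div_eq_mul_inv, le_div_iff₀ (by linarith)]
    calc _ ≤ Real.exp (-δ * wt η l) * divisorProd l ^ 2 := by gcongr; nlinarith
      _ ≤ Real.exp (-δ * wt η l) * Real.exp (c * X + δ * wt η l) := by gcongr; exact h δ hδ l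
      _ = _ := by rw [← Real.exp_add]; congr 1; ring
  have hj : ∑' j : ℤ, ENNReal.ofReal (Real.exp (-δ * |(j : ℝ)|)) ≤
      ENNReal.ofReal (4 * X * X * (1 + J)) := by
    rw [ENNReal.tsum_eq_iSup_sum]
    refine iSup_le fun T => ?_
    rw [← ENNReal.ofReal_sum_of_nonneg fun l _ => Real.exp_nonneg _]
    refine ENNReal.ofReal_le_ofReal ?_
    have hJT := hJs T 1 le_rfl
    calc _ ≤ ∑ j ∈ T, 4 * X * X * (1 / (1 + |(j : ℝ)| ^ 2 * 1 ^ 2)) := by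
          refine Finset.sum_le_sum fun j _ => ?_
          set a := |(j : ℝ)|
          have ha : 0 ≤ a := abs_nonneg _
          rw [mul_one_div, le_div_iff₀ (by positivity), neg_mul, Real.exp_neg,
            inv_mul_le_iff₀ (Real.exp_pos _)]
          have h1 : 1 + δ * a + (δ * a) ^ 2 / 2 ≤ Real.exp (δ * a) :=
            by linarith [Real.quadratic_le_exp_of_nonneg (show 0 ≤ δ * a by positivity)]
          have hXδ : 1 ≤ X * δ := by rwa [div_le_iff₀ hδ] at hX1
          have e1 : 1 ≤ X * X := one_le_mul_of_one_le_of_one_le hX2 hX2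
          have e2 : 1 ≤ (X * δ) * (X * δ) := one_le_mul_of_one_le_of_one_le hXδ hXδ
          calc 1 + a ^ 2 * 1 ^ 2 ≤ (X * X) * 1 + (X * δ * (X * δ)) * a ^ 2 := by nlinarith [sq_nonneg a]
            _ ≤ (1 + δ * a + (δ * a) ^ 2 / 2) * (4 * X * X) := by
                have : 0 ≤ δ * a * (X * X) := by positivity
                have : 0 ≤ (δ * a) ^ 2 * (X * X) := by positivity
                nlinarith
            _ ≤ _ := by gcongr
      _ = 4 * X * X * ∑ j ∈ T, 1 / (1 + |(j : ℝ)| ^ 2 * 1 ^ 2) := by rw [Finset.mul_sum]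
      _ ≤ _ := by
          gcongr
          simpa using hJT
  have hprod : ∑' k, weight η (-δ) k = (∑' l : ℕ →₀ ℤ, ENNReal.ofReal (Real.exp (-δ * wt η l))) *
      ∑' j : ℤ, ENNReal.ofReal (Real.exp (-δ * |(j : ℝ)|)) := by
    have e : ∀ k : Freq, weight η (-δ) k = ENNReal.ofReal (Real.exp (-δ * wt η k.1)) *
        ENNReal.ofReal (Real.exp (-δ * |(k.2 : ℝ)|)) := fun k => by
      unfold weight freqSize
      rw [← ENNReal.ofReal_mul (Real.exp_nonneg _), ← Real.exp_add, mul_add]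
    simp_rw [e]
    rw [ENNReal.tsum_prod']
    simp_rw [ENNReal.tsum_mul_left, ENNReal.tsum_mul_right]
  rw [hprod]
  refine (mul_le_mul' hl hj).trans ?_
  rw [← ENNReal.ofReal_mul (by positivity)]
  refine ENNReal.ofReal_le_ofReal ?_
  have hXe : X ≤ Real.exp X := by linarith [Real.add_one_le_exp X]
  calc Real.exp (c * X) * K * (4 * X * X * (1 + J))
      = Real.exp (c * X) * K * (4 * (1 + J)) * X * X := by ring
    _ ≤ Real.exp (c * X) * Real.exp (K * X) * Real.exp (8 * (1 + J) * X) * Real.exp X * Real.exp X := by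
        gcongr
        · calc K ≤ K * X := le_mul_of_one_le_right hK.le hX2
            _ ≤ _ := by linarith [Real.add_one_le_exp (K * X)]
        · calc 4 * (1 + J) ≤ 8 * (1 + J) * X := by nlinarith
            _ ≤ _ := by linarith [Real.add_one_le_exp (8 * (1 + J) * X)]
    _ = _ := by
        simp only [← Real.exp_add]
        congr 1
        ring

end SmallDivisors

/-! ### The symplectic structure -/

section Symplectic

open MeasureTheory intervalIntegral

lemma avg_eq_zero_iff {u : ℝ → ℝ} : avg u = 0 ↔ ∫ x in (0 : ℝ)..(2 * Real.pi), u x = 0 := by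
  unfold avg
  have := Real.pi_pos
  rw [mul_eq_zero]
  exact or_iff_right (by positivity)

/-- In the symplectic form, `∂_x⁻¹ u` may be replaced by any primitive of `u`. -/
lemma sympForm_eq {u v W : ℝ → ℝ} (hu : Continuous u) (hW : ∀ x, HasDerivAt W (u x) x)
    (hv : Continuous v) (hv0 : avg v = 0) : sympForm u v = ∫ x in (0 : ℝ)..(2 * Real.pi), W x * v x := by
  have h1 : ∀ x, ∫ y in (0 : ℝ)..x, u y = W x - W 0 := fun x =>
    integral_eq_sub_of_hasDerivAt (fun y _ => hW y) (hu.intervalIntegrable _ _)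
  have hWc : Continuous W := continuous_iff_continuousAt.2 fun x => (hW x).continuousAt
  have h2 : ∀ x, invDx u x * v x = W x * v x - (W 0 + avg fun z => ∫ y in (0 : ℝ)..z, u y) * v x :=
    fun x => by
      simp only [invDx, h1 x]
      ring
  unfold sympForm
  simp_rw [h2]
  have i1 : IntervalIntegrable (fun x => W x * v x) volume 0 (2 * Real.pi) :=
    (hWc.mul hv).intervalIntegrable _ _
  rw [integral_sub i1 ((hv.intervalIntegrable _ _).const_mul _), intervalIntegral.integral_const_mul, avg_eq_zero_iff.1 hv0, mul_zero, sub_zero]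

/-- Substitution of a diffeomorphism of the circle in an integral over a period. -/
lemma integral_comp_circle {g ρ : ℝ → ℝ} (hg : ∀ x, HasDerivAt g (ρ x) x) (hρ : Continuous ρ)
    (hper : ∀ x, g (x + 2 * Real.pi) = g x + 2 * Real.pi) {f : ℝ → ℝ} (hf : Continuous f)
    (hfp : Function.Periodic f (2 * Real.pi)) :
    ∫ x in (0 : ℝ)..(2 * Real.pi), f (g x) * ρ x = ∫ x in (0 : ℝ)..(2 * Real.pi), f x := by
  have hg2 : g (2 * Real.pi) = g 0 + 2 * Real.pi := by simpa using hper 0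
  have := integral_comp_mul_deriv (a := 0) (b := 2 * Real.pi) (f := g) (f' := ρ) (g := f)
    (fun x _ => hg x) hρ.continuousOn hf
  simp only [Function.comp] at this
  rw [this, hg2, hfp.intervalIntegral_add_eq (g 0) 0, zero_add]

/-- The transport `u ↦ g' · (u ∘ g)` by a diffeomorphism `g` of the circle is symplectic. -/
lemma isSymplectic_transport {g ρ : ℝ → ℝ} (hg : ∀ x, HasDerivAt g (ρ x) x) (hρ : Continuous ρ)
    (hper : ∀ x, g (x + 2 * Real.pi) = g x + 2 * Real.pi) : IsSymplectic fun u x => ρ x * u (g x) := by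
  have hgc : Continuous g := continuous_iff_continuousAt.2 fun x => (hg x).continuousAt
  have hρper : ∀ x, ρ (x + 2 * Real.pi) = ρ x := fun x => by
    have h1 := (hg (x + 2 * Real.pi)).comp_add_const x (2 * Real.pi)
    have h2 := (hg x).add_const (2 * Real.pi)
    exact h1.unique (h2.congr_of_eventuallyEq (Eventually.of_forall hper))
  have hsubst : ∀ f : ℝ → ℝ, Continuous f → Function.Periodic f (2 * Real.pi) →
      ∫ x in (0 : ℝ)..(2 * Real.pi), f (g x) * ρ x = ∫ x in (0 : ℝ)..(2 * Real.pi), f x :=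
    fun f hf hfp => integral_comp_circle hg hρ hper hf hfp
  have hphase : ∀ u ∈ Phase, (fun x => ρ x * u (g x)) ∈ Phase := fun u hu => by
    refine ⟨hρ.mul (hu.1.comp hgc), fun x => ?_, avg_eq_zero_iff.2 ?_⟩
    · simp only [hρper, hper, hu.2.1 (g x)]
    · have := hsubst u hu.1 hu.2.1
      simp_rw [mul_comm (u _)] at this
      rw [this]
      exact avg_eq_zero_iff.1 hu.2.2
  refine ⟨hphase, fun u hu v hv => ?_⟩
  set U : ℝ → ℝ := fun x => ∫ y in (0 : ℝ)..x, u y with hU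
  have hUd : ∀ x, HasDerivAt U (u x) x := fun x =>
    integral_hasDerivAt_right (hu.1.intervalIntegrable _ _) (hu.1.stronglyMeasurableAtFilter _ _)
      hu.1.continuousAt
  have hUc : Continuous U := continuous_iff_continuousAt.2 fun x => (hUd x).continuousAt
  have hUp : Function.Periodic U (2 * Real.pi) := fun x => by
    have h1 : U (x + 2 * Real.pi) - U x = ∫ y in x..(x + 2 * Real.pi), u y := by
      rw [hU]
      exact integral_interval_sub_left (hu.1.intervalIntegrable _ _) (hu.1.intervalIntegrable _ _)
    have h2 := hu.2.1.intervalIntegral_add_eq x 0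
    rw [zero_add, avg_eq_zero_iff.1 hu.2.2] at h2
    linarith
  have hΦ : ∀ x, HasDerivAt (fun x => U (g x)) (ρ x * u (g x)) x := fun x => by
    rw [mul_comm]
    exact (hUd (g x)).comp x (hg x)
  rw [sympForm_eq (hphase u hu).1 hΦ (hphase v hv).1 (hphase v hv).2.2,
    sympForm_eq hu.1 hUd hv.1 hv.2.2]
  rw [← hsubst (fun x => U x * v x) (hUc.mul hv.1) (hUp.mul hv.2.1)]
  exact integral_congr fun x _ => by ring

/-- Smooth `2π`-periodic functions. -/
def SmoothPer (f : ℝ → ℝ) : Prop := ContDiff ℝ (⊤ : ℕ∞) f ∧ Function.Periodic f (2 * Real.pi)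

namespace SmoothPer

variable {f g : ℝ → ℝ}

lemma mul (hf : SmoothPer f) (hg : SmoothPer g) : SmoothPer fun x => f x * g x :=
  ⟨hf.1.mul hg.1, hf.2.mul hg.2⟩

lemma add (hf : SmoothPer f) (hg : SmoothPer g) : SmoothPer fun x => f x + g x :=
  ⟨hf.1.add hg.1, hf.2.add hg.2⟩

lemma sub (hf : SmoothPer f) (hg : SmoothPer g) : SmoothPer fun x => f x - g x :=
  ⟨hf.1.sub hg.1, hf.2.sub hg.2⟩

lemma hasDerivAt (hf : SmoothPer f) (x : ℝ) : HasDerivAt f (deriv f x) x :=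
  ((hf.1.differentiable (by simp)) x).hasDerivAt

lemma deriv (hf : SmoothPer f) : SmoothPer (deriv f) := by
  refine ⟨(contDiff_infty_iff_deriv.1 hf.1).2, fun x => ?_⟩
  have h1 := (hf.hasDerivAt (x + 2 * Real.pi)).comp_add_const x (2 * Real.pi)
  exact h1.unique ((hf.hasDerivAt x).congr_of_eventuallyEq (Eventually.of_forall hf.2))

lemma iteratedDeriv (hf : SmoothPer f) (n : ℕ) : SmoothPer (iteratedDeriv n f) := by
  induction n with
  | zero => simpa using hf
  | succ n ih => rw [iteratedDeriv_succ]; exact ih.deriv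

lemma integral_mul_deriv (hf : SmoothPer f) (hg : SmoothPer g) :
    ∫ x in (0 : ℝ)..(2 * Real.pi), f x * _root_.deriv g x =
      - ∫ x in (0 : ℝ)..(2 * Real.pi), _root_.deriv f x * g x := by
  rw [integral_mul_deriv_eq_deriv_mul (fun x _ => hf.hasDerivAt x) (fun x _ => hg.hasDerivAt x)
    (hf.deriv.1.continuous.intervalIntegrable _ _) (hg.deriv.1.continuous.intervalIntegrable _ _)]
  have h1 := hf.2 0
  have h2 := hg.2 0
  rw [zero_add] at h1 h2
  rw [h1, h2, sub_self, zero_sub]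

lemma integral_mul_iteratedDeriv (n : ℕ) (hf : SmoothPer f) (hg : SmoothPer g) :
    ∫ x in (0 : ℝ)..(2 * Real.pi), f x * _root_.iteratedDeriv n g x =
      (-1) ^ n * ∫ x in (0 : ℝ)..(2 * Real.pi), _root_.iteratedDeriv n f x * g x := by
  induction n generalizing g with
  | zero => simp
  | succ n ih =>
    rw [iteratedDeriv_succ', ih hg.deriv, integral_mul_deriv (hf.iteratedDeriv n) hg, pow_succ,
      ← iteratedDeriv_succ]
    ring

end SmoothPer

/-- A smooth periodic function that vanishes at `x₀` to third order and whose fourth derivative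
vanishes there. -/
lemma exists_test_function (x₀ : ℝ) : ∃ V, SmoothPer V ∧ V x₀ = 0 ∧ deriv V x₀ = 0 ∧
    iteratedDeriv 2 V x₀ = 0 ∧ iteratedDeriv 3 V x₀ = -6 ∧ iteratedDeriv 4 V x₀ = 0 := by
  set V : ℝ → ℝ := fun x => Real.sin (2 * (x - x₀)) - 2 * Real.sin (x - x₀) with hV
  have d1 : ∀ x, HasDerivAt (fun x : ℝ => x - x₀) 1 x := fun x => (hasDerivAt_id x).sub_const x₀
  have d2 : ∀ x, HasDerivAt (fun x : ℝ => 2 * (x - x₀)) 2 x := fun x => by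
    simpa using (d1 x).const_mul 2
  have e1 : deriv V = fun x => 2 * Real.cos (2 * (x - x₀)) - 2 * Real.cos (x - x₀) := funext fun x => by
    refine HasDerivAt.deriv (((d2 x).sin.sub ((d1 x).sin.const_mul 2)).congr_deriv ?_)
    ring
  have e2 : iteratedDeriv 2 V = fun x => -4 * Real.sin (2 * (x - x₀)) + 2 * Real.sin (x - x₀) := by
    rw [iteratedDeriv_succ, iteratedDeriv_one, e1]
    refine funext fun x => HasDerivAt.deriv
      ((((d2 x).cos.const_mul 2).sub ((d1 x).cos.const_mul 2)).congr_deriv ?_)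
    ring
  have e3 : iteratedDeriv 3 V = fun x => -8 * Real.cos (2 * (x - x₀)) + 2 * Real.cos (x - x₀) := by
    rw [iteratedDeriv_succ, e2]
    refine funext fun x => HasDerivAt.deriv
      ((((d2 x).sin.const_mul (-4)).add ((d1 x).sin.const_mul 2)).congr_deriv ?_)
    ring
  have e4 : iteratedDeriv 4 V = fun x => 16 * Real.sin (2 * (x - x₀)) - 2 * Real.sin (x - x₀) := by
    rw [iteratedDeriv_succ, e3]
    refine funext fun x => HasDerivAt.deriv
      ((((d2 x).cos.const_mul (-8)).add ((d1 x).cos.const_mul 2)).congr_deriv ?_)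
    ring
  refine ⟨V, ⟨by rw [hV]; fun_prop, fun x => ?_⟩, by simp [hV], by simp [e1], by simp [e2], ?_, by simp [e4]⟩
  · have h1 : 2 * (x + 2 * Real.pi - x₀) = 2 * (x - x₀) + 2 * Real.pi + 2 * Real.pi := by ring
    have h2 : x + 2 * Real.pi - x₀ = x - x₀ + 2 * Real.pi := by ring
    simp only [hV]
    rw [h1, h2, Real.sin_add_two_pi, Real.sin_add_two_pi, Real.sin_add_two_pi]
  · rw [e3]
    norm_num

/-- A third order Hamiltonian operator has `2 ∂_x a₃` as its coefficient of second order. Indeed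
`P ∂_x` is symmetric in `L²`, and the coefficients of third order of `P ∂_x` and of its adjoint are
`a₂` and `4 ∂_x a₃ - a₂`. -/
lemma coeff_two_of_isHamiltonian {P : (ℝ → ℝ) → ℝ → ℝ} (hP : IsHamiltonian P) {a₃ a₂ a₁ a₀ : ℝ → ℝ}
    (h₃ : SmoothPer a₃) (h₂ : SmoothPer a₂) (h₁ : SmoothPer a₁) (h₀ : SmoothPer a₀)
    (hPa : ∀ u, ContDiff ℝ (⊤ : ℕ∞) u → ∀ x, P u x = a₃ x * iteratedDeriv 3 u x +
      a₂ x * iteratedDeriv 2 u x + a₁ x * iteratedDeriv 1 u x + a₀ x * u x) (x₀ : ℝ) :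
    a₂ x₀ = 2 * deriv a₃ x₀ := by
  have hPsp : ∀ u, SmoothPer u → SmoothPer (P u) := fun u hu => by
    rw [show P u = _ from funext (hPa u hu.1)]
    exact (((h₃.mul (hu.iteratedDeriv 3)).add (h₂.mul (hu.iteratedDeriv 2))).add
      (h₁.mul (hu.iteratedDeriv 1))).add (h₀.mul hu)
  have hphase : ∀ V, SmoothPer V → deriv V ∈ Phase := fun V hV => by
    refine ⟨hV.deriv.1.continuous, hV.deriv.2, avg_eq_zero_iff.2 ?_⟩
    rw [integral_eq_sub_of_hasDerivAt (fun x _ => hV.hasDerivAt x)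
      (hV.deriv.1.continuous.intervalIntegrable _ _)]
    have := hV.2 0
    rw [zero_add] at this
    rw [this, sub_self]
  -- `sympForm (P u) V' = - ∫ (P u) V`
  have hform : ∀ U V, SmoothPer U → SmoothPer V → sympForm (P (deriv U)) (deriv V) =
      - ∫ x in (0 : ℝ)..(2 * Real.pi), P (deriv U) x * V x := fun U V hU hV => by
    have hf := hPsp _ hU.deriv
    set f := P (deriv U) with hfdef
    have havg : avg f = 0 := hP.1 _ (hphase U hU) hU.deriv.1
    set W : ℝ → ℝ := fun x => ∫ y in (0 : ℝ)..x, f y with hW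
    have hWd : ∀ x, HasDerivAt W (f x) x := fun x =>
      integral_hasDerivAt_right (hf.1.continuous.intervalIntegrable _ _)
        (hf.1.continuous.stronglyMeasurableAtFilter _ _) hf.1.continuous.continuousAt
    rw [sympForm_eq hf.1.continuous hWd hV.deriv.1.continuous (hphase V hV).2.2,
      integral_mul_deriv_eq_deriv_mul (fun x _ => hWd x) (fun x _ => hV.hasDerivAt x)
        (hf.1.continuous.intervalIntegrable _ _) (hV.deriv.1.continuous.intervalIntegrable _ _)]
    have h1 : W (2 * Real.pi) = 0 := avg_eq_zero_iff.1 havg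
    have h2 : W 0 = 0 := integral_same
    rw [h1, h2]
    ring
  have hsymm : ∀ U V, SmoothPer U → SmoothPer V → ∫ x in (0 : ℝ)..(2 * Real.pi), P (deriv U) x * V x =
      ∫ x in (0 : ℝ)..(2 * Real.pi), P (deriv V) x * U x := fun U V hU hV => by
    have := hP.2 _ (hphase U hU) _ (hphase V hV) hU.deriv.1 hV.deriv.1
    rw [hform U V hU hV, hform V U hV hU] at this
    exact neg_injective this
  obtain ⟨V, hV, v0, v1, v2, v3, v4⟩ := exists_test_function x₀
  -- the adjoint of `P ∂_x`, applied to `V`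
  have m3 := (h₃.mul hV)
  have m2 := (h₂.mul hV)
  have m1 := (h₁.mul hV)
  have m0 := (h₀.mul hV)
  set D : ℝ → ℝ := fun x => (iteratedDeriv 4 (fun x => a₃ x * V x) x - iteratedDeriv 3 (fun x => a₂ x * V x) x +
    iteratedDeriv 2 (fun x => a₁ x * V x) x - iteratedDeriv 1 (fun x => a₀ x * V x) x) - P (deriv V) x with hD
  have hDsp : SmoothPer D := ((((m3.iteratedDeriv 4).sub (m2.iteratedDeriv 3)).add
    (m1.iteratedDeriv 2)).sub (m0.iteratedDeriv 1)).sub (hPsp _ hV.deriv)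
  have hadj : ∀ U, SmoothPer U → ∫ x in (0 : ℝ)..(2 * Real.pi), D x * U x = 0 := fun U hU => by
    have e : ∀ x, P (deriv U) x * V x = (a₃ x * V x) * iteratedDeriv 4 U x +
        (a₂ x * V x) * iteratedDeriv 3 U x + (a₁ x * V x) * iteratedDeriv 2 U x +
        (a₀ x * V x) * iteratedDeriv 1 U x := fun x => by
      rw [hPa _ hU.deriv.1, iteratedDeriv_succ' (n := 3) (f := U), iteratedDeriv_succ' (n := 2) (f := U),
        iteratedDeriv_succ' (n := 1) (f := U), iteratedDeriv_one (f := U)]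
      ring
    have ii : ∀ {f : ℝ → ℝ}, SmoothPer f → IntervalIntegrable f volume 0 (2 * Real.pi) := fun h =>
      h.1.continuous.intervalIntegrable _ _
    have h := hsymm U V hU hV
    rw [integral_congr fun x _ => e x,
      integral_add (ii (((m3.mul (hU.iteratedDeriv 4)).add (m2.mul (hU.iteratedDeriv 3))).add
        (m1.mul (hU.iteratedDeriv 2)))) (ii (m0.mul (hU.iteratedDeriv 1))),
      integral_add (ii ((m3.mul (hU.iteratedDeriv 4)).add (m2.mul (hU.iteratedDeriv 3))))
        (ii (m1.mul (hU.iteratedDeriv 2))),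
      integral_add (ii (m3.mul (hU.iteratedDeriv 4))) (ii (m2.mul (hU.iteratedDeriv 3))),
      m3.integral_mul_iteratedDeriv 4 hU, m2.integral_mul_iteratedDeriv 3 hU,
      m1.integral_mul_iteratedDeriv 2 hU, m0.integral_mul_iteratedDeriv 1 hU] at h
    have e2 : ∀ x, D x * U x = iteratedDeriv 4 (fun x => a₃ x * V x) x * U x -
        iteratedDeriv 3 (fun x => a₂ x * V x) x * U x + iteratedDeriv 2 (fun x => a₁ x * V x) x * U x -
        iteratedDeriv 1 (fun x => a₀ x * V x) x * U x - P (deriv V) x * U x := fun x => by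
      simp only [hD]
      ring
    rw [integral_congr fun x _ => e2 x,
      integral_sub (ii ((((m3.iteratedDeriv 4).mul hU |>.sub ((m2.iteratedDeriv 3).mul hU)).add
        ((m1.iteratedDeriv 2).mul hU)).sub ((m0.iteratedDeriv 1).mul hU)))
        (ii ((hPsp _ hV.deriv).mul hU)),
      integral_sub (ii (((m3.iteratedDeriv 4).mul hU |>.sub ((m2.iteratedDeriv 3).mul hU)).add
        ((m1.iteratedDeriv 2).mul hU))) (ii ((m0.iteratedDeriv 1).mul hU)),
      integral_add (ii ((m3.iteratedDeriv 4).mul hU |>.sub ((m2.iteratedDeriv 3).mul hU)))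
        (ii ((m1.iteratedDeriv 2).mul hU)),
      integral_sub (ii ((m3.iteratedDeriv 4).mul hU)) (ii ((m2.iteratedDeriv 3).mul hU))]
    linarith
  have hDzero : D x₀ = 0 := by
    have h1 := hadj D hDsp
    have h2 : ∫ x in x₀..(x₀ + 2 * Real.pi), D x * D x = 0 := by
      rw [(hDsp.mul hDsp).2.intervalIntegral_add_eq x₀ 0, zero_add]
      exact h1
    by_contra hne
    have hpos : 0 < ∫ x in x₀..(x₀ + 2 * Real.pi), D x * D x := by
      refine integral_pos (by linarith [Real.pi_pos])
        (hDsp.1.continuous.mul hDsp.1.continuous).continuousOn (fun x _ => mul_self_nonneg _)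
        ⟨x₀, ⟨le_rfl, by linarith [Real.pi_pos]⟩, ?_⟩
      exact mul_self_pos.2 hne
    exact hpos.ne' h2
  have cd : ∀ {f : ℝ → ℝ} (n : ℕ), SmoothPer f → ContDiffAt ℝ n f x₀ := fun n h =>
    (h.1.of_le (by exact_mod_cast le_top)).contDiffAt
  have hPV : P (deriv V) x₀ = -6 * a₂ x₀ := by
    rw [hPa _ hV.deriv.1, ← iteratedDeriv_succ' (n := 3), ← iteratedDeriv_succ' (n := 2),
      ← iteratedDeriv_succ' (n := 1), v4, v3, v2, v1]
    ring
  have l4 : iteratedDeriv 4 (fun x => a₃ x * V x) x₀ = -24 * deriv a₃ x₀ := by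
    rw [iteratedDeriv_fun_mul (cd 4 h₃) (cd 4 hV)]
    simp only [Finset.sum_range_succ, Finset.range_zero, Finset.sum_empty, iteratedDeriv_zero,
      iteratedDeriv_one, v0, v1, v2, v3, v4, Nat.sub_zero, Nat.reduceSub]
    norm_num [Nat.choose]
    ring
  have l3 : iteratedDeriv 3 (fun x => a₂ x * V x) x₀ = -6 * a₂ x₀ := by
    rw [iteratedDeriv_fun_mul (cd 3 h₂) (cd 3 hV)]
    simp only [Finset.sum_range_succ, Finset.range_zero, Finset.sum_empty, iteratedDeriv_zero,
      iteratedDeriv_one, v0, v1, v2, v3, Nat.sub_zero, Nat.reduceSub]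
    norm_num [Nat.choose]
    ring
  have l2 : iteratedDeriv 2 (fun x => a₁ x * V x) x₀ = 0 := by
    rw [iteratedDeriv_fun_mul (cd 2 h₁) (cd 2 hV)]
    simp only [Finset.sum_range_succ, Finset.range_zero, Finset.sum_empty, iteratedDeriv_zero,
      iteratedDeriv_one, v0, v1, v2, Nat.sub_zero, Nat.reduceSub]
    norm_num
  have l1 : iteratedDeriv 1 (fun x => a₀ x * V x) x₀ = 0 := by
    rw [iteratedDeriv_fun_mul (cd 1 h₀) (cd 1 hV)]
    simp only [Finset.sum_range_succ, Finset.range_zero, Finset.sum_empty, iteratedDeriv_zero,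
      iteratedDeriv_one, v0, v1, Nat.sub_zero, Nat.reduceSub]
    norm_num
  simp only [hD, hPV, l4, l3, l2, l1] at hDzero
  linarith

end Symplectic

/-! ### Conjugation of differential operators by a change of variables -/

section Conjugation

variable {η γ : ℝ} {O : Set (ℕ → ℝ)}

/-- The derivatives of `ρ · c₀` when `c_j' = ρ c_{j+1}`. -/
lemma iteratedDeriv_transport {ρ ρ₁ ρ₂ ρ₃ c₀ c₁ c₂ c₃ : ℝ → ℝ} (h₀ : ∀ x, HasDerivAt ρ (ρ₁ x) x)
    (h₁ : ∀ x, HasDerivAt ρ₁ (ρ₂ x) x) (h₂ : ∀ x, HasDerivAt ρ₂ (ρ₃ x) x)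
    (hc₀ : ∀ x, HasDerivAt c₀ (ρ x * c₁ x) x) (hc₁ : ∀ x, HasDerivAt c₁ (ρ x * c₂ x) x)
    (hc₂ : ∀ x, HasDerivAt c₂ (ρ x * c₃ x) x) (x : ℝ) :
    iteratedDeriv 1 (fun x => ρ x * c₀ x) x = ρ₁ x * c₀ x + ρ x ^ 2 * c₁ x ∧
    iteratedDeriv 2 (fun x => ρ x * c₀ x) x = ρ₂ x * c₀ x + 3 * ρ x * ρ₁ x * c₁ x + ρ x ^ 3 * c₂ x ∧
    iteratedDeriv 3 (fun x => ρ x * c₀ x) x = ρ₃ x * c₀ x + (4 * ρ x * ρ₂ x + 3 * ρ₁ x ^ 2) * c₁ x +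
      6 * ρ x ^ 2 * ρ₁ x * c₂ x + ρ x ^ 4 * c₃ x := by
  have e1 : iteratedDeriv 1 (fun x => ρ x * c₀ x) = fun x => ρ₁ x * c₀ x + ρ x ^ 2 * c₁ x := by
    rw [iteratedDeriv_one]
    refine funext fun x => HasDerivAt.deriv (((h₀ x).mul (hc₀ x)).congr_deriv ?_)
    ring
  have e2 : iteratedDeriv 2 (fun x => ρ x * c₀ x) =
      fun x => ρ₂ x * c₀ x + 3 * ρ x * ρ₁ x * c₁ x + ρ x ^ 3 * c₂ x := by
    rw [iteratedDeriv_succ, e1]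
    refine funext fun x => HasDerivAt.deriv
      ((((h₁ x).mul (hc₀ x)).add (((h₀ x).pow 2).mul (hc₁ x))).congr_deriv ?_)
    simp only [Pi.pow_apply]
    push_cast
    ring
  refine ⟨by rw [e1], by rw [e2], ?_⟩
  rw [iteratedDeriv_succ, e2]
  refine HasDerivAt.deriv (((((h₂ x).mul (hc₀ x)).add ((((h₀ x).const_mul 3).mul (h₁ x)).mul
    (hc₁ x))).add (((h₀ x).pow 3).mul (hc₂ x))).congr_deriv ?_)
  simp only [Pi.pow_apply, Pi.mul_apply]
  push_cast
  ring

variable {s s' b b' : ℝ} {β α R V : (ℕ → ℝ) → Fn}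

/-- The chain rule in `x` for `V(φ + β(φ) ω, x + α(φ, x))`. -/
lemma hasDerivAt_CP_x (H : Setting η γ O) (hs : 0 < s) {bα bV sV : ℝ} (hsV : 0 < sV)
    (hβ : IndepX β) (hα : RBd η γ O s bα α) (hV : RBd η γ O sV bV V) {ω : ℕ → ℝ} (hω : ω ∈ O)
    (φ : ℕ → ℝ) (x : ℝ) :
    HasDerivAt (CP β α V ω φ) ((1 + DX α ω φ x) * CP β α (DX V) ω φ x) x := by
  have h := hV.hasDerivAt_curve H hsV hω φ (hasDerivAt_const x (β ω φ x))
    ((hasDerivAt_id x).add (hα.hasDerivAt_x H hs hω φ x))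
  rw [zero_mul, zero_add] at h
  refine h.congr_of_eventuallyEq (Eventually.of_forall fun y => ?_)
  simp only [CP, hβ ω φ y x]
  rfl

/-- The chain rule in the direction of the frequency vector. -/
lemma hasDerivAt_CP_phi (H : Setting η γ O) (hs : 0 < s) {bα bβ bV sV : ℝ} (hsV : 0 < sV)
    (hβ : RBd η γ O s bβ β) (hα : RBd η γ O s bα α) (hV : RBd η γ O sV bV V) {ω : ℕ → ℝ} (hω : ω ∈ O)
    (φ : ℕ → ℝ) (x : ℝ) :
    HasDerivAt (fun t : ℝ => CP β α V ω (φ + t • ω) x)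
      ((1 + DO β ω φ x) * CP β α (DO V) ω φ x + DO α ω φ x * CP β α (DX V) ω φ x) 0 := by
  have h1 := hβ.hasDerivAt_phi H hs hω φ x 0
  have h2 := hα.hasDerivAt_phi H hs hω φ x 0
  have h := hV.hasDerivAt_curve H hsV hω φ ((hasDerivAt_id (0 : ℝ)).add h1) (h2.const_add x)
  simp only [Pi.add_apply, id, zero_smul, add_zero, zero_add] at h
  refine h.congr_of_eventuallyEq (Eventually.of_forall fun t => ?_)
  simp only [CP, add_smul, add_assoc]

/-- The composition of a third order operator with `V ↦ ρ V(φ + β ω, x + α)`, where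
`ρ = 1 + R = 1 + ∂_x α`, divided by `ρ`. The derivatives of `V` on the right are taken at the image
point. -/
lemma operator_transport (H : Setting η γ O) (hs : 0 < s) {bα bβ bR bV sV : ℝ} (hsV : 0 < sV)
    (hβx : IndepX β) (hβ : RBd η γ O s bβ β) (hα : RBd η γ O s bα α) (hR : RBd η γ O s bR R)
    (hV : RBd η γ O sV bV V) {ω : ℕ → ℝ} (hω : ω ∈ O) (hαR : ∀ φ x, DX α ω φ x = R ω φ x)
    (a₃ a₂ a₁ a₀ : ℝ) (φ : ℕ → ℝ) (x : ℝ) (hρ : 1 + R ω φ x ≠ 0) :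
    (1 + R ω φ x)⁻¹ * (dphi ω (fun φ x => (1 + R ω φ x) * CP β α V ω φ x) φ x +
      a₃ * dx 3 (fun φ x => (1 + R ω φ x) * CP β α V ω φ x) φ x +
      a₂ * dx 2 (fun φ x => (1 + R ω φ x) * CP β α V ω φ x) φ x +
      a₁ * dx 1 (fun φ x => (1 + R ω φ x) * CP β α V ω φ x) φ x +
      a₀ * ((1 + R ω φ x) * CP β α V ω φ x)) =
    (1 + DO β ω φ x) * CP β α (DO V) ω φ x + a₃ * (1 + R ω φ x) ^ 3 * CP β α (DX (DX (DX V))) ω φ x +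
      (1 + R ω φ x) * (6 * a₃ * DX R ω φ x + a₂ * (1 + R ω φ x)) * CP β α (DX (DX V)) ω φ x +
      (a₃ * (4 * DX (DX R) ω φ x + 3 * DX R ω φ x ^ 2 * (1 + R ω φ x)⁻¹) + 3 * a₂ * DX R ω φ x +
        a₁ * (1 + R ω φ x) + DO α ω φ x) * CP β α (DX V) ω φ x +
      ((a₃ * DX (DX (DX R)) ω φ x + a₂ * DX (DX R) ω φ x + a₁ * DX R ω φ x + DO R ω φ x) *
        (1 + R ω φ x)⁻¹ + a₀) * CP β α V ω φ x := by
  have hR1 := hR.dx H (by positivity) (show s / 2 < s by linarith)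
  have hR2 := hR1.dx H (by positivity) (show s / 4 < s / 2 by linarith)
  have hV1 := hV.dx H (by positivity) (show sV / 2 < sV by linarith)
  have hV2 := hV1.dx H (by positivity) (show sV / 4 < sV / 2 by linarith)
  have hc : ∀ {W : (ℕ → ℝ) → Fn} {w b : ℝ}, 0 < w → RBd η γ O w b W → ∀ x,
      HasDerivAt (CP β α W ω φ) ((1 + R ω φ x) * CP β α (DX W) ω φ x) x := fun hw hW x => by
    rw [← hαR]
    exact hasDerivAt_CP_x H hs hw hβx hα hW hω φ x
  obtain ⟨e1, e2, e3⟩ := iteratedDeriv_transport (ρ := fun x => 1 + R ω φ x) (ρ₁ := DX R ω φ)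
    (ρ₂ := DX (DX R) ω φ) (ρ₃ := DX (DX (DX R)) ω φ)
    (fun x => (hR.hasDerivAt_x H hs hω φ x).const_add 1)
    (fun x => hR1.hasDerivAt_x H (by positivity) hω φ x)
    (fun x => hR2.hasDerivAt_x H (by positivity) hω φ x) (hc hsV hV) (hc (by positivity) hV1)
    (hc (by positivity) hV2) x
  have e0 : dphi ω (fun φ x => (1 + R ω φ x) * CP β α V ω φ x) φ x =
      DO R ω φ x * CP β α V ω φ x + (1 + R ω φ x) *
        ((1 + DO β ω φ x) * CP β α (DO V) ω φ x + DO α ω φ x * CP β α (DX V) ω φ x) := by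
    have h1 := (hR.hasDerivAt_phi H hs hω φ x 0).const_add 1
    have h2 := hasDerivAt_CP_phi H hs hsV hβ hα hV hω φ x
    have := (h1.mul h2).deriv
    simp only [zero_smul, add_zero] at this
    exact this
  rw [e0]
  simp only [dx]
  rw [e1, e2, e3]
  field_simp
  ring

/-- The coefficient of second order vanishes after the change of variables, by the Hamiltonian
structure `a₂ = 2 ∂_x a₃` and since `a₃ ρ³` does not depend on `x`. -/
lemma coeff_two_eq_zero {a₃ ρ : ℝ → ℝ} {a₃' ρ' m x : ℝ} (h₃ : HasDerivAt a₃ a₃' x)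
    (hρ : HasDerivAt ρ ρ' x) (hm : ∀ y, a₃ y * ρ y ^ 3 = m) (h0 : ρ x ≠ 0) :
    6 * a₃ x * ρ' + 2 * a₃' * ρ x = 0 := by
  have h := (h₃.mul (hρ.pow 3)).unique
    ((hasDerivAt_const x m).congr_of_eventuallyEq (Eventually.of_forall hm))
  simp only [Pi.pow_apply] at h
  have : ρ x ^ 2 * (6 * a₃ x * ρ' + 2 * a₃' * ρ x) = 0 := by
    push_cast at h
    linear_combination 2 * h
  exact (mul_eq_zero.1 this).resolve_left (pow_ne_zero 2 h0)

lemma eq_zero_of_deriv_pos {f : ℝ → ℝ} {f' : ℝ → ℝ} (hf : ∀ t, HasDerivAt f (f' t) t)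
    (hpos : ∀ t, 0 < f' t) {a b : ℝ} (h : f a = f b) : a = b :=
  (strictMono_of_deriv_pos fun t => by rw [(hf t).deriv]; exact hpos t).injective h

/-- A right inverse of a change of variables close to the identity is a left inverse. -/
lemma left_inverse (H : Setting η γ O) (hs : 0 < s) {bβ bα : ℝ} {β' α' : (ℕ → ℝ) → Fn}
    (hβx : IndepX β) (hβ : RBd η γ O s bβ β) (hα : RBd η γ O s bα α) {ω : ℕ → ℝ} (hω : ω ∈ O)
    (hθ : ∀ φ x, 0 < 1 + DO β ω φ x) (hρ : ∀ φ x, 0 < 1 + DX α ω φ x)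
    (hinv : ∀ φ x, β' ω φ x = - CP β' α' β ω φ x ∧ α' ω φ x = - CP β' α' α ω φ x) (φ : ℕ → ℝ) (x : ℝ) :
    CP β α β' ω φ x = - β ω φ x ∧ CP β α α' ω φ x = - α ω φ x := by
  obtain ⟨h1, h2⟩ := hinv (φ + β ω φ x • ω) (x + α ω φ x)
  simp only [CP] at h1 h2 ⊢
  set B' := β' ω (φ + β ω φ x • ω) (x + α ω φ x) with hB'
  set A' := α' ω (φ + β ω φ x • ω) (x + α ω φ x) with hA'
  have e : φ + β ω φ x • ω + B' • ω = φ + (β ω φ x + B') • ω := by rw [add_assoc, ← add_smul]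
  rw [e] at h1 h2
  have hτ : β ω φ x + B' = 0 := by
    refine eq_zero_of_deriv_pos (f := fun t : ℝ => t + β ω (φ + t • ω) x)
      (fun t => (hasDerivAt_id t).add (hβ.hasDerivAt_phi H hs hω φ x t)) (fun t => hθ _ _) ?_
    rw [hβx ω (φ + (β ω φ x + B') • ω) x (x + α ω φ x + A'), zero_smul, add_zero]
    linarith
  rw [hτ, zero_smul, add_zero] at h2
  have hx : x + α ω φ x + A' = x := by
    refine eq_zero_of_deriv_pos (f := fun y : ℝ => y + α ω φ y)
      (fun y => (hasDerivAt_id y).add (hα.hasDerivAt_x H hs hω φ y)) (fun y => hρ _ _) ?_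
    linarith
  exact ⟨by linarith, by linarith⟩

end Conjugation

/-! ### The scale of bounds -/

/-- The bookkeeping device for one step of the iteration. The loss of width in every operation is a
multiple of `δ`, and every constant, in particular the loss from `δ` and from the small divisors, is
bounded by a power of the large number `D`. The size of the perturbation is `ε`, so small that it
compensates the powers of `D`. -/
structure Scale (η γ : ℝ) (O : Set (ℕ → ℝ)) (D ε δ : ℝ) : Prop extends Setting η γ O where
  le_D : 100 ≤ D
  eps_nonneg : 0 ≤ ε
  small : D ^ 60 * ε ≤ 1
  delta_pos : 0 < δ
  div_delta : 3 / δ ≤ D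
  divisor : ∀ (w : ℝ) (l : ℕ →₀ ℤ), l ≠ 0 → lipC γ O (fun ω => (Complex.I * (dot l ω : ℂ))⁻¹) *
    weight η (w - δ) (l, 0) ≤ ENNReal.ofReal D * weight η w (l, 0)
  dot_ne : ∀ ω ∈ O, ∀ l : ℕ →₀ ℤ, l ≠ 0 → dot l ω ≠ 0

namespace Scale

variable {η γ : ℝ} {O : Set (ℕ → ℝ)} {D ε δ w w' : ℝ} {k l : ℕ} {f g : (ℕ → ℝ) → Fn}

/-- A function of size `D^k ε` on the strip of width `w`. -/
def Sm (_K : Scale η γ O D ε δ) (w : ℝ) (k : ℕ) (f : (ℕ → ℝ) → Fn) : Prop :=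
  RBd η γ O w (D ^ k * ε) f

/-- A function of size `D^k` on the strip of width `w`. -/
def Bg (_K : Scale η γ O D ε δ) (w : ℝ) (k : ℕ) (f : (ℕ → ℝ) → Fn) : Prop :=
  RBd η γ O w (D ^ k) f

lemma D_pos (K : Scale η γ O D ε δ) : 0 < D := by linarith [K.le_D]

lemma one_le_D (K : Scale η γ O D ε δ) : 1 ≤ D := by linarith [K.le_D]

lemma pow_le_pow (K : Scale η γ O D ε δ) (h : k ≤ l) : D ^ k ≤ D ^ l :=
  pow_le_pow_right₀ K.one_le_D h

lemma pow_mul_eps_nonneg (K : Scale η γ O D ε δ) (k : ℕ) : 0 ≤ D ^ k * ε :=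
  mul_nonneg (pow_nonneg K.D_pos.le k) K.eps_nonneg

lemma pow_mul_eps_le (K : Scale η γ O D ε δ) (h : k ≤ 60) : D ^ k * ε ≤ 1 :=
  (mul_le_mul_of_nonneg_right (K.pow_le_pow h) K.eps_nonneg).trans K.small

lemma pow_mul_eps_le_div (K : Scale η γ O D ε δ) (h : k ≤ 59) : D ^ k * ε ≤ 1 / 100 := by
  have h1 := K.pow_mul_eps_le (k := k + 1) (by omega)
  have h2 := K.pow_mul_eps_nonneg k
  rw [pow_succ, mul_right_comm] at h1
  nlinarith [K.le_D]

lemma pow_mul_eps_le_delta (K : Scale η γ O D ε δ) (h : k ≤ 58) : 6 * (D ^ k * ε) ≤ δ := by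
  have h1 := K.pow_mul_eps_le_div (k := k + 1) (by omega)
  have h2 := K.pow_mul_eps_nonneg k
  have h3 := K.div_delta
  rw [div_le_iff₀ K.delta_pos] at h3
  rw [pow_succ, mul_right_comm] at h1
  have := K.delta_pos
  nlinarith [mul_le_mul_of_nonneg_left h3 h2]

variable {K : Scale η γ O D ε δ}

lemma Sm.mono (h : K.Sm w k f) (hw : w' ≤ w) (hk : k ≤ l) : K.Sm w' l f :=
  RBd.mono h hw (mul_le_mul_of_nonneg_right (K.pow_le_pow hk) K.eps_nonneg)

lemma Bg.mono (h : K.Bg w k f) (hw : w' ≤ w) (hk : k ≤ l) : K.Bg w' l f :=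
  RBd.mono h hw (K.pow_le_pow hk)

lemma Sm.width (h : K.Sm w k f) (hw : w' ≤ w) : K.Sm w' k f := h.mono hw le_rfl

lemma Bg.width (h : K.Bg w k f) (hw : w' ≤ w) : K.Bg w' k f := h.mono hw le_rfl

lemma Sm.congr (h : K.Sm w k f) (hfg : ∀ ω ∈ O, ∀ φ x, f ω φ x = g ω φ x) : K.Sm w k g :=
  RBd.congr h hfg

lemma Bg.congr (h : K.Bg w k f) (hfg : ∀ ω ∈ O, ∀ φ x, f ω φ x = g ω φ x) : K.Bg w k g :=
  RBd.congr h hfg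

lemma Sm.add (hf : K.Sm w k f) (hg : K.Sm w l g) :
    K.Sm w (max k l + 1) (fun ω φ x => f ω φ x + g ω φ x) := by
  refine RBd.mono (RBd.add hf hg) le_rfl ?_
  have h1 := mul_le_mul_of_nonneg_right (K.pow_le_pow (le_max_left k l)) K.eps_nonneg
  have h2 := mul_le_mul_of_nonneg_right (K.pow_le_pow (le_max_right k l)) K.eps_nonneg
  have h3 := K.pow_mul_eps_nonneg (max k l)
  rw [pow_succ, mul_right_comm]
  nlinarith [K.le_D]

lemma Sm.neg (hf : K.Sm w k f) : K.Sm w k (fun ω φ x => - f ω φ x) := RBd.neg hf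

lemma Sm.sub (hf : K.Sm w k f) (hg : K.Sm w l g) :
    K.Sm w (max k l + 1) (fun ω φ x => f ω φ x - g ω φ x) := by
  simpa only [sub_eq_add_neg] using hf.add hg.neg

lemma Bg.add (hf : K.Bg w k f) (hg : K.Bg w l g) :
    K.Bg w (max k l + 1) (fun ω φ x => f ω φ x + g ω φ x) := by
  refine RBd.mono (RBd.add hf hg) le_rfl ?_
  have h1 := K.pow_le_pow (le_max_left k l)
  have h2 := K.pow_le_pow (le_max_right k l)
  have h3 := pow_nonneg K.D_pos.le (max k l)
  rw [pow_succ]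
  nlinarith [K.le_D]

lemma Bg.const {a : ℝ} (ha : |a| ≤ 100) : K.Bg w 1 (fun _ _ _ => a) :=
  (RBd.const a).mono le_rfl (by rw [pow_one]; linarith [K.le_D])

lemma Bg.mul (hw : 0 ≤ w) (hf : K.Bg w k f) (hg : K.Sm w l g) :
    K.Sm w (k + l) (fun ω φ x => f ω φ x * g ω φ x) :=
  RBd.mono (RBd.mul hw hf hg) le_rfl (by rw [pow_add, mul_assoc])

lemma Sm.big (hf : K.Sm w k f) (hk : k ≤ 60) : K.Bg w 0 f :=
  RBd.mono hf le_rfl (by rw [pow_zero]; exact K.pow_mul_eps_le hk)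

lemma Sm.one_add (hf : K.Sm w k f) (hk : k ≤ 60) : K.Bg w 1 (fun ω φ x => 1 + f ω φ x) :=
  RBd.mono (RBd.add (RBd.const 1) hf) le_rfl
    (by rw [pow_one, abs_one]; linarith [K.le_D, K.pow_mul_eps_le hk])

lemma two_mul_le (K : Scale η γ O D ε δ) (k : ℕ) : 2 * (D ^ k * ε) ≤ D ^ (k + 1) * ε := by
  have := K.pow_mul_eps_nonneg k
  rw [pow_succ, mul_right_comm]
  nlinarith [K.le_D]

lemma Sm.inv_one_add (hw : 0 ≤ w) (hf : K.Sm w k f) (hk : k ≤ 59) :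
    K.Sm w (k + 1) (fun ω φ x => (1 + f ω φ x)⁻¹ - 1) :=
  RBd.mono (RBd.inv_one_add hw hf (by linarith [K.pow_mul_eps_le_div hk])) le_rfl (K.two_mul_le k)

lemma Sm.log_one_add (hw : 0 ≤ w) (hf : K.Sm w k f) (hk : k ≤ 59) :
    K.Sm w (k + 1) (fun ω φ x => Real.log (1 + f ω φ x)) :=
  RBd.mono (RBd.log_one_add hw hf (by linarith [K.pow_mul_eps_le_div hk])) le_rfl (K.two_mul_le k)

lemma Sm.exp_sub_one (hw : 0 ≤ w) (hf : K.Sm w k f) (hk : k ≤ 59) :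
    K.Sm w (k + 1) (fun ω φ x => Real.exp (f ω φ x) - 1) :=
  RBd.mono (RBd.exp_sub_one hw hf (by linarith [K.pow_mul_eps_le_div hk])) le_rfl (K.two_mul_le k)

/-- The reciprocal of `1 + f`. -/
lemma Sm.inv_big (hw : 0 ≤ w) (hf : K.Sm w k f) (hk : k ≤ 59) :
    K.Bg w 1 (fun ω φ x => (1 + f ω φ x)⁻¹) :=
  ((hf.inv_one_add hw hk).one_add (by omega)).congr fun _ _ _ _ => add_sub_cancel _ _

lemma Sm.abs_le (hw : 0 ≤ w) (hf : K.Sm w k f) (hk : k ≤ 59) {ω : ℕ → ℝ} (hω : ω ∈ O) (φ : ℕ → ℝ)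
    (x : ℝ) : |f ω φ x| ≤ 1 / 100 := (RBd.abs_le hw hf hω φ x).trans (K.pow_mul_eps_le_div hk)

lemma Sm.one_add_pos (hw : 0 ≤ w) (hf : K.Sm w k f) (hk : k ≤ 59) {ω : ℕ → ℝ} (hω : ω ∈ O)
    (φ : ℕ → ℝ) (x : ℝ) : 0 < 1 + f ω φ x := by
  linarith [(_root_.abs_le.1 (hf.abs_le hw hk hω φ x)).1]

lemma one_div_le (K : Scale η γ O D ε δ) {t : ℝ} (ht : δ ≤ t) : 3 / t ≤ D :=
  (div_le_div_of_nonneg_left (by norm_num) K.delta_pos ht).trans K.div_delta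

lemma Sm.dphi (hw : 0 ≤ w') (hww : w' + δ ≤ w) (hf : K.Sm w k f) : K.Sm w' (k + 1) (DO f) := by
  refine RBd.mono (RBd.dphi K.toSetting hw (by linarith [K.delta_pos]) hf) le_rfl ?_
  rw [pow_succ', mul_assoc]
  exact mul_le_mul_of_nonneg_right (K.one_div_le (by linarith)) (K.pow_mul_eps_nonneg k)

lemma Sm.dx (hw : 0 ≤ w') (hww : w' + δ ≤ w) (hf : K.Sm w k f) : K.Sm w' (k + 1) (DX f) := by
  refine RBd.mono (RBd.dx K.toSetting hw (by linarith [K.delta_pos]) hf) le_rfl ?_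
  rw [pow_succ', mul_assoc]
  refine mul_le_mul_of_nonneg_right (le_trans ?_ (K.one_div_le (t := w - w') (by linarith)))
    (K.pow_mul_eps_nonneg k)
  have : 0 < w - w' := by linarith [K.delta_pos]
  gcongr
  norm_num

lemma Sm.comp (hw : 0 ≤ w') (hww : w' + δ ≤ w) (hf : K.Sm w k f) (hl : l ≤ 58)
    {β α : (ℕ → ℝ) → Fn} (hβ : K.Sm w' l β) (hα : K.Sm w' l α) : K.Sm w' k (CP β α f) :=
  RBd.comp K.toSetting hw (by linarith [K.pow_mul_eps_le_delta hl, K.pow_mul_eps_nonneg l]) hf hβ hα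

lemma Bg.comp (hw : 0 ≤ w') (hww : w' + δ ≤ w) (hf : K.Bg w k f) (hl : l ≤ 58)
    {β α : (ℕ → ℝ) → Fn} (hβ : K.Sm w' l β) (hα : K.Sm w' l α) : K.Bg w' k (CP β α f) :=
  RBd.comp K.toSetting hw (by linarith [K.pow_mul_eps_le_delta hl, K.pow_mul_eps_nonneg l]) hf hβ hα

lemma Bg.comp_sub (hw : 0 ≤ w') (hww : w' + 2 * δ ≤ w) (hf : K.Bg w k f) (hl : l ≤ 58)
    {β α : (ℕ → ℝ) → Fn} (hβ : K.Sm w' l β) (hα : K.Sm w' l α) :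
    K.Sm w' (k + (l + 1)) (fun ω φ x => CP β α f ω φ x - f ω φ x) := by
  have hd := K.pow_mul_eps_nonneg l
  refine RBd.mono (RBd.comp_sub K.toSetting hw K.delta_pos
    (by linarith [K.pow_mul_eps_le_delta hl]) hf hβ hα) le_rfl ?_
  rw [pow_add, mul_assoc, mul_comm, pow_succ' D l, mul_assoc, mul_div_right_comm]
  exact mul_le_mul_of_nonneg_left (mul_le_mul_of_nonneg_right K.div_delta hd)
    (pow_nonneg K.D_pos.le k)

lemma Sm.avg (hw : 0 ≤ w) (hf : K.Sm w k f) : K.Sm w k (AV f) := RBd.avg hw hf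

end Scale

/-! ### Reduction of the coefficients -/

lemma avg_add {f g : ℝ → ℝ} (hf : Continuous f) (hg : Continuous g) :
    avg (fun x => f x + g x) = avg f + avg g := by
  unfold avg
  rw [intervalIntegral.integral_add (hf.intervalIntegrable _ _) (hg.intervalIntegrable _ _), mul_add]

lemma avg_const (a : ℝ) : avg (fun _ => a) = a := by
  unfold avg
  have := Real.pi_ne_zero
  rw [intervalIntegral.integral_const, smul_eq_mul, sub_zero]
  field_simp

lemma avg_const_mul (a : ℝ) (f : ℝ → ℝ) : avg (fun x => a * f x) = a * avg f := by
  unfold avg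
  rw [intervalIntegral.integral_const_mul]
  ring

namespace Scale

variable {η γ : ℝ} {O : Set (ℕ → ℝ)} {D ε δ w : ℝ} {k l : ℕ} {K : Scale η γ O D ε δ}
  {A : (ℕ → ℝ) → ℝ}

/-- The reciprocal of `1 + A`. -/
lemma inv_one_add_big (K : Scale η γ O D ε δ) (hw : 0 ≤ w) {a : ℝ} (ha : a ≤ 1 / 2)
    (hA : RBd η γ O w a (fun ω _ _ => A ω)) : K.Bg w 1 (fun ω _ _ => (1 + A ω)⁻¹) :=
  (((RBd.const 1).add (hA.inv_one_add hw ha)).mono le_rfl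
    (by rw [pow_one, abs_one]; linarith [K.le_D])).congr fun _ _ _ _ => add_sub_cancel _ _

/-- A change of the variable `x` makes the coefficient of third order independent of `x`. -/
lemma exists_change_x (hw : 0 < w) (hA : RBd η γ O w (1 / 4) (fun ω _ _ => A ω))
    {g : (ℕ → ℝ) → Fn} (hg : K.Sm w k g) (hk : k ≤ 40) :
    ∃ ξ m, K.Sm w (k + 7) ξ ∧ K.Sm w (k + 7) (DX ξ) ∧ K.Sm w (k + 7) m ∧ IndepX m ∧
      ∀ ω ∈ O, (∀ φ, avg (DX ξ ω φ) = 0) ∧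
        ∀ φ x, (1 + A ω + g ω φ x) * (1 + DX ξ ω φ x) ^ 3 = 1 + A ω + m ω φ x := by
  have hAi := K.inv_one_add_big hw.le (by norm_num) hA
  set f : (ℕ → ℝ) → Fn := fun ω φ x => (1 + A ω)⁻¹ * g ω φ x with hf
  have bf : K.Sm w (k + 1) f := (hAi.mul hw.le hg).mono le_rfl (by omega)
  have bL : K.Sm w (k + 2) (fun ω φ x => -1 / 3 * Real.log (1 + f ω φ x)) := by
    refine ((bf.log_one_add hw.le (by omega)).const_mul hw.le (-1 / 3)).mono le_rfl ?_
    have := K.pow_mul_eps_nonneg (k + 2)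
    rw [show |(-1 / 3 : ℝ)| = 1 / 3 by norm_num [abs_div]]
    linarith
  -- `1 + E` is the power `-1/3` of `a₃ / (1 + A)`, and `1 + ξ_x` has to be its multiple of average `1`.
  set E : (ℕ → ℝ) → Fn := fun ω φ x => Real.exp (-1 / 3 * Real.log (1 + f ω φ x)) - 1 with hE
  have bE : K.Sm w (k + 3) E := bL.exp_sub_one hw.le (by omega)
  have bκ : K.Sm w (k + 3) (AV E) := bE.avg hw.le
  set J : (ℕ → ℝ) → Fn := fun ω φ x => (1 + AV E ω φ x)⁻¹ - 1 with hJ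
  have bJ : K.Sm w (k + 4) J := bκ.inv_one_add hw.le (by omega)
  set R : (ℕ → ℝ) → Fn := fun ω φ x => (1 + E ω φ x) * J ω φ x + E ω φ x with hR
  have bR : K.Sm w (k + 7) R :=
    (((bE.one_add (by omega)).mul hw.le bJ).add bE).mono le_rfl (by omega)
  have hEc : ∀ ω ∈ O, ∀ φ, Continuous (E ω φ) := fun ω hω φ =>
    (RBd.contDiff K.toSetting hw bE hω φ).continuous
  have hR0 : ∀ ω ∈ O, ∀ φ, avg (R ω φ) = 0 := fun ω hω φ => by
    have hpos : 1 + avg (E ω φ) ≠ 0 := (bκ.one_add_pos hw.le (by omega) hω φ 0).ne'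
    have e : R ω φ = fun x => (1 + J ω φ 0) * E ω φ x + J ω φ 0 := funext fun x => by
      simp only [hR, hJ, AV]
      ring
    rw [e, avg_add ((hEc ω hω φ).const_mul _) continuous_const, avg_const_mul, avg_const]
    simp only [hJ, AV]
    field_simp
    ring
  obtain ⟨ξ, bξ, hξ⟩ := RBd.exists_primitive K.toSetting hw bR
  have hξR : ∀ ω ∈ O, ∀ φ x, DX ξ ω φ x = R ω φ x := fun ω hω φ x => by
    rw [hξ ω hω, AV, hR0 ω hω, sub_zero]
  refine ⟨ξ, fun ω φ x => (1 + A ω) * ((3 + J ω φ x * (3 + J ω φ x)) * J ω φ x), bξ,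
    bR.congr fun ω hω φ x => (hξR ω hω φ x).symm, ?_, fun _ _ _ _ => rfl,
    fun ω hω => ⟨fun φ => ?_, fun φ x => ?_⟩⟩
  · have b1 : K.Bg w 1 (fun ω _ _ => 1 + A ω) :=
      ((RBd.const 1).add hA).mono le_rfl (by rw [pow_one, abs_one]; linarith [K.le_D])
    have b3 : K.Bg w 1 (fun ω φ x => 3 + J ω φ x * (3 + J ω φ x)) := by
      have h := RBd.mono bJ le_rfl (K.pow_mul_eps_le (k := k + 4) (by omega))
      refine ((RBd.const 3).add (h.mul hw.le ((RBd.const 3).add h))).mono le_rfl ?_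
      rw [pow_one, abs_of_pos (by norm_num : (0 : ℝ) < 3)]
      linarith [K.le_D]
    exact (b1.mul hw.le (b3.mul hw.le bJ)).mono le_rfl (by omega)
  · rw [show DX ξ ω φ = R ω φ from funext (hξR ω hω φ), hR0 ω hω]
  · have hA1 : 1 + A ω ≠ 0 := by
      have := (abs_le.1 (hA.abs_le hw.le hω φ x)).1
      linarith
    have hf1 := bf.one_add_pos hw.le (by omega) hω φ x
    have h3 : (1 + E ω φ x) ^ 3 * (1 + f ω φ x) = 1 := by
      simp only [hE, add_sub_cancel]
      rw [← Real.exp_nat_mul]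
      have : ((3 : ℕ) : ℝ) * (-1 / 3 * Real.log (1 + f ω φ x)) = - Real.log (1 + f ω φ x) := by
        push_cast; ring
      rw [this, Real.exp_neg, Real.exp_log hf1, inv_mul_cancel₀ hf1.ne']
    have h4 : 1 + A ω + g ω φ x = (1 + A ω) * (1 + f ω φ x) := by
      simp only [hf]
      field_simp
    rw [h4, hξR ω hω]
    have h5 : 1 + R ω φ x = (1 + E ω φ x) * (1 + J ω φ x) := by
      simp only [hR]; ring
    rw [h5]
    linear_combination (1 + A ω) * (1 + J ω φ x) ^ 3 * h3

lemma IndepX_DO {f : (ℕ → ℝ) → Fn} (hf : IndepX f) : IndepX (DO f) := fun ω φ x y => by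
  unfold DO AiryKAM.dphi
  simp_rw [hf ω _ x y]

/-- A function of `φ` is, up to its mean value, a derivative in the direction of `ω`. -/
lemma exists_dphi_inverse (hw : 0 < w) {m : (ℕ → ℝ) → Fn} (hm : K.Sm (w + δ) k m)
    (hmx : IndepX m) :
    ∃ (G : (ℕ → ℝ) → Fn) (m₀ : (ℕ → ℝ) → ℝ), K.Sm w (k + 1) G ∧ IndepX G ∧
      lipNorm (fun a : ℝ => ‖a‖ₑ) γ O m₀ ≤ ENNReal.ofReal (D ^ k * ε) ∧
      ∀ ω ∈ O, ∀ φ x, DO G ω φ x = m ω φ x - m₀ ω := by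
  have h := RBd.exists_dphi_inverse K.toSetting hw K.D_pos.le
    (fun l hl => by simpa using K.divisor (w + δ) l hl) K.dot_ne (by linarith [K.delta_pos]) hm hmx
  rwa [← mul_assoc, ← pow_succ'] at h

/-- A reparametrization of time makes the coefficient of third order constant. -/
lemma exists_change_time (hw : 0 < w) (hA : RBd η γ O (w + δ) (1 / 8) (fun ω _ _ => A ω))
    {m : (ℕ → ℝ) → Fn} (hm : K.Sm (w + δ) k m) (hmx : IndepX m) (hk : k ≤ 50) :
    ∃ (A' : (ℕ → ℝ) → ℝ) (β : (ℕ → ℝ) → Fn), K.Sm w (k + 2) β ∧ IndepX β ∧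
      lipNorm (fun a : ℝ => ‖a‖ₑ) γ O (fun ω => A' ω - A ω) ≤ ENNReal.ofReal (D ^ k * ε) ∧
      ∀ ω ∈ O, ∀ φ x, (1 + A' ω) * (1 + DO β ω φ x) = 1 + A ω + m ω φ x := by
  obtain ⟨G, m₀, bG, hGx, bm, hG⟩ := K.exists_dphi_inverse hw hm hmx
  have bA' : RBd η γ O w (1 / 4) (fun ω _ _ => A ω + m₀ ω) := by
    refine ((hA.mono (by linarith [K.delta_pos]) le_rfl).add
      (RBd.of_omega (K.pow_mul_eps_nonneg k) bm)).mono le_rfl ?_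
    linarith [K.pow_mul_eps_le_div (k := k) (by omega)]
  have bi := K.inv_one_add_big (A := fun ω => A ω + m₀ ω) hw.le (by norm_num) bA'
  refine ⟨fun ω => A ω + m₀ ω, fun ω φ x => (1 + (A ω + m₀ ω))⁻¹ * G ω φ x,
    (bi.mul hw.le bG).mono le_rfl (by omega), fun ω φ x y => by
      beta_reduce
      rw [hGx ω φ x y], ?_,
    fun ω hω φ x => ?_⟩
  · simpa only [add_sub_cancel_left] using bm
  · have hd := ((RBd.hasDerivAt_phi K.toSetting hw bG hω φ x 0).const_mul
      (1 + (A ω + m₀ ω))⁻¹).deriv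
    have e : DO (fun ω φ x => (1 + (A ω + m₀ ω))⁻¹ * G ω φ x) ω φ x =
        (1 + (A ω + m₀ ω))⁻¹ * DO G ω φ x := by
      simp only [zero_smul, add_zero] at hd
      exact hd
    have h1 : 1 + (A ω + m₀ ω) ≠ 0 := by
      have := (abs_le.1 (bA'.abs_le hw.le hω φ x)).1
      linarith
    rw [e, hG ω hω]
    field_simp
    ring

/-- A translation of `x`, depending on `φ`, makes the average of the coefficient of first order
proportional to `1 + ω·∂_φ β`. -/
lemma exists_translation (hw : 0 < w) {B F β : (ℕ → ℝ) → Fn} (hB : K.Bg (w + δ) 1 B)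
    (hBavg : ∀ ω ∈ O, ∃ b, ∀ φ, avg (B ω φ) = b) (hF : K.Sm (w + δ) k F) (hβ : K.Sm w k β)
    (hβx : IndepX β) (hk : k ≤ 50) :
    ∃ (p : (ℕ → ℝ) → Fn) (b : (ℕ → ℝ) → ℝ), K.Sm w (k + 3) p ∧ IndepX p ∧
      ∀ ω ∈ O, ∀ φ x, avg (B ω φ) + avg (F ω φ) + DO p ω φ x = b ω * (1 + DO β ω φ x) := by
  have hδ := K.delta_pos
  obtain ⟨q, q₀, bq, hqx, bq₀, hq⟩ := K.exists_dphi_inverse hw (hF.avg (by linarith))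
    fun _ _ _ _ => rfl
  have hBc : ∀ ω ∈ O, ∀ φ, avg (B ω φ) = avg (B ω 0) := fun ω hω φ => by
    obtain ⟨b, hb⟩ := hBavg ω hω
    rw [hb, hb]
  have bb : K.Bg w 2 (fun ω _ _ => avg (B ω 0) + q₀ ω) := by
    have h1 : K.Bg (w + δ) 1 (fun ω _ _ => avg (B ω 0)) :=
      RBd.congr (RBd.avg (by linarith) hB) fun ω hω φ x => hBc ω hω φ
    have h2 : K.Sm (w + δ) k (fun ω _ _ => q₀ ω) := RBd.of_omega (K.pow_mul_eps_nonneg k) bq₀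
    exact (h1.add (h2.big (by omega))).mono (by linarith) (by omega)
  refine ⟨fun ω φ x => (avg (B ω 0) + q₀ ω) * β ω φ x - q ω φ x, fun ω => avg (B ω 0) + q₀ ω,
    ((bb.mul hw.le hβ).sub bq).mono le_rfl (by omega),
    fun ω φ x y => by
      beta_reduce
      rw [hβx ω φ x y, hqx ω φ x y], fun ω hω φ x => ?_⟩
  have hd := (((RBd.hasDerivAt_phi K.toSetting hw hβ hω φ x 0).const_mul
    (avg (B ω 0) + q₀ ω)).sub (RBd.hasDerivAt_phi K.toSetting hw bq hω φ x 0)).deriv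
  have e : DO (fun ω φ x => (avg (B ω 0) + q₀ ω) * β ω φ x - q ω φ x) ω φ x =
      (avg (B ω 0) + q₀ ω) * DO β ω φ x - DO q ω φ x := by
    simp only [zero_smul, add_zero] at hd
    exact hd
  rw [e, hq ω hω, AV, hBc ω hω φ]
  ring

end Scale

/-! ### The reduction step -/

namespace Scale

variable {η γ : ℝ} {O : Set (ℕ → ℝ)} {D ε δ w : ℝ} {k l : ℕ} {K : Scale η γ O D ε δ}
  {A : (ℕ → ℝ) → ℝ}

/-- The variation of a coefficient under a perturbation, a change of variables and multiplication by a
function close to `1`. -/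
lemma transport_sub (hw : 0 ≤ w) {F f r β α : (ℕ → ℝ) → Fn} (hF : K.Bg (w + 2 * δ) 1 F)
    (hf : K.Sm (w + δ) k f) (hr : K.Sm w k r) (hk : k ≤ 50) (hβ : K.Sm w k β) (hα : K.Sm w k α) :
    K.Sm w (k + 5)
      (fun ω φ x => (1 + r ω φ x) * CP β α (fun ω φ x => F ω φ x + f ω φ x) ω φ x - F ω φ x) := by
  have hδ := K.delta_pos
  have b1 : K.Bg w 2 (CP β α (fun ω φ x => F ω φ x + f ω φ x)) :=
    (((hF.width (by linarith)).add (hf.big (by omega))).mono le_rfl (by omega)).comp hw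
      (le_refl (w + δ)) (by omega) hβ hα
  have b2 := hf.comp hw le_rfl (by omega) hβ hα
  have b3 := hF.comp_sub hw le_rfl (by omega) hβ hα
  refine (((b1.mul hw hr).add (b2.add b3)).mono le_rfl (by omega)).congr fun ω hω φ x => ?_
  simp only [CP]
  ring

end Scale

lemma dx_three (V : (ℕ → ℝ) → Fn) (ω : ℕ → ℝ) : dx 3 (V ω) = DX (DX (DX V)) ω := by
  funext φ x
  simp only [dx, iteratedDeriv_succ, iteratedDeriv_zero]
  rfl

lemma dx_two (V : (ℕ → ℝ) → Fn) (ω : ℕ → ℝ) : dx 2 (V ω) = DX (DX V) ω := by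
  funext φ x
  simp only [dx, iteratedDeriv_succ, iteratedDeriv_zero]
  rfl

lemma dx_one (V : (ℕ → ℝ) → Fn) (ω : ℕ → ℝ) : dx 1 (V ω) = DX V ω := by
  funext φ x
  simp only [dx, DX, iteratedDeriv_one]

lemma DX_eq_zero {f : (ℕ → ℝ) → Fn} (hf : IndepX f) (ω φ x) : DX f ω φ x = 0 := by
  have : f ω φ = fun _ => f ω φ x := funext fun y => hf ω φ y x
  rw [DX, this, deriv_const]

/-- The third order operator `ω·∂_φ + a₃ ∂_x³ + a₂ ∂_x² + a₁ ∂_x + a₀`. -/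
def thirdOrder (ω : ℕ → ℝ) (a₃ a₂ a₁ a₀ g : Fn) : Fn := fun φ x =>
  dphi ω g φ x + a₃ φ x * dx 3 g φ x + a₂ φ x * dx 2 g φ x + a₁ φ x * dx 1 g φ x + a₀ φ x * g φ x

/-- The weighted composition `(1 + ∂_x α) V(φ + β ω, x + α)`. -/
def transport (β α V : (ℕ → ℝ) → Fn) : (ℕ → ℝ) → Fn :=
  fun ω φ x => (1 + DX α ω φ x) * CP β α V ω φ x

namespace Scale

variable {η γ : ℝ} {O : Set (ℕ → ℝ)} {D ε δ w : ℝ} {k l : ℕ} {K : Scale η γ O D ε δ}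
  {A : (ℕ → ℝ) → ℝ}

/-- One step of the reduction: a third order operator with Hamiltonian structure which is a small
perturbation of `ω·∂_φ + (1 + A) ∂_x³ + B ∂_x + Z` is conjugated to an operator of that form, with
coefficients close to `A, B, Z`. -/
theorem exists_reduction (hw : 0 < w - 6 * δ) (hA : RBd η γ O w (1 / 8) (fun ω _ _ => A ω))
    {B Z g₃ g₂ g₁ g₀ : (ℕ → ℝ) → Fn} (hg₃ : K.Sm w k g₃) (hg₂ : K.Sm w k g₂) (hg₁ : K.Sm w k g₁)
    (hg₀ : K.Sm w k g₀) (hk : k ≤ 8) (hB : K.Bg w 1 B) (hZ : K.Bg w 1 Z)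
    (hBavg : ∀ ω ∈ O, ∃ b, ∀ φ, avg (B ω φ) = b)
    (hham : ∀ ω ∈ O, ∀ φ x, g₂ ω φ x = 2 * DX g₃ ω φ x) :
    ∃ (ξ β p β' α' r : (ℕ → ℝ) → Fn) (A' : (ℕ → ℝ) → ℝ) (B' Z' : (ℕ → ℝ) → Fn),
      (∀ f ∈ [ξ, β, p, β', α', r, fun ω φ x => B' ω φ x - B ω φ x, fun ω φ x => Z' ω φ x - Z ω φ x],
        K.Sm (w - 6 * δ) (k + 40) f) ∧ (∀ f ∈ [β, p, r, β'], IndepX f) ∧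
      lipNorm (fun a : ℝ => ‖a‖ₑ) γ O (fun ω => A' ω - A ω) ≤ ENNReal.ofReal (D ^ (k + 40) * ε) ∧
      ∀ ω ∈ O,
        (∀ φ x, β' ω φ x = - CP β' α' β ω φ x ∧
          α' ω φ x = - CP β' α' (fun ω φ x => ξ ω φ x + p ω φ x) ω φ x ∧
          CP β (fun ω φ x => ξ ω φ x + p ω φ x) β' ω φ x = - β ω φ x ∧
          CP β (fun ω φ x => ξ ω φ x + p ω φ x) α' ω φ x = - (ξ ω φ x + p ω φ x)) ∧
        (∀ φ x, (1 + DX α' ω φ x) * (1 + CP β' α' (DX ξ) ω φ x) = 1) ∧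
        (∃ b, ∀ φ, avg (B' ω φ) = b) ∧
        ∀ (sV bV : ℝ) (V : (ℕ → ℝ) → Fn), 0 < sV → RBd η γ {ω} sV bV V → ∀ φ x,
          (1 + r ω φ x) * transport β' α' (fun ω => thirdOrder ω
            (fun φ x => 1 + A ω + g₃ ω φ x) (g₂ ω) (fun φ x => B ω φ x + g₁ ω φ x)
            (fun φ x => Z ω φ x + g₀ ω φ x)
            (fun φ x => (1 + DX ξ ω φ x) * CP β (fun ω φ x => ξ ω φ x + p ω φ x) V ω φ x)) ω φ x =
          dphi ω (V ω) φ x + (1 + A' ω) * dx 3 (V ω) φ x + B' ω φ x * dx 1 (V ω) φ x +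
            Z' ω φ x * V ω φ x := by
  have hδ := K.delta_pos
  have hw0 : 0 < w := by linarith
  have hS := K.toSetting
  obtain ⟨ξ, m, bξ, bR, bm, hmx, hξ⟩ := K.exists_change_x hw0 (hA.mono le_rfl (by norm_num)) hg₃
    (by omega)
  obtain ⟨A', β, bβ, hβx, bA', hβ⟩ := K.exists_change_time (w := w - δ) (by linarith)
    (hA.mono (by linarith) le_rfl) (bm.width (by linarith)) hmx (by omega)
  set R := DX ξ with hR
  have bR1 := bR.dx (w' := w - δ) (by linarith) (by linarith)
  have bR2 := bR1.dx (w' := w - 2 * δ) (by linarith) (by linarith)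
  have bR3 := bR2.dx (w' := w - 3 * δ) (by linarith) (by linarith)
  have bρi := bR.inv_big hw0.le (by omega)
  have b1R := bR.one_add (by omega)
  have ba₃ : K.Bg w 1 (fun ω φ x => 1 + A ω + g₃ ω φ x) :=
    (((RBd.const 1).add hA).add (RBd.mono hg₃ le_rfl (K.pow_mul_eps_le (k := k) (by omega)))).mono
      le_rfl (by rw [pow_one, abs_one]; linarith [K.le_D])
  -- the part of the coefficient of first order which does not contain the translation `p`
  set u : (ℕ → ℝ) → Fn := fun ω φ x => (1 + A ω + g₃ ω φ x) * (4 * DX (DX R) ω φ x +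
    3 * ((1 + R ω φ x)⁻¹ * (DX R ω φ x * DX R ω φ x))) + (3 * (g₂ ω φ x * DX R ω φ x) +
    (B ω φ x * R ω φ x + ((1 + R ω φ x) * g₁ ω φ x + DO ξ ω φ x))) with hu
  have w1 : 0 ≤ w - δ := by linarith
  have w2 : 0 ≤ w - 2 * δ := by linarith
  have w3 : 0 ≤ w - 3 * δ := by linarith
  have l1 : w - δ ≤ w := by linarith
  have l2 : w - 2 * δ ≤ w := by linarith
  have l3 : w - 3 * δ ≤ w := by linarith
  have l12 : w - 2 * δ ≤ w - δ := by linarith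
  have l13 : w - 3 * δ ≤ w - δ := by linarith
  have l23 : w - 3 * δ ≤ w - 2 * δ := by linarith
  have c3 : K.Bg (w - 2 * δ) 1 (fun _ _ _ => (3 : ℝ)) := Scale.Bg.const (by norm_num [abs_of_pos])
  have c4 : K.Bg (w - 2 * δ) 1 (fun _ _ _ => (4 : ℝ)) := Scale.Bg.const (by norm_num [abs_of_pos])
  have bu : K.Sm (w - 2 * δ) (k + 15) u := by
    have t1 := (c4.mul w2 bR2).add (c3.mul w2 ((bρi.width l2).mul w2
      (((bR1.width l12).big (by omega)).mul w2 (bR1.width l12))))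
    have t2 := c3.mul w2 (((hg₂.width l2).big (by omega)).mul w2 (bR1.width l12))
    have t3 := (hB.width l2).mul w2 (bR.width l2)
    have t4 := (b1R.width l2).mul w2 (hg₁.width l2)
    have t5 := bξ.dphi w2 (by linarith)
    exact (((ba₃.width l2).mul w2 t1).add (t2.add (t3.add (t4.add t5)))).mono le_rfl (by omega)
  -- the new terms of order zero, divided by the weight `1 + R`
  set z : (ℕ → ℝ) → Fn := fun ω φ x => (1 + R ω φ x)⁻¹ * ((1 + A ω + g₃ ω φ x) * DX (DX (DX R)) ω φ x +
    (g₂ ω φ x * DX (DX R) ω φ x + ((B ω φ x + g₁ ω φ x) * DX R ω φ x + DO R ω φ x))) + g₀ ω φ x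
    with hz
  have bz : K.Sm (w - 3 * δ) (k + 16) z := by
    have t1 := (ba₃.width l3).mul w3 bR3
    have t2 := ((hg₂.width l3).big (by omega)).mul w3 (bR2.width l23)
    have t3 := ((hB.add (hg₁.big (by omega))).width l3).mul w3 (bR1.width l13)
    have t4 := bR.dphi w3 (by linarith)
    exact (((bρi.width l3).mul w3 (t1.add (t2.add (t3.add t4)))).add (hg₀.width l3)).mono le_rfl
      (by omega)
  -- The weight `1 + R` is the Jacobian of the substitution that relates the averages before and after
  -- the change of variables; the average of `B + F + ω·∂_φ p` is the one to be normalized.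
  set F : (ℕ → ℝ) → Fn := fun ω φ x => (1 + R ω φ x) * u ω φ x + B ω φ x * R ω φ x with hF
  have bF : K.Sm (w - 2 * δ) (k + 17) F :=
    (((b1R.width l2).mul w2 bu).add ((hB.width l2).mul w2 (bR.width l2))).mono le_rfl (by omega)
  obtain ⟨p, b, bp, hpx, hp⟩ := K.exists_translation (w := w - 3 * δ) (by linarith)
    (hB.width (by linarith)) hBavg (bF.width (by linarith)) (bβ.mono (by linarith) (by omega)) hβx
    (by omega)
  set α : (ℕ → ℝ) → Fn := fun ω φ x => ξ ω φ x + p ω φ x with hα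
  have bα : K.Sm (w - 3 * δ) (k + 21) α := ((bξ.width l3).add bp).mono le_rfl (by omega)
  obtain ⟨β', α', bβ', bα', hβ'x, hinv⟩ := exists_right_inverse (s' := w - 5 * δ) hS (by linarith) hδ
    (K.pow_mul_eps_le_delta (k := k + 21) (by omega)) (by linarith) (bβ.mono l13 (by omega)) bα
  replace bβ' : K.Sm (w - 5 * δ) (k + 22) β' := bβ'.mono le_rfl (K.two_mul_le _)
  replace bα' : K.Sm (w - 5 * δ) (k + 22) α' := bα'.mono le_rfl (K.two_mul_le _)
  replace hβ'x := hβ'x hβx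
  have bdβ := bβ.dphi (w' := w - 2 * δ) (by linarith) (by linarith)
  have bj := bdβ.inv_one_add (by linarith) (by omega)
  -- the factor `r - 1` before composition with the inverse change of variables
  set j : (ℕ → ℝ) → Fn := fun ω φ x => (1 + DO β ω φ x)⁻¹ - 1 with hj
  have hdβx := IndepX_DO hβx
  have hrx : IndepX (CP β' α' j) := fun ω φ x y => by
    simp only [CP, hj]
    rw [hβ'x ω φ x y, hdβx ω _ _ (y + α' ω φ y)]
  have br : K.Sm (w - 5 * δ) (k + 22) (CP β' α' j) :=
    (bj.comp (by linarith) (by linarith) (by omega) bβ' bα').mono le_rfl (by omega)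
  have bv : K.Sm (w - 4 * δ) (k + 22) (fun ω φ x => u ω φ x + DO p ω φ x) :=
    ((bu.width (by linarith)).add (bp.dphi (by linarith) (by linarith))).mono le_rfl (by omega)
  have bB' := K.transport_sub (w := w - 5 * δ) (k := k + 22) (by linarith) (hB.width (by linarith))
    (bv.width (by linarith)) br (by omega) bβ' bα'
  have bZ' := K.transport_sub (w := w - 5 * δ) (k := k + 22) (by linarith) (hZ.width (by linarith))
    (bz.mono (by linarith) (by omega)) br (by omega) bβ' bα'
  have hαR : ∀ ω ∈ O, ∀ φ x, DX α ω φ x = R ω φ x := fun ω hω φ x => by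
    have h1 := RBd.hasDerivAt_x hS hw0 bξ hω φ x
    have h2 := RBd.hasDerivAt_x hS (by linarith) bp hω φ x
    rw [DX_eq_zero hpx] at h2
    have := (h1.add h2).deriv
    rw [add_zero] at this
    exact this
  have hθ : ∀ ω ∈ O, ∀ φ x, 0 < 1 + DO β ω φ x := fun ω hω φ x =>
    bdβ.one_add_pos w2 (by omega) hω φ x
  have hρ : ∀ ω ∈ O, ∀ φ x, 0 < 1 + R ω φ x := fun ω hω φ x =>
    bR.one_add_pos hw0.le (by omega) hω φ x
  have hα'R : ∀ ω ∈ O, ∀ φ x, (1 + DX α' ω φ x) * (1 + CP β' α' R ω φ x) = 1 := fun ω hω φ x => by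
    have h1 := hasDerivAt_CP_x hS (s := w - 5 * δ) (by linarith) (by linarith) hβ'x bα' bα hω φ x
    have h2 := RBd.hasDerivAt_x hS (by linarith) bα' hω φ x
    rw [show α' ω φ = fun x => - CP β' α' α ω φ x from funext fun x => (hinv ω hω φ x).2] at h2
    have h3 := h2.unique h1.neg
    simp only [CP, hαR ω hω] at h3 ⊢
    linarith
  have hleft : ∀ ω ∈ O, ∀ φ x, CP β α β' ω φ x = - β ω φ x ∧ CP β α α' ω φ x = - α ω φ x :=
    fun ω hω φ x => left_inverse hS (s := w - 3 * δ) (by linarith) hβx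
      (bβ.width l13) bα hω (hθ ω hω) (fun φ x => by rw [hαR ω hω]; exact hρ ω hω φ x)
      (hinv ω hω) φ x
  refine ⟨ξ, β, p, β', α', CP β' α' j, A',
    fun ω φ x => (1 + CP β' α' j ω φ x) *
      CP β' α' (fun ω φ x => B ω φ x + (u ω φ x + DO p ω φ x)) ω φ x,
    fun ω φ x => (1 + CP β' α' j ω φ x) * CP β' α' (fun ω φ x => Z ω φ x + z ω φ x) ω φ x,
    ?_, ?_, bA'.trans (ENNReal.ofReal_le_ofReal ?_),
    fun ω hω => ⟨fun φ x => ⟨(hinv ω hω φ x).1, (hinv ω hω φ x).2, hleft ω hω φ x⟩,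
      hα'R ω hω, ⟨b ω, fun φ => ?_⟩, fun sV bV V hsV hV φ x => ?_⟩⟩
  · simp only [List.forall_mem_cons, List.not_mem_nil, false_imp_iff, implies_true, and_true]
    exact ⟨bξ.mono (by linarith) (by omega), bβ.mono (by linarith) (by omega),
      bp.mono (by linarith) (by omega), bβ'.mono (by linarith) (by omega),
      bα'.mono (by linarith) (by omega), br.mono (by linarith) (by omega),
      bB'.mono (by linarith) (by omega), bZ'.mono (by linarith) (by omega)⟩
  · simp only [List.forall_mem_cons, List.not_mem_nil, false_imp_iff, implies_true, and_true]
    exact ⟨hβx, hpx, hrx, hβ'x⟩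
  · exact mul_le_mul_of_nonneg_right (K.pow_le_pow (by omega)) K.eps_nonneg
  -- the average of `B'`, computed by the substitution `y = x + α'`
  · set θ := φ + β' ω φ 0 • ω with hθ0
    have cB : Continuous (B ω θ) := (RBd.contDiff hS hw0 hB hω θ).continuous
    have cu : Continuous (u ω θ) := (RBd.contDiff hS (by linarith) bu hω θ).continuous
    have cR : Continuous (R ω θ) := (RBd.contDiff hS hw0 bR hω θ).continuous
    have cF : Continuous (F ω θ) := (RBd.contDiff hS (by linarith) bF hω θ).continuous
    have bdα' := bα'.dx (w' := w - 6 * δ) (by linarith) (by linarith)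
    have cα' : Continuous (DX α' ω φ) := (RBd.contDiff hS hw bdα' hω φ).continuous
    set f : ℝ → ℝ := fun y => (B ω θ y + (u ω θ y + DO p ω θ 0)) * (1 + R ω θ y) with hf
    have hper : Function.Periodic f (2 * Real.pi) := fun y => by
      simp only [hf]
      rw [RBd.periodic hB hω θ y, RBd.periodic bu hω θ y, RBd.periodic bR hω θ y]
    have hint := integral_comp_circle (g := fun x => x + α' ω φ x) (ρ := fun x => 1 + DX α' ω φ x)
      (fun x => (hasDerivAt_id x).add (RBd.hasDerivAt_x hS (by linarith) bα' hω φ x))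
      (continuous_const.add cα') (fun x => by rw [RBd.periodic bα' hω φ x]; ring)
      (f := f) (by fun_prop) hper
    have havg : avg (fun x => f (x + α' ω φ x) * (1 + DX α' ω φ x)) = avg f := by
      unfold avg
      rw [hint]
    have hB'f : (fun x => (1 + CP β' α' j ω φ x) *
        CP β' α' (fun ω φ x => B ω φ x + (u ω φ x + DO p ω φ x)) ω φ x) =
        fun x => (1 + DO β ω θ 0)⁻¹ * (f (x + α' ω φ x) * (1 + DX α' ω φ x)) := funext fun x => by
      have h := hα'R ω hω φ x
      simp only [CP, hj, hf] at h ⊢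
      rw [hβ'x ω φ x 0] at h ⊢
      rw [hdβx ω _ _ 0, IndepX_DO hpx ω _ _ 0]
      linear_combination (-(1 + DO β ω θ 0)⁻¹ *
        (B ω θ (x + α' ω φ x) + (u ω θ (x + α' ω φ x) + DO p ω θ 0))) * h
    have hfF : f = fun y => B ω θ y + (F ω θ y + (DO p ω θ 0 + DO p ω θ 0 * R ω θ y)) :=
      funext fun y => by
        simp only [hf, hF]
        ring
    refine (congrArg avg hB'f).trans ?_
    rw [avg_const_mul, havg, hfF, avg_add cB (by fun_prop), avg_add cF (by fun_prop),
      avg_add continuous_const (by fun_prop), avg_const, avg_const_mul, (hξ ω hω).1, mul_zero,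
      add_zero, ← add_assoc, hp ω hω θ 0]
    have := (hθ ω hω θ 0).ne'
    field_simp
  -- the conjugated operator at `(φ, x)`, the point that `(θ, y)` is mapped to
  · set θ := φ + β' ω φ x • ω with hθ0
    set y := x + α' ω φ x with hy
    have hsub : ({ω} : Set (ℕ → ℝ)) ⊆ O := Set.singleton_subset_iff.2 hω
    have hS' : Setting η γ {ω} := ⟨hS.eta_pos, hS.gamma_lt, fun ω' h => hS.mem_Icc ω' (hsub h)⟩
    have E := operator_transport hS' (s := w - 3 * δ) (by linarith) hsV hβx
      (RBd.subset (bβ.width l13) hsub) (RBd.subset bα hsub) (RBd.subset (bR.width l3) hsub) hV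
      (Set.mem_singleton ω) (hαR ω hω) (1 + A ω + g₃ ω θ y) (g₂ ω θ y) (B ω θ y + g₁ ω θ y)
      (Z ω θ y + g₀ ω θ y) θ y (hρ ω hω θ y).ne'
    have hpt : ∀ X : (ℕ → ℝ) → Fn, CP β α X ω θ y = X ω φ x := fun X => by
      obtain ⟨h1, h2⟩ := hinv ω hω φ x
      change β' ω φ x = - β ω θ y at h1
      change α' ω φ x = - α ω θ y at h2
      have e1 : θ + β ω θ y • ω = φ := by
        rw [hθ0, add_assoc, ← add_smul, ← hθ0, h1, neg_add_cancel, zero_smul, add_zero]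
      have e2 : y + α ω θ y = x := by
        linarith
      simp only [CP]
      rw [e1, e2]
    have hDα : DO α ω θ y = DO ξ ω θ y + DO p ω θ y := by
      have h1 := RBd.hasDerivAt_phi hS hw0 bξ hω θ y 0
      have h2 := RBd.hasDerivAt_phi hS (by linarith) bp hω θ y 0
      have := (h1.add h2).deriv
      simp only [zero_smul, add_zero] at this
      exact this
    have hr1 : 1 + CP β' α' j ω φ x = (1 + DO β ω θ y)⁻¹ := add_sub_cancel _ _
    have hr2 : 1 + DX α' ω φ x = (1 + R ω θ y)⁻¹ := eq_inv_of_mul_eq_one_left (hα'R ω hω φ x)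
    have h2 : 6 * (1 + A ω + g₃ ω θ y) * DX R ω θ y + g₂ ω θ y * (1 + R ω θ y) = 0 := by
      rw [hham ω hω]
      refine coeff_two_eq_zero (a₃ := fun y => 1 + A ω + g₃ ω θ y) (ρ := fun y => 1 + R ω θ y)
        (m := 1 + A ω + m ω θ 0) ((RBd.hasDerivAt_x hS hw0 hg₃ hω θ y).const_add _)
        ((RBd.hasDerivAt_x hS hw0 bR hω θ y).const_add 1) (fun y => ?_) (hρ ω hω θ y).ne'
      rw [(hξ ω hω).2, hmx ω θ y 0]
    have h3 := (hξ ω hω).2 θ y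
    rw [← hβ ω hω θ y] at h3
    have hθ1 := (hθ ω hω θ y).ne'
    have hρ1 := (hρ ω hω θ y).ne'
    have hi1 := inv_mul_cancel₀ hθ1
    have hi2 := inv_mul_cancel₀ hρ1
    change (1 + CP β' α' j ω φ x) * ((1 + DX α' ω φ x) * _) = dphi ω (V ω) φ x +
      (1 + A' ω) * dx 3 (V ω) φ x +
      (1 + CP β' α' j ω φ x) * (B ω θ y + (u ω θ y + DO p ω θ y)) * dx 1 (V ω) φ x +
      (1 + CP β' α' j ω φ x) * (Z ω θ y + z ω θ y) * V ω φ x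
    rw [hr1, hr2]
    refine (congrArg (fun t => (1 + DO β ω θ y)⁻¹ * t) E).trans ?_
    simp only [hpt]
    rw [hDα, h2, h3, dx_three, dx_one, show dphi ω (V ω) φ x = DO V ω φ x from rfl]
    simp only [hu, hz]
    linear_combination (DO V ω φ x + (1 + A' ω) * DX (DX (DX V)) ω φ x) * hi1

end Scale

/-! ### The parameters of the iteration -/

section Parameters

variable {S sbar : ℝ}

lemma sigmaInit_pos (h : sbar < S) : 0 < sigmaInit S sbar := by
  unfold sigmaInit
  have : 0 < min (S - sbar) 1 := lt_min (by linarith) one_pos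
  positivity

lemma sigmaInit_le : sigmaInit S sbar ≤ 1 / 8 := by
  unfold sigmaInit
  linarith [min_le_right (S - sbar) 1]

lemma sigma_pos (h : sbar < S) (n : ℕ) : 0 < sigma S sbar n := by
  unfold sigma
  have := sigmaInit_pos h
  have := Real.pi_pos
  positivity

lemma sum_sigma_le (h : sbar < S) (n : ℕ) : ∑ k ∈ Finset.range n, sigma S sbar k ≤ sigmaInit S sbar := by
  have h1 : HasSum (fun k : ℕ => 1 / ((k : ℝ) + 1) ^ 2) (Real.pi ^ 2 / 6) := by
    have := (hasSum_nat_add_iff' 1).2 hasSum_zeta_two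
    simpa using this
  have h2 : HasSum (sigma S sbar) (sigmaInit S sbar) := by
    refine hasSum_of_eq (f := fun k : ℕ => 6 * sigmaInit S sbar / Real.pi ^ 2 * (1 / ((k : ℝ) + 1) ^ 2))
      ?_ fun k => ?_
    · have := h1.mul_left (6 * sigmaInit S sbar / Real.pi ^ 2)
      have hpi := Real.pi_ne_zero
      rwa [show 6 * sigmaInit S sbar / Real.pi ^ 2 * (Real.pi ^ 2 / 6) = sigmaInit S sbar by
        field_simp] at this
    · unfold sigma
      rw [div_mul_div_comm, mul_one]
  exact sum_le_hasSum _ (fun k _ => (sigma_pos h k).le) h2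

lemma sigma_le (h : sbar < S) (n : ℕ) : sigma S sbar n ≤ 1 / 8 := by
  refine le_trans ?_ ((sum_sigma_le h (n + 1)).trans sigmaInit_le)
  exact Finset.single_le_sum (f := sigma S sbar) (fun k _ => (sigma_pos h k).le)
    (Finset.self_mem_range_succ n)

lemma width_eq (n : ℕ) :
    width S sbar n = S - sigmaInit S sbar - 6 * ∑ k ∈ Finset.range n, sigma S sbar k := by
  induction n with
  | zero => simp [width]
  | succ n ih =>
    rw [width, ih, Finset.sum_range_succ]
    ring

lemma width_pos (h0 : 0 < sbar) (h : sbar < S) (n : ℕ) : 0 < width S sbar n - 6 * sigma S sbar n := by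
  have h1 := width_eq (S := S) (sbar := sbar) (n + 1)
  have h2 := sum_sigma_le h (n + 1)
  rw [width] at h1
  have h3 : sigmaInit S sbar ≤ (S - sbar) / 8 := by
    unfold sigmaInit
    linarith [min_le_left (S - sbar) 1]
  linarith

lemma width_antitone (h : sbar < S) : Antitone (width S sbar) :=
  antitone_nat_of_succ_le fun n => by
    rw [width]
    linarith [sigma_pos h n]

lemma width_le_widthCoeff (h : sbar < S) (n : ℕ) : width S sbar n ≤ widthCoeff S sbar n := by
  cases n with
  | zero => exact le_rfl
  | succ n =>
    rw [width, widthCoeff]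
    linarith [sigma_pos h n]

lemma widthCoeff_le (h : sbar < S) {k n : ℕ} (hk : k < n) :
    widthCoeff S sbar n ≤ width S sbar k - 3 * sigma S sbar k := by
  cases n with
  | zero => omega
  | succ n =>
    rw [widthCoeff]
    rcases (Nat.lt_succ_iff.1 hk).eq_or_lt with rfl | hlt
    · exact le_rfl
    · have h1 := width_antitone h (Nat.succ_le_of_lt hlt)
      rw [Nat.succ_eq_add_one, width] at h1
      linarith [sigma_pos h n, sigma_pos h k]

end Parameters

/-! ### Sums of increments -/

lemma lipNorm_add_le {Y : Type*} [AddCommGroup Y] {N : Y → ℝ≥0∞} (hN : ∀ a b, N (a + b) ≤ N a + N b)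
    {γ : ℝ} {O : Set (ℕ → ℝ)} (f g : (ℕ → ℝ) → Y) :
    lipNorm N γ O (fun ω => f ω + g ω) ≤ lipNorm N γ O f + lipNorm N γ O g := by
  obtain ⟨a, l, h1, h2, h3⟩ := exists_lipNorm_eq N γ O f
  obtain ⟨a', l', h1', h2', h3'⟩ := exists_lipNorm_eq N γ O g
  refine lipNorm_le (a := a + a') (l := l + l') (fun ω hω => (hN _ _).trans (add_le_add (h1 ω hω)
    (h1' ω hω))) (fun ω₁ H₁ ω₂ H₂ hne => ?_) (le_of_eq ?_)
  · refine le_trans ?_ (add_le_add (h2 ω₁ H₁ ω₂ H₂ hne) (h2' ω₁ H₁ ω₂ H₂ hne))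
    rw [← ENNReal.add_div, add_sub_add_comm]
    exact ENNReal.div_le_div_right (hN _ _) _
  · rw [h3, h3']
    ring

/-- A family that starts from zero is bounded by the sum of its increments. -/
lemma lipNorm_le_sum {Y : Type*} [AddCommGroup Y] {N : Y → ℝ≥0∞} (hN : ∀ a b, N (a + b) ≤ N a + N b)
    (h0 : N 0 = 0) {γ : ℝ} {O : Set (ℕ → ℝ)} {f : ℕ → (ℕ → ℝ) → Y} (hf : ∀ ω ∈ O, f 0 ω = 0) {n : ℕ}
    {c : ℕ → ℝ} (hc0 : ∀ k, 0 ≤ c k)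
    (hc : ∀ k < n, lipNorm N γ O (fun ω => f (k + 1) ω - f k ω) ≤ ENNReal.ofReal (c k)) :
    lipNorm N γ O (f n) ≤ ENNReal.ofReal (∑ k ∈ Finset.range n, c k) := by
  induction n with
  | zero =>
    refine lipNorm_le (a := 0) (l := 0) (fun ω hω => ?_) (fun ω₁ H₁ ω₂ H₂ hne => ?_) (by simp)
    · rw [hf ω hω, h0]
    · rw [hf _ H₁, hf _ H₂, sub_zero, h0, ENNReal.zero_div]
  | succ n ih =>
    rw [Finset.sum_range_succ, ENNReal.ofReal_add (Finset.sum_nonneg fun k _ => hc0 k) (hc0 n)]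
    have := lipNorm_add_le (γ := γ) (O := O) hN (f n) (fun ω => f (n + 1) ω - f n ω)
    simp only [add_sub_cancel] at this
    exact this.trans (add_le_add (ih fun k hk => hc k (by omega)) (hc n (by omega)))

lemma anorm_zero (η s : ℝ) : anorm η s 0 = 0 := by simp [anorm]

lemma anorm_add_le (η s : ℝ) (u v : Fourier) : anorm η s (u + v) ≤ anorm η s u + anorm η s v := by
  rw [anorm, anorm, anorm, ← ENNReal.tsum_add]
  refine ENNReal.tsum_le_tsum fun k => ?_
  rw [← add_mul]
  gcongr
  exact enorm_add_le _ _

lemma lipNorm_anorm_mono {η s s' γ : ℝ} {O : Set (ℕ → ℝ)} (h : s' ≤ s) (u : (ℕ → ℝ) → Fourier) :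
    lipNorm (anorm η s') γ O u ≤ lipNorm (anorm η s) γ O u :=
  lipNorm_mono (fun _ _ => anorm_mono h) fun _ _ _ _ => anorm_mono h

lemma Hs_add {η s : ℝ} (hs : 0 ≤ s) {u v : Fourier} (hu : u ∈ Hs η s) (hv : v ∈ Hs η s) :
    u + v ∈ Hs η s ∧ ∀ φ x, eval (u + v) φ x = eval u φ x + eval v φ x := by
  refine ⟨⟨fun k => ?_, (anorm_add_le η s u v).trans_lt (ENNReal.add_lt_top.2 ⟨hu.2, hv.2⟩)⟩,
    fun φ x => eval_eq_of_hasSum ?_⟩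
  · rw [Pi.add_apply, Pi.add_apply, hu.1, hv.1, map_add]
  · rw [Complex.ofReal_add]
    refine hasSum_of_eq ((hasSum_eval hu.1 (summable_norm_of_mem_Hs hs hu.2) φ x).add
      (hasSum_eval hv.1 (summable_norm_of_mem_Hs hs hv.2) φ x)) fun k => ?_
    rw [Pi.add_apply, add_mul]

lemma oneF_mem (η s : ℝ) : oneF ∈ Hs η s := by
  refine ⟨fun k => ?_, ?_⟩
  · by_cases hk : k = 0
    · simp [hk, oneF]
    · simp [hk, oneF]
  · rw [anorm, tsum_eq_single 0 fun k hk => by simp [oneF, hk]]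
    exact ENNReal.mul_lt_top (by simp [oneF]) ENNReal.ofReal_lt_top

lemma eval_oneF (φ : ℕ → ℝ) (x : ℝ) : eval oneF φ x = 1 := by
  refine eval_eq_of_hasSum ?_
  rw [Complex.ofReal_one]
  convert hasSum_ite_eq (0 : Freq) (1 : ℂ) using 2 with k
  by_cases hk : k = 0
  · simp [hk, oneF, mode_zero]
  · simp [hk, oneF]

lemma eval_zero (φ : ℕ → ℝ) (x : ℝ) : eval 0 φ x = 0 := by simp [eval]

lemma zero_mem_Hs (η s : ℝ) : (0 : Fourier) ∈ Hs η s :=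
  ⟨fun k => by simp, by rw [anorm_zero]; exact ENNReal.zero_lt_top⟩

/-! ### The changes of variables as operators -/

/-- The weighted composition operator `V ↦ (1 + R) V(φ + β ω, x + α)`. -/
def pull (ω : ℕ → ℝ) (R β α V : Fn) : Fn := fun φ x => (1 + R φ x) * V (φ + β φ x • ω) (x + α φ x)

lemma changeVar_eq_pull {ξ β p : (ℕ → ℝ) → Fn} (hβ : IndepX β) (hp : IndepX p) {ω : ℕ → ℝ}
    {Ξ Β P : Fourier} (h1 : eval Ξ = ξ ω) (h2 : eval Β = β ω) (h3 : eval P = p ω) :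
    changeVar ω Ξ Β P = pull ω (DX ξ ω) (β ω) (fun φ x => ξ ω φ x + p ω φ x) := by
  funext V φ x
  simp only [changeVar, fibre, pull, h1, h2, h3, dx_one]
  rw [hβ ω φ 0 x, hp ω φ 0 x, add_assoc]

/-- Weighted compositions with inverse changes of variables and reciprocal weights are inverse to
each other. -/
lemma pull_pull {ω : ℕ → ℝ} {R β α R' β' α' : Fn} (h1 : ∀ φ x, β' φ x = - β (φ + β' φ x • ω) (x + α' φ x))
    (h2 : ∀ φ x, α' φ x = - α (φ + β' φ x • ω) (x + α' φ x))
    (h3 : ∀ φ x, (1 + R' φ x) * (1 + R (φ + β' φ x • ω) (x + α' φ x)) = 1) (V : Fn) :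
    pull ω R' β' α' (pull ω R β α V) = V := by
  funext φ x
  simp only [pull]
  rw [← mul_assoc, h3, one_mul]
  congr 1
  · rw [add_assoc, ← add_smul, h1, neg_add_eq_zero.2 (by rw [← h1]), zero_smul, add_zero]
  · have := h2 φ x
    linarith

/-- Weighted compositions with functions analytic on a strip are bounded. -/
lemma boundedOnStrips_pull {η γ : ℝ} {ω : ℕ → ℝ} (H : Setting η γ {ω}) {R β α : (ℕ → ℝ) → Fn}
    {σ smax t d : ℝ} (hd : 3 * d ≤ σ) (ht : smax - σ ≤ t) (hβ : RBd η γ {ω} t d β)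
    (hα : RBd η γ {ω} t d α) (hR : RBd η γ {ω} t (1 / 2) R) :
    BoundedOnStrips η σ smax (pull ω (R ω) (β ω) (α ω)) := by
  intro s hσ hs v hv
  have hs0 : 0 ≤ s - σ := by linarith
  have h1 := (RBd.of_mem_Hs (γ := γ) (by linarith [hβ.1]) hv ω).comp H hs0 (by linarith)
    (hβ.mono (by linarith) le_rfl) (hα.mono (by linarith) le_rfl)
  have h2 := ((RBd.const 1).add (hR.mono (s' := s - σ) (by linarith) le_rfl)).mul hs0 h1
  obtain ⟨U, b1, b2, -⟩ := h2.exists_fourier hs0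
  refine ⟨U ω, (b2 ω rfl).1, (b2 ω rfl).2, ((le_lipNorm (Set.mem_singleton ω)).trans b1).trans ?_⟩
  rw [ENNReal.ofReal_mul (by positivity), ENNReal.ofReal_toReal hv.2.ne]
  gcongr
  rw [abs_one]
  exact (ENNReal.ofReal_le_ofReal (by norm_num)).trans (ENNReal.ofReal_ofNat 2).le

/-- The action of a change of variables on functions of `x` is symplectic. -/
lemma isSymplectic_fibre {η γ : ℝ} {O : Set (ℕ → ℝ)} (H : Setting η γ O) {ξ : (ℕ → ℝ) → Fn} {s b : ℝ}
    (hs : 0 < s) (hξ : RBd η γ O s b ξ) {ω : ℕ → ℝ} (hω : ω ∈ O) {Ξ P : Fourier} (h1 : eval Ξ = ξ ω)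
    (φ : ℕ → ℝ) : IsSymplectic (fibre Ξ P φ) := by
  have hc := ((hξ.dx H (half_pos hs).le (half_lt_self hs)).contDiff H (half_pos hs) hω φ).continuous
  have := isSymplectic_transport (g := fun x => x + ξ ω φ x + eval P φ 0)
    (ρ := fun x => 1 + DX ξ ω φ x)
    (fun x => ((hasDerivAt_id x).add (hξ.hasDerivAt_x H hs hω φ x)).add_const _)
    (continuous_const.add hc) fun x => by rw [hξ.periodic hω φ x]; ring
  unfold fibre
  rw [h1, dx_one]
  exact this

/-! ### The linearized quadratic part -/

/-- The coefficient of `∂_x^l v` in `Q'(h)[v]`, for `Q(u) = ∑ q_{ij} (∂_x^i u) (∂_x^j u)`. -/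
def quadCoeff (q : ℕ × ℕ → (ℕ → ℝ) → Fn) (h : ℕ → (ℕ → ℝ) → Fn) (l : ℕ) : (ℕ → ℝ) → Fn :=
  fun ω φ x => ∑ ij ∈ quadIndex, q ij ω φ x *
    ((if ij.2 = l then h ij.1 ω φ x else 0) + if ij.1 = l then h ij.2 ω φ x else 0)

lemma lt_of_mem_quadIndex {ij : ℕ × ℕ} (h : ij ∈ quadIndex) : ij.1 < 4 ∧ ij.2 < 4 := by
  simp only [quadIndex, Finset.mem_filter, Finset.mem_product, Finset.mem_range] at h
  omega

lemma quadDiff_eq (q : ℕ × ℕ → (ℕ → ℝ) → Fourier) (h : (ℕ → ℝ) → Fn) (ω : ℕ → ℝ) (v : Fn)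
    (φ : ℕ → ℝ) (x : ℝ) : quadDiff (fun ij => q ij ω) (h ω) v φ x =
    ∑ l ∈ Finset.range 4, quadCoeff (fun ij ω => eval (q ij ω)) (fun i ω => dx i (h ω)) l ω φ x *
      dx l v φ x := by
  simp only [quadDiff, quadBil, quadCoeff, Finset.sum_mul]
  rw [Finset.sum_comm, ← Finset.sum_add_distrib]
  refine Finset.sum_congr rfl fun ij hij => ?_
  obtain ⟨h1, h2⟩ := lt_of_mem_quadIndex hij
  simp only [mul_assoc, add_mul, mul_add, ite_mul, zero_mul, mul_ite, mul_zero, Finset.sum_add_distrib,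
    Finset.sum_ite_eq, Finset.mem_range, h1, h2, if_true]
  ring

namespace Scale

variable {η γ : ℝ} {O : Set (ℕ → ℝ)} {D ε δ w : ℝ} {K : Scale η γ O D ε δ}

/-- The factor of `D` from `D^7` to `D^8` bounds the number of terms. -/
lemma quadCoeff_small (hw : 0 ≤ w) {q : ℕ × ℕ → (ℕ → ℝ) → Fn} {h : ℕ → (ℕ → ℝ) → Fn}
    (hq : ∀ ij ∈ quadIndex, K.Bg w 2 (q ij)) (hh : ∀ i < 4, K.Sm w 4 (h i)) (l : ℕ) :
    K.Sm w 8 (quadCoeff q h l) := by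
  have h0 : ∀ (P : Prop) [Decidable P], ∀ i < 4, K.Sm w 4 (fun ω φ x => if P then h i ω φ x else 0) := by
    intro P _ i hi
    by_cases hP : P
    · simpa only [hP, if_true] using hh i hi
    · have h00 : RBd η γ O w |(0 : ℝ)| (fun _ _ _ => 0) := RBd.const 0
      rw [abs_zero] at h00
      simp only [hP, if_false]
      exact h00.mono le_rfl (K.pow_mul_eps_nonneg 4)
  have := RBd.sum (η := η) (γ := γ) (O := O) (s := w) quadIndex
    (f := fun ij ω φ x => q ij ω φ x *
      ((if ij.2 = l then h ij.1 ω φ x else 0) + if ij.1 = l then h ij.2 ω φ x else 0))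
    (b := fun _ => D ^ 7 * ε) fun ij hij => ?_
  · refine this.mono le_rfl ?_
    rw [Finset.sum_const, nsmul_eq_mul]
    have hc : (quadIndex.card : ℝ) ≤ D := by
      have : quadIndex.card ≤ 100 := by decide
      exact le_trans (by exact_mod_cast this) K.le_D
    calc _ ≤ D * (D ^ 7 * ε) := mul_le_mul_of_nonneg_right hc (K.pow_mul_eps_nonneg 7)
      _ = D ^ 8 * ε := by ring
  · obtain ⟨h1, h2⟩ := lt_of_mem_quadIndex hij
    exact (hq ij hij).mul hw ((h0 _ _ h1).add (h0 _ _ h2))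

/-- The derivatives of the approximate solution. -/
lemma dx_small (hw : 0 ≤ w) {h : (ℕ → ℝ) → Fn} (hh : K.Sm (w + 3 * δ) 1 h) :
    ∀ i < 4, K.Sm w 4 (fun ω => AiryKAM.dx i (h ω)) := by
  have hδ := K.delta_pos
  have h1 := hh.dx (w' := w + 2 * δ) (by linarith) (by linarith)
  have h2 := h1.dx (w' := w + δ) (by linarith) (by linarith)
  have h3 := h2.dx (w' := w) (by linarith) (by linarith)
  intro i hi
  interval_cases i
  · exact (hh.mono (by linarith) (by omega)).congr fun ω _ φ x => by
      simp only [AiryKAM.dx, iteratedDeriv_zero]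
  · exact (h1.mono (by linarith) (by omega)).congr fun ω _ φ x => by rw [dx_one]
  · exact (h2.mono (by linarith) (by omega)).congr fun ω _ φ x => by rw [dx_two]
  · exact (h3.mono le_rfl (by omega)).congr fun ω _ φ x => by rw [dx_three]

end Scale

/-! ### One step of the iteration -/

namespace Scale

variable {η γ : ℝ} {O : Set (ℕ → ℝ)} {D ε δ s t σ : ℝ} {K : Scale η γ O D ε δ}

/-- A family of series that is bounded in the Lipschitz norm on the strip of width `t`. -/
lemma of_lipNorm (K : Scale η γ O D ε δ) (ht : 0 ≤ t)
    (hsum : ∑' k, weight η (-δ) k ≤ ENNReal.ofReal D) {u : (ℕ → ℝ) → Fourier} {b : ℝ} (hb : 0 ≤ b)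
    (hu : ∀ ω ∈ O, u ω ∈ Hs η t) (h : lipNorm (anorm η t) γ O u ≤ ENNReal.ofReal b) :
    RBd η γ O (t - δ) (D * b) (fun ω => eval (u ω)) :=
  RBd.of_lipNorm ht hb K.D_pos.le (by rwa [sub_sub_cancel_left]) hu h

/-- The second coefficient of a Hamiltonian operator of third order. -/
lemma coeff_two_eq {w : ℝ} (hw : 0 < w) {A : (ℕ → ℝ) → ℝ} {B Z g₃ g₂ g₁ g₀ : (ℕ → ℝ) → Fn} {k : ℕ}
    (hg₃ : K.Sm w k g₃) (hg₂ : K.Sm w k g₂) (hg₁ : K.Sm w k g₁) (hg₀ : K.Sm w k g₀) (hB : K.Bg w 1 B)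
    (hZ : K.Bg w 1 Z) {ω : ℕ → ℝ} (hω : ω ∈ O) (φ : ℕ → ℝ)
    (hP : IsHamiltonian fun u x => thirdOrder ω (fun φ x => 1 + A ω + g₃ ω φ x) (g₂ ω)
      (fun φ x => B ω φ x + g₁ ω φ x) (fun φ x => Z ω φ x + g₀ ω φ x) (fun _ => u) φ x) (x : ℝ) :
    g₂ ω φ x = 2 * DX g₃ ω φ x := by
  have hs : ∀ {f : (ℕ → ℝ) → Fn} {b : ℝ}, RBd η γ O w b f → SmoothPer (f ω φ) := fun hf =>
    ⟨hf.contDiff K.toSetting hw hω φ, hf.periodic hω φ⟩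
  have hc : SmoothPer fun _ => 1 + A ω := ⟨contDiff_const, fun _ => rfl⟩
  have hadd : ∀ {f g : ℝ → ℝ}, SmoothPer f → SmoothPer g → SmoothPer fun x => f x + g x :=
    fun hf hg => hf.add hg
  have := coeff_two_of_isHamiltonian hP (hadd hc (hs hg₃)) (hs hg₂) (hadd (hs hB) (hs hg₁))
    (hadd (hs hZ) (hs hg₀)) (fun u _ x => ?_) x
  · rw [this, deriv_const_add]
    rfl
  · simp only [thirdOrder, AiryKAM.dphi, AiryKAM.dx, deriv_const]
    ring

/-- The reduction step for operators given by Fourier series. Of the loss of width `σ = 20 δ`, four `δ`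
are spent on the change of norms and on the derivatives of `h`, six on the reduction. The power `48`
is `8 + 40`, from the size `D^8 ε` of the perturbation and the loss `D^40` of the reduction. -/
theorem exists_step (K : Scale η γ O D ε δ) (hσ : σ = 20 * δ) (hs : 0 < s - 3 * σ) (hst : s ≤ t)
    (hsum : ∑' k, weight η (-δ) k ≤ ENNReal.ofReal D) {M : ℝ} (hM0 : 0 ≤ M) (hM : M ≤ D)
    {A : (ℕ → ℝ) → ℝ} {B Z : (ℕ → ℝ) → Fourier} {q : ℕ × ℕ → (ℕ → ℝ) → Fourier}
    {h : (ℕ → ℝ) → Fourier} (hA : lipNorm (fun a : ℝ => ‖a‖ₑ) γ O A ≤ ENNReal.ofReal (1 / 8))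
    (hB : lipNorm (anorm η t) γ O B ≤ ENNReal.ofReal (1 / 8))
    (hZ : lipNorm (anorm η t) γ O Z ≤ ENNReal.ofReal (1 / 8))
    (hBZ : ∀ ω ∈ O, B ω ∈ Hs η t ∧ Z ω ∈ Hs η t)
    (hBavg : ∀ ω ∈ O, ∃ b : ℝ, ∀ φ, AiryKAM.avg (eval (B ω) φ) = b)
    (hq : ∀ ω ∈ O, ∀ ij ∈ quadIndex, q ij ω ∈ Hs η t)
    (hqM : ∑ ij ∈ quadIndex, lipNorm (anorm η t) γ O (q ij) ≤ ENNReal.ofReal M)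
    (hh : ∀ ω ∈ O, h ω ∈ Hs η s) (hhε : lipNorm (anorm η s) γ O h ≤ ENNReal.ofReal ε)
    (hham : ∀ ω ∈ O, ∀ φ : ℕ → ℝ, IsHamiltonian fun u x =>
      airyOp ω (A ω) (B ω) (Z ω) (fun _ => u) φ x +
        quadDiff (fun ij => q ij ω) (eval (h ω)) (fun _ => u) φ x) :
    ∃ (ξ β p r ξ' β' p' : (ℕ → ℝ) → Fourier) (A' : (ℕ → ℝ) → ℝ) (B' Z' : (ℕ → ℝ) → Fourier),
      (∀ f ∈ [ξ, β, p, fun ω => r ω - oneF],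
        lipNorm (anorm η (s - σ)) γ O f ≤ ENNReal.ofReal (D ^ 48 * ε)) ∧
      lipNorm (fun a : ℝ => ‖a‖ₑ) γ O (fun ω => A' ω - A ω) ≤ ENNReal.ofReal (D ^ 48 * ε) ∧
      lipNorm (anorm η (s - 3 * σ)) γ O (fun ω => B' ω - B ω) ≤ ENNReal.ofReal (D ^ 48 * ε) ∧
      lipNorm (anorm η (s - 3 * σ)) γ O (fun ω => Z' ω - Z ω) ≤ ENNReal.ofReal (D ^ 48 * ε) ∧
      ∀ ω ∈ O,
        (∀ f ∈ [ξ ω, β ω, p ω, r ω], f ∈ Hs η (s - σ)) ∧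
        (∀ f ∈ [ξ' ω, β' ω, p' ω], f ∈ Hs η (s - 2 * σ)) ∧
        (∀ f ∈ [B' ω, Z' ω], f ∈ Hs η (s - 3 * σ)) ∧
        (∀ f ∈ [β ω, p ω, r ω, β' ω, p' ω], XIndep f) ∧
        BoundedOnStrips η σ (s - σ) (changeVar ω (ξ ω) (β ω) (p ω)) ∧
        BoundedOnStrips η σ (s - σ) (changeVar ω (ξ' ω) (β' ω) (p' ω)) ∧
        (∀ g : Fn,
          changeVar ω (ξ' ω) (β' ω) (p' ω) (changeVar ω (ξ ω) (β ω) (p ω) g) = g ∧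
          changeVar ω (ξ ω) (β ω) (p ω) (changeVar ω (ξ' ω) (β' ω) (p' ω) g) = g) ∧
        (∀ φ, IsSymplectic (fibre (ξ ω) (p ω) φ) ∧ IsSymplectic (fibre (ξ' ω) (p' ω) φ)) ∧
        (∀ s > 0, ∀ v ∈ Hs η s, ∀ φ x,
          eval (r ω) φ 0 *
            changeVar ω (ξ' ω) (β' ω) (p' ω)
              (fun θ y =>
                airyOp ω (A ω) (B ω) (Z ω) (changeVar ω (ξ ω) (β ω) (p ω) (eval v)) θ y +
                quadDiff (fun ij => q ij ω) (eval (h ω))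
                  (changeVar ω (ξ ω) (β ω) (p ω) (eval v)) θ y) φ x =
          airyOp ω (A' ω) (B' ω) (Z' ω) (eval v) φ x) ∧
        ∃ b : ℝ, ∀ φ, AiryKAM.avg (eval (B' ω) φ) = b := by
  have hδ := K.delta_pos
  have ht : 0 ≤ t := by linarith
  set w := s - 4 * δ with hw
  have hw0 : 0 < w := by linarith
  have bh : K.Sm (w + 3 * δ) 1 (fun ω => eval (h ω)) :=
    (K.of_lipNorm (by linarith) hsum K.eps_nonneg hh hhε).mono (by linarith) (by rw [pow_one])
  have bq : ∀ ij ∈ quadIndex, K.Bg w 2 (fun ω => eval (q ij ω)) := fun ij hij =>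
    (K.of_lipNorm ht hsum hM0 (fun ω hω => hq ω hω ij hij) ((Finset.single_le_sum
      (f := fun ij => lipNorm (anorm η t) γ O (q ij)) (fun _ _ => zero_le) hij).trans hqM)).mono
      (by linarith) (by rw [sq]; exact mul_le_mul_of_nonneg_left hM K.D_pos.le)
  set g := quadCoeff (fun ij ω => eval (q ij ω)) (fun i ω => AiryKAM.dx i (eval (h ω))) with hg
  have bg : ∀ l, K.Sm w 8 (g l) := K.quadCoeff_small hw0.le bq (K.dx_small hw0.le bh)
  have bB : K.Bg w 1 (fun ω => eval (B ω)) :=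
    (K.of_lipNorm ht hsum (by norm_num) (fun ω hω => (hBZ ω hω).1) hB).mono (by linarith)
      (by linarith [K.le_D])
  have bZ : K.Bg w 1 (fun ω => eval (Z ω)) :=
    (K.of_lipNorm ht hsum (by norm_num) (fun ω hω => (hBZ ω hω).2) hZ).mono (by linarith)
      (by linarith [K.le_D])
  have hop : ∀ ω (v : Fn) φ x, airyOp ω (A ω) (B ω) (Z ω) v φ x +
      quadDiff (fun ij => q ij ω) (eval (h ω)) v φ x = thirdOrder ω (fun φ x => 1 + A ω + g 3 ω φ x)
        (g 2 ω) (fun φ x => eval (B ω) φ x + g 1 ω φ x) (fun φ x => eval (Z ω) φ x + g 0 ω φ x) v φ x :=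
    fun ω v φ x => by
      rw [quadDiff_eq q (fun ω => eval (h ω))]
      simp only [airyOp, thirdOrder, Finset.sum_range_succ, Finset.sum_range_zero, ← hg]
      simp only [AiryKAM.dx, iteratedDeriv_zero]
      ring
  simp only [hop] at hham ⊢
  obtain ⟨ξ, β, p, β', α', r, A', B', Z', hsm, hix, bA', hall⟩ := K.exists_reduction (w := w) (k := 8)
    (by linarith) (RBd.of_omega (by norm_num) hA) (bg 3) (bg 2) (bg 1) (bg 0) le_rfl bB bZ hBavg
    fun ω hω φ x => coeff_two_eq hw0 (bg 3) (bg 2) (bg 1) (bg 0) bB bZ hω φ (hham ω hω φ) x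
  simp only [List.forall_mem_cons, List.not_mem_nil, false_imp_iff, implies_true, and_true]
    at hsm hix ⊢
  obtain ⟨bξ, bβ, bp, bβ', bα', br, bB', bZ'⟩ := hsm
  obtain ⟨hβx, hpx, hrx, hβ'x⟩ := hix
  have hv : s - σ ≤ w - 6 * δ := by linarith
  have hv0 : 0 < s - σ := by linarith
  have h3 : s - 3 * σ ≤ s - σ := by linarith
  obtain ⟨Uξ, nξ, mξ, -⟩ := RBd.exists_fourier hv0.le (bξ.width hv)
  obtain ⟨Uβ, nβ, mβ, iβ⟩ := RBd.exists_fourier hv0.le (bβ.width hv)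
  obtain ⟨Up, np, mp, ip⟩ := RBd.exists_fourier hv0.le (bp.width hv)
  obtain ⟨Ur, nr, mr, ir⟩ := RBd.exists_fourier hv0.le (br.width hv)
  obtain ⟨Uα', -, mα', -⟩ := RBd.exists_fourier hv0.le (bα'.width hv)
  obtain ⟨Uβ', -, mβ', iβ'⟩ := RBd.exists_fourier hv0.le (bβ'.width hv)
  obtain ⟨UB, nB, mB, -⟩ := RBd.exists_fourier hv0.le (bB'.width hv)
  obtain ⟨UZ, nZ, mZ, -⟩ := RBd.exists_fourier hv0.le (bZ'.width hv)
  refine ⟨Uξ, Uβ, Up, fun ω => Ur ω + oneF, Uα', Uβ', fun _ => 0, A', fun ω => B ω + UB ω,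
    fun ω => Z ω + UZ ω, ⟨nξ, nβ, np, by simpa only [add_sub_cancel_right] using nr⟩, bA',
    by simpa only [add_sub_cancel_left] using (lipNorm_anorm_mono h3 UB).trans nB,
    by simpa only [add_sub_cancel_left] using (lipNorm_anorm_mono h3 UZ).trans nZ, fun ω hω => ?_⟩
  obtain ⟨hinv, hprod, havg, hconj⟩ := hall ω hω
  have hsub : ({ω} : Set (ℕ → ℝ)) ⊆ O := Set.singleton_subset_iff.2 hω
  have H1 : Setting η γ {ω} := ⟨K.eta_pos, K.gamma_lt, fun ω' h => K.mem_Icc ω' (hsub h)⟩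
  have hT := changeVar_eq_pull hβx hpx (mξ ω hω).2 (mβ ω hω).2 (mp ω hω).2
  have hT' := changeVar_eq_pull (p := fun _ _ _ => 0) hβ'x (fun _ _ _ _ => rfl) (mα' ω hω).2
    (mβ' ω hω).2 (funext fun φ => funext fun x => eval_zero φ x)
  simp only [add_zero] at hT'
  have er := Hs_add hv0.le (mr ω hω).1 (oneF_mem η (s - σ))
  have eB := Hs_add hs.le (Hs_mono (by linarith) (hBZ ω hω).1) (Hs_mono h3 (mB ω hω).1)
  have eZ := Hs_add hs.le (Hs_mono (by linarith) (hBZ ω hω).2) (Hs_mono h3 (mZ ω hω).1)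
  have eB' : eval (B ω + UB ω) = B' ω := funext fun φ => funext fun x => by
    rw [eB.2, (mB ω hω).2, add_sub_cancel]
  have eZ' : eval (Z ω + UZ ω) = Z' ω := funext fun φ => funext fun x => by
    rw [eZ.2, (mZ ω hω).2, add_sub_cancel]
  have hd : 3 * (D ^ 49 * ε) ≤ σ := by
    have := K.pow_mul_eps_le_delta (k := 49) (by omega)
    have := K.pow_mul_eps_nonneg 49
    linarith
  have hv2 : s - σ - σ ≤ s - σ := by linarith
  have hd2 : D ^ 49 * ε ≤ 1 / 2 := (K.pow_mul_eps_le_div (by omega)).trans (by norm_num)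
  have bα := bξ.add bp
  have bdξ := bξ.dx (w' := s - σ) hv0.le (by linarith)
  have bdα' := bα'.dx (w' := s - σ) hv0.le (by linarith)
  refine ⟨⟨(mξ ω hω).1, (mβ ω hω).1, (mp ω hω).1, er.1⟩,
    ⟨Hs_mono (by linarith) (mα' ω hω).1, Hs_mono (by linarith) (mβ' ω hω).1, zero_mem_Hs _ _⟩,
    ⟨eB.1, eZ.1⟩, ⟨iβ hβx ω hω, ip hpx ω hω, fun l j hj => ?_, iβ' hβ'x ω hω, fun _ _ _ => rfl⟩,
    ?_, ?_, fun V => ?_, fun φ => ⟨isSymplectic_fibre K.toSetting (by linarith) bξ hω (mξ ω hω).2 φ,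
      isSymplectic_fibre K.toSetting (by linarith) bα' hω (mα' ω hω).2 φ⟩, fun s₁ hs₁ v hv φ x => ?_, ?_⟩
  · have hne : ((l, j) : Freq) ≠ 0 := fun h => hj (congrArg Prod.snd h)
    beta_reduce
    rw [Pi.add_apply, ir hrx ω hω l j hj, zero_add, oneF, Pi.single_eq_of_ne hne]
  · rw [hT]
    exact boundedOnStrips_pull H1 (α := fun ω φ x => ξ ω φ x + p ω φ x) hd hv2
      (RBd.subset (bβ.mono hv (l := 49) (by omega)) hsub) (RBd.subset (bα.width hv) hsub)
      (RBd.subset (RBd.mono bdξ le_rfl hd2) hsub)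
  · rw [hT']
    exact boundedOnStrips_pull H1 hd hv2 (RBd.subset (bβ'.mono hv (l := 49) (by omega)) hsub)
      (RBd.subset (bα'.mono hv (l := 49) (by omega)) hsub)
      (RBd.subset (RBd.mono bdα' le_rfl hd2) hsub)
  · rw [hT, hT']
    have hl1 : ∀ φ x, - β ω φ x = β' ω (φ + β ω φ x • ω) (x + (ξ ω φ x + p ω φ x)) :=
      fun φ x => (hinv φ x).2.2.1.symm
    have hl2 : ∀ φ x, - (ξ ω φ x + p ω φ x) = α' ω (φ + β ω φ x • ω) (x + (ξ ω φ x + p ω φ x)) :=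
      fun φ x => (hinv φ x).2.2.2.symm
    refine ⟨pull_pull (fun φ x => (hinv φ x).1) (fun φ x => (hinv φ x).2.1) hprod V,
      pull_pull (fun φ x => by rw [← hl1, neg_neg]) (fun φ x => by rw [← hl2, neg_neg])
        (fun φ x => ?_) V⟩
    have h := hprod (φ + β ω φ x • ω) (x + (ξ ω φ x + p ω φ x))
    simp only [CP] at h
    rw [← hl1, ← hl2, add_assoc φ, ← add_smul, add_neg_cancel, zero_smul, add_zero,
      add_neg_cancel_right] at h
    rw [mul_comm]
    exact h
  · rw [hT, hT', er.2, eval_oneF, (mr ω hω).2, hrx ω φ 0 x, add_comm (r ω φ x)]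
    have h := hconj s₁ _ (fun _ => eval v) hs₁ (RBd.of_mem_Hs hs₁.le hv ω) φ x
    simp only [airyOp, eB', eZ']
    exact h
  · rw [eB']
    exact havg

end Scale

/-! ### The choice of the constants -/

/-- All losses at the width `δ = σ / 20` are bounded by `D = exp (c σ^{-μ})`. -/
lemma exists_scale {η μ γbar M : ℝ} (hη : 0 < η) (hμ1 : 1 < μ) (hμ : 1 / η < μ) (hγbar : 0 < γbar)
    (hM : 0 < M) : ∃ c : ℝ, 0 < c ∧ ∀ σ : ℝ, 0 < σ → σ ≤ 1 / 8 → ∀ γ : ℝ, γ < 1 →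
      ∀ O : Set (ℕ → ℝ), O ⊆ Dioph γbar → ∀ ε : ℝ, 0 ≤ ε →
      ε * Real.exp (60 * (c * σ ^ (-μ))) ≤ 1 →
      Scale η γ O (Real.exp (c * σ ^ (-μ))) ε (σ / 20) ∧ M ≤ Real.exp (c * σ ^ (-μ)) ∧
      ∑' k, weight η (-(σ / 20)) k ≤ ENNReal.ofReal (Real.exp (c * σ ^ (-μ))) := by
  obtain ⟨c₁, hc₁, h₁⟩ := exists_smallDivisor_le hη hμ1 hμ hγbar
  obtain ⟨c₂, hc₂, h₂⟩ := exists_tsum_weight_le hη hμ1 hμ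
  have h20 : (0 : ℝ) < 20 ^ μ := by positivity
  -- `20 ^ μ` converts powers of `σ / 20` into powers of `σ`; with `160` the exponential exceeds `100`
  -- and `3 / (σ / 20)`, with `M` it exceeds `M`.
  refine ⟨(c₁ + c₂) * 20 ^ μ + 160 + M, by positivity, fun σ hσ hσ8 γ hγ O hO ε hε hsmall => ?_⟩
  set c := (c₁ + c₂) * 20 ^ μ + 160 + M with hc
  set X := σ ^ (-μ) with hX
  have hX1 : 1 / σ ≤ X := by
    rw [hX, one_div, ← Real.rpow_neg_one]
    exact Real.rpow_le_rpow_of_exponent_ge hσ (by linarith) (by linarith)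
  have hX2 : 1 ≤ X := le_trans (by rw [le_div_iff₀ hσ]; linarith) hX1
  have hδ : (σ / 20) ^ (-μ) = 20 ^ μ * X := by
    rw [Real.div_rpow hσ.le (by norm_num), Real.rpow_neg (by norm_num : (0 : ℝ) ≤ 20), div_inv_eq_mul,
      mul_comm]
  have hc12 : 0 ≤ (c₁ + c₂) * 20 ^ μ := by positivity
  have e1 : Real.exp (c₁ * (σ / 20) ^ (-μ)) ≤ Real.exp (c * X) := by
    rw [hδ, ← mul_assoc, Real.exp_le_exp]
    gcongr
    nlinarith
  have e2 : Real.exp (c₂ * (σ / 20) ^ (-μ)) ≤ Real.exp (c * X) := by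
    rw [hδ, ← mul_assoc, Real.exp_le_exp]
    gcongr
    nlinarith
  have e3 : c * X ≤ Real.exp (c * X) := by linarith [Real.add_one_le_exp (c * X)]
  have e4 : c ≤ c * X := le_mul_of_one_le_right (by linarith) hX2
  refine ⟨⟨⟨hη, hγ, fun ω hω => (hO hω).1⟩, by linarith, hε, ?_, by positivity, ?_, fun w l hl =>
    (h₁ (σ / 20) (by positivity) (by linarith) γ hγ O hO w l hl).trans ?_,
    fun ω hω l hl => (dioph_lower hγbar (hO hω) hl).1⟩, by linarith,
    (h₂ (σ / 20) (by positivity) (by linarith)).trans (ENNReal.ofReal_le_ofReal e2)⟩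
  · rw [← Real.exp_nat_mul, mul_comm]
    exact_mod_cast hsmall
  · have : 3 / (σ / 20) = 60 * (1 / σ) := by field_simp; norm_num
    rw [this]
    nlinarith
  · gcongr

/-- Under the smallness condition, the increments of the coefficients are summable. -/
lemma increment_le {σ ε c X : ℝ} (hσ : 0 < σ) (hc : 0 ≤ c * X)
    (h : ε ≤ σ ^ ((1 : ℝ) + 1) * Real.exp (-(60 * c) * X)) :
    σ ^ (-1 : ℝ) * Real.exp (48 * c * X) * ε ≤ σ := by
  have e : σ ^ (-1 : ℝ) * Real.exp (48 * c * X) * (σ ^ ((1 : ℝ) + 1) * Real.exp (-(60 * c) * X)) =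
      σ * Real.exp (-(12 * (c * X))) := by
    rw [Real.rpow_neg_one, Real.rpow_add hσ, Real.rpow_one, show -(12 * (c * X)) =
      48 * c * X + -(60 * c) * X by ring, Real.exp_add]
    field_simp
  calc _ ≤ σ ^ (-1 : ℝ) * Real.exp (48 * c * X) * (σ ^ ((1 : ℝ) + 1) * Real.exp (-(60 * c) * X)) := by
        gcongr
    _ = σ * Real.exp (-(12 * (c * X))) := e
    _ ≤ σ := mul_le_of_le_one_right hσ.le (Real.exp_le_one_iff.2 (by linarith))

end

end AiryKAM

open AiryKAM in
theorem proposition3p3 :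
    -- the exponents are pure numbers
    ∃ τ₁ τ₂ : ℝ, 0 < τ₁ ∧ 0 < τ₂ ∧
    ∀ η μ γbar γ M : ℝ, 0 < η → max 1 (1 / η) < μ → 0 < γbar → γbar < 1 → 0 < γ → γ < 1 → 0 < M →
    -- the constants do not depend on the step, the widths of the strips, or the operators
    ∃ C C₁ K : ℝ, 0 < C ∧ 0 < C₁ ∧ 0 < K ∧
    ∀ S sbar ε : ℝ, 0 < sbar → sbar < S → 0 < ε →
    ∀ (n : ℕ) (O : Set (ℕ → ℝ)), O ⊆ Dioph γbar →
    ∀ (A : ℕ → (ℕ → ℝ) → ℝ) (B Z : ℕ → (ℕ → ℝ) → Fourier)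
      (q : ℕ × ℕ → (ℕ → ℝ) → Fourier) (h : (ℕ → ℝ) → Fourier),
    -- smallness
    (∀ k ≤ n, eps ε k ≤
      sigma S sbar k ^ (τ₁ + 1) * Real.exp (-C₁ * sigma S sbar k ^ (-μ))) →
    -- the operators `L_0, …, L_n`
    (∀ ω ∈ O, A 0 ω = 0 ∧ B 0 ω = 0 ∧ Z 0 ω = 0) →
    (∀ k < n,
      lipNorm (fun a : ℝ => ‖a‖ₑ) γ O (fun ω => A (k + 1) ω - A k ω) ≤
        ENNReal.ofReal (sigma S sbar k ^ (-τ₂) * Real.exp (C * sigma S sbar k ^ (-μ)) * eps ε k) ∧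
      lipNorm (anorm η (width S sbar k - 3 * sigma S sbar k)) γ O (fun ω => B (k + 1) ω - B k ω) ≤
        ENNReal.ofReal
          (K * (sigma S sbar k ^ (-τ₂) * Real.exp (C * sigma S sbar k ^ (-μ)) * eps ε k)) ∧
      lipNorm (anorm η (width S sbar k - 3 * sigma S sbar k)) γ O (fun ω => Z (k + 1) ω - Z k ω) ≤
        ENNReal.ofReal
          (K * (sigma S sbar k ^ (-τ₂) * Real.exp (C * sigma S sbar k ^ (-μ)) * eps ε k))) →
    (∀ ω ∈ O, B n ω ∈ Hs η (widthCoeff S sbar n) ∧ Z n ω ∈ Hs η (widthCoeff S sbar n)) →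
    (∀ ω ∈ O, ∃ b : ℝ, ∀ φ, avg (eval (B n ω) φ) = b) →
    -- the quadratic part `Q_n`
    (∀ ω ∈ O, ∀ ij ∈ quadIndex, q ij ω ∈ Hs η (widthCoeff S sbar n)) →
    ∑ ij ∈ quadIndex, lipNorm (anorm η (widthCoeff S sbar n)) γ O (q ij) ≤ ENNReal.ofReal M →
    -- the approximate solution `h_n`
    (∀ ω ∈ O, h ω ∈ Hs η (width S sbar n) ∧ ZeroAverage (h ω)) →
    lipNorm (anorm η (width S sbar n)) γ O h ≤ ENNReal.ofReal (eps ε n) →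
    -- `L_n + Q_n'(h_n)` is a Hamiltonian operator
    (∀ ω ∈ O, ∀ φ : ℕ → ℝ, IsHamiltonian fun u x =>
      airyOp ω (A n ω) (B n ω) (Z n ω) (fun _ => u) φ x +
        quadDiff (fun ij => q ij ω) (eval (h ω)) (fun _ => u) φ x) →
    ∃ (ξ β p r ξ' β' p' : (ℕ → ℝ) → Fourier)
      (Anew : (ℕ → ℝ) → ℝ) (Bnew Znew : (ℕ → ℝ) → Fourier),
      -- size of the transformation
      (∀ f ∈ [ξ, β, p, fun ω => r ω - oneF],
        lipNorm (anorm η (width S sbar n - sigma S sbar n)) γ O f ≤ ENNReal.ofReal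
          (K * (sigma S sbar n ^ (-τ₁) * eps ε n * Real.exp (C * sigma S sbar n ^ (-μ))))) ∧
      -- variation of the coefficients
      lipNorm (fun a : ℝ => ‖a‖ₑ) γ O (fun ω => Anew ω - A n ω) ≤
        ENNReal.ofReal (sigma S sbar n ^ (-τ₂) * Real.exp (C * sigma S sbar n ^ (-μ)) * eps ε n) ∧
      lipNorm (anorm η (width S sbar n - 3 * sigma S sbar n)) γ O (fun ω => Bnew ω - B n ω) ≤
        ENNReal.ofReal
          (K * (sigma S sbar n ^ (-τ₂) * Real.exp (C * sigma S sbar n ^ (-μ)) * eps ε n)) ∧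
      lipNorm (anorm η (width S sbar n - 3 * sigma S sbar n)) γ O (fun ω => Znew ω - Z n ω) ≤
        ENNReal.ofReal
          (K * (sigma S sbar n ^ (-τ₂) * Real.exp (C * sigma S sbar n ^ (-μ)) * eps ε n)) ∧
      ∀ ω ∈ O,
        -- all functions are analytic and real on real; `β`, `p`, `r` depend on `φ` only
        (∀ f ∈ [ξ ω, β ω, p ω, r ω], f ∈ Hs η (width S sbar n - sigma S sbar n)) ∧
        (∀ f ∈ [ξ' ω, β' ω, p' ω], f ∈ Hs η (width S sbar n - 2 * sigma S sbar n)) ∧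
        (∀ f ∈ [Bnew ω, Znew ω], f ∈ Hs η (width S sbar n - 3 * sigma S sbar n)) ∧
        (∀ f ∈ [β ω, p ω, r ω, β' ω, p' ω], XIndep f) ∧
        -- `T` is well defined and invertible, and its inverse is of the same form
        BoundedOnStrips η (sigma S sbar n) (width S sbar n - sigma S sbar n)
          (changeVar ω (ξ ω) (β ω) (p ω)) ∧
        BoundedOnStrips η (sigma S sbar n) (width S sbar n - sigma S sbar n)
          (changeVar ω (ξ' ω) (β' ω) (p' ω)) ∧
        (∀ g : Fn,
          changeVar ω (ξ' ω) (β' ω) (p' ω) (changeVar ω (ξ ω) (β ω) (p ω) g) = g ∧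
          changeVar ω (ξ ω) (β ω) (p ω) (changeVar ω (ξ' ω) (β' ω) (p' ω) g) = g) ∧
        -- `T` and its inverse are symplectic
        (∀ φ, IsSymplectic (fibre (ξ ω) (p ω) φ) ∧ IsSymplectic (fibre (ξ' ω) (p' ω) φ)) ∧
        -- `r T⁻¹ (L_n + Q_n'(h_n)) T = ω·∂_φ + (1 + A_{n+1}) ∂_x³ + B_{n+1} ∂_x + C_{n+1}`
        (∀ s > 0, ∀ v ∈ Hs η s, ∀ φ x,
          eval (r ω) φ 0 *
            changeVar ω (ξ' ω) (β' ω) (p' ω)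
              (fun θ y =>
                airyOp ω (A n ω) (B n ω) (Z n ω) (changeVar ω (ξ ω) (β ω) (p ω) (eval v)) θ y +
                quadDiff (fun ij => q ij ω) (eval (h ω))
                  (changeVar ω (ξ ω) (β ω) (p ω) (eval v)) θ y) φ x =
          airyOp ω (Anew ω) (Bnew ω) (Znew ω) (eval v) φ x) ∧
        -- the `x`-average of `B_{n+1}` is constant
        ∃ b : ℝ, ∀ φ, avg (eval (Bnew ω) φ) = b := by
  refine ⟨1, 1, one_pos, one_pos, fun η μ γbar γ M hη hμ hγbar _ hγ0 hγ1 hM => ?_⟩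
  have hμ1 := (le_max_left 1 (1 / η)).trans_lt hμ
  obtain ⟨c, hc, hscale⟩ := exists_scale hη hμ1 ((le_max_right 1 (1 / η)).trans_lt hμ) hγbar hM
  -- With `D = exp (c σ^{-μ})`, the step costs `D ^ 48` and needs `D ^ 60 * ε ≤ 1`. Powers of `1 / σ` are
  -- contained in powers of `D`, so that the exponents `τ₁, τ₂` only have to be positive.
  refine ⟨48 * c, 60 * c, 1, by positivity, by positivity, one_pos, fun S sbar ε hsbar hS hε n O hO A B Z
    q h hsmall hzero hinc hBZ hBavg hq hqM hh hhε hham => ?_⟩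
  have hσ := sigma_pos hS
  have hX : ∀ k, 0 ≤ c * sigma S sbar k ^ (-μ) := fun k =>
    mul_nonneg hc.le (Real.rpow_nonneg (hσ k).le _)
  have hsum : ∑ k ∈ Finset.range n, sigma S sbar k ≤ 1 / 8 := (sum_sigma_le hS n).trans sigmaInit_le
  have hincr : ∀ k < n, sigma S sbar k ^ (-1 : ℝ) * Real.exp (48 * c * sigma S sbar k ^ (-μ)) *
      eps ε k ≤ sigma S sbar k := fun k hk => increment_le (hσ k) (hX k) (hsmall k hk.le)
  have hA : lipNorm (fun a : ℝ => ‖a‖ₑ) γ O (A n) ≤ ENNReal.ofReal (1 / 8) :=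
    (lipNorm_le_sum (fun a b => enorm_add_le a b) enorm_zero (fun ω hω => (hzero ω hω).1)
      (fun k => (hσ k).le) fun k hk => (hinc k hk).1.trans
        (ENNReal.ofReal_le_ofReal (hincr k hk))).trans (ENNReal.ofReal_le_ofReal hsum)
  have hser : ∀ U : ℕ → (ℕ → ℝ) → Fourier, (∀ ω ∈ O, U 0 ω = 0) →
      (∀ k < n, lipNorm (anorm η (width S sbar k - 3 * sigma S sbar k)) γ O
        (fun ω => U (k + 1) ω - U k ω) ≤ ENNReal.ofReal (1 * (sigma S sbar k ^ (-1 : ℝ) *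
          Real.exp (48 * c * sigma S sbar k ^ (-μ)) * eps ε k))) →
      lipNorm (anorm η (widthCoeff S sbar n)) γ O (U n) ≤ ENNReal.ofReal (1 / 8) := fun U h0 hU =>
    (lipNorm_le_sum (anorm_add_le η _) (anorm_zero η _) h0 (fun k => (hσ k).le) fun k hk =>
      ((lipNorm_anorm_mono (widthCoeff_le hS hk) _).trans (hU k hk)).trans
        (ENNReal.ofReal_le_ofReal (by rw [one_mul]; exact hincr k hk))).trans
      (ENNReal.ofReal_le_ofReal hsum)
  have hB := hser B (fun ω hω => (hzero ω hω).2.1) fun k hk => (hinc k hk).2.1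
  have hZ := hser Z (fun ω hω => (hzero ω hω).2.2) fun k hk => (hinc k hk).2.2
  have hσ8 := sigma_le hS n
  have hεn : 0 ≤ eps ε n := mul_nonneg hε.le (Real.exp_nonneg _)
  obtain ⟨K, hMD, hD⟩ := hscale (sigma S sbar n) (hσ n) hσ8 γ hγ1 O hO (eps ε n) hεn (by
    have h1 := hsmall n le_rfl
    have h2 : sigma S sbar n ^ ((1 : ℝ) + 1) ≤ 1 :=
      Real.rpow_le_one (hσ n).le (by linarith) (by norm_num)
    calc _ ≤ 1 * Real.exp (-(60 * c) * sigma S sbar n ^ (-μ)) *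
          Real.exp (60 * (c * sigma S sbar n ^ (-μ))) := by
          gcongr
          exact h1.trans (by gcongr)
      _ = 1 := by
          rw [one_mul, ← Real.exp_add, Real.exp_eq_one_iff]
          ring)
  obtain ⟨ξ, β, p, r, ξ', β', p', A', B', Z', h1, h2, h3, h4, h5⟩ := K.exists_step
    (σ := sigma S sbar n) (s := width S sbar n) (by ring) (by linarith [width_pos hsbar hS n, hσ n])
    (width_le_widthCoeff hS n) hD hM.le hMD hA hB hZ hBZ hBavg hq hqM (fun ω hω => (hh ω hω).1) hhε hham
  have hfin : Real.exp (c * sigma S sbar n ^ (-μ)) ^ 48 * eps ε n ≤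
      sigma S sbar n ^ (-1 : ℝ) * Real.exp (48 * c * sigma S sbar n ^ (-μ)) * eps ε n := by
    have h1 : 1 ≤ sigma S sbar n ^ (-1 : ℝ) :=
      Real.one_le_rpow_of_pos_of_le_one_of_nonpos (hσ n) (by linarith) (by norm_num)
    rw [← Real.exp_nat_mul, mul_assoc (48 : ℝ)]
    refine mul_le_mul_of_nonneg_right ?_ hεn
    exact_mod_cast le_mul_of_one_le_left (Real.exp_nonneg _) h1
  exact ⟨ξ, β, p, r, ξ', β', p', A', B', Z',
    fun f hf => (h1 f hf).trans (ENNReal.ofReal_le_ofReal (by rw [one_mul, mul_right_comm]; exact hfin)),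
    h2.trans (ENNReal.ofReal_le_ofReal hfin),
    h3.trans (ENNReal.ofReal_le_ofReal (by rw [one_mul]; exact hfin)),
    h4.trans (ENNReal.ofReal_le_ofReal (by rw [one_mul]; exact hfin)), h5⟩
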